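/- **Setting.** Let $\mathrm T$ be a set with a preorder $\le$; write $\mathrm t<\mathrm t'$ if $\mathrm t\le \mathrm t'\not\le \mathrm t$, and let $[\mathrm T]$ be the partially ordered set of classes $t$ of $\sim$, where $\mathrm t\sim\mathrm t'$ iff $\mathrm t\le\mathrm t'\le\mathrm t$. Let $J$ be the set of those $j\subseteq\mathrm T$ with no $\mathrm t<\mathrm t'$ in $j$, $K$ the set of finite $k\in J$, $L$ the set of maximal $l\in J$. For $j,j'\subseteq\mathrm T$ put $j\le j'$ iff every point of $j$ is $\le$ some point of $j'$; $j\sim j'$ iff $j\le j'\le j$; $j\Join j'$ iff no point of $j$ is comparable with a point of $j'$; $k\vee k'=\max(k\cup k')$ (maximal points); $[j]$ is the set of classes that meet $j$. A semigroup $S$ acts on $\mathrm T$ with $s\mathrm t\le s\mathrm t'\Leftrightarrow \mathrm t\le\mathrm t'$. Given are: - a Hilbert space $\mathcal K$, a unitary representation $U$ of $S$ on $\mathcal K$, and unital $*$-subalgebras $\mathfrak A_k\subseteq\mathcal B(\mathcal K)$, $k\in K$, with $\mathfrak A_\emptyset=\mathcal B(\mathcal K)$, $\mathfrak A_k\supseteq\mathfrak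 A_{k'}$ for $k\le k'$, $\mathfrak A_{k\vee k'}=\mathfrak A_k\cap\mathfrak A_{k'}$, such that $a\mapsto a^s=U_s^*aU_s$ maps $\mathfrak A_{sk}$ onto $\mathfrak A_k$; put $\mathfrak A_l=\bigcap_{k\subseteq l}\mathfrak A_k$ for $l\in L$; - nonempty sets $\mathrm E_t$, $t\in[\mathrm T]$, and for $k\in K$ a system $\mathcal B_k$ of subsets of $\mathrm E_k=\prod_{t\in[k]}\mathrm E_t$ that contains $\emptyset$ and $\mathrm E_k$, is closed under intersection, and each member of which belongs to a countable partition of $\mathrm E_k$ into members; $\mathcal B_k\cup\mathcal B_{k'}\subseteq\mathcal B_{k\cup k'}$ if $k\sim k'$, and $\mathcal B_{k\cup k'}=\{B\times B'\}$ if $k\Join k'$; maps $g_s:\mathrm E_t\to\mathrm E_{st}$ with $g_sg_{s'}=g_{ss'}$ such that $B\mapsto B^s=g_s^{-1}(B)$ maps $\mathcal B_{sk}$ onto $\mathcal B_k$. For finite $\Lambda\subseteq\mathrm T$ let $\mathcal B^\Lambda$ be the set of functions $b$ on $[\mathrm T]$ with $b(t)\in\mathcal B_{\Lambda\cap t}$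 for $t\in[\Lambda]$ and $b(t)=\mathrm E_t$ otherwise; $\mathfrak B=\bigcup_\Lambda\mathcal B^\Lambda$, $\mathfrak B_l=\bigcup_{\Lambda\le l}\mathcal B^\Lambda$; $e(t)=\mathrm E_t$ for all $t$; for $j\in J$ put $b(j)=\prod_{t\in[j]}b(t)$ (a cylinder if $j$ is infinite). **Hypothesis.** Let $\kappa:\mathfrak B\times\mathfrak B\to\mathcal B(\mathcal K)$ (equivalently, the projective system of its restrictions $\kappa^\Lambda$ to $\mathcal B^\Lambda\times\mathcal B^\Lambda$) be an $S$-covariant process in the wide sense: $\kappa^\Lambda$ has values in the commutant $\mathfrak A_{\max\Lambda}'$, and 1⁰ $\sum_{i,i'}(\zeta_i|\kappa(b^i,b^{i'})\zeta_{i'})\ge0$ for all finite families $b^i\in\mathfrak B$, $\zeta_i\in\mathcal K$; 2⁰ $\kappa(e,e)=1$; 3⁰ $\kappa(b,b)=\sum_m\kappa(b^m,b^m)$ weakly, whenever $l\in L$, $\Lambda\le l$, $b,b^m\in\mathcal B^\Lambda$, $b^m(t)=b(t)$ for $t\notin[l]$, and $b(l)$ is the disjoint union of the $b^m(l)$, $m\in\mathbb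 N$; 4⁰ $\kappa(bB,b')=\kappa(b,b'B)$ for $b,b'\in\mathfrak B_l$, $l\in L$, and $B\in\mathcal B_k$ with $k\subset t\in[l]$, where $bB$ is $b$ with $b(t)$ replaced by $b(t)\cap B$; 5⁰ $U_s^*\kappa(b,b')U_s=\kappa(b^s,b'^s)$ for $b,b'\in\mathcal B^{s\Lambda}$, where $b^s(t)=b(st)^s$. **Conclusion.** There are a Hilbert space $\mathcal H\supseteq\mathcal K$, with projection $\mathrm P$ onto $\mathcal K$, an isometric representation $V$ of $S$ on $\mathcal H$ that extends $U$, faithful $*$-representations $\iota_k:\mathfrak A_k\to\mathcal B(\mathcal H)$ and projection-valued maps $\pi_k^*$ on $\mathcal B_k$, $k\in K$, with $I_k=\iota_k(1)$ and $P_k^*=\pi_k^*(\mathrm E_k)$, such that: (i) $\iota_k(a)=\iota_{k'}(a)I_k$ for $k\le k'$, $a\in\mathfrak A_{k'}$; $\iota_\emptyset(a)=a\mathrm P$; $V_s\iota_k(a^s)=\iota_{sk}(a)V_sI_k$ for $a\in\mathfrak A_{sk}$. (ii) $P_k^*I_k=I_k$, $P^*_\emptyset=\mathrm I$; $\pi^*_{k\cup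 k'}(B\cap B')=\pi_k^*(B)\pi_{k'}^*(B')$ if $k\sim k'$; $\pi^*_{k\cup k'}(B\times B')=\pi_k^*(B)\pi_{k'}^*(B')P^*_{k\cup k'}$ if $k\Join k'$; $P_k^*=\sum_m\pi_k^*(B^m)$ strongly for every countable partition of $\mathrm E_k$ into $B^m\in\mathcal B_k$; $\pi_k^*(B)$ commutes with $\iota_k(a)$; $V_s\pi^*_k(B^s)=\pi^*_{sk}(B)V_sP^*_k$ for $B\in\mathcal B_{sk}$. (iii) $F^\Lambda(b)^*F^\Lambda(b')=\kappa^\Lambda(b,b')$ on $\mathcal K$ (and $0$ on $\mathcal K^\perp$) for $b,b'\in\mathcal B^\Lambda$, where $F^\Lambda(b)=\pi^*_{k_n}(b(k_n))\cdots\pi^*_{k_1}(b(k_1))I_\emptyset$ and $k_n=\max\Lambda$, $k_{n-1}=\max(\Lambda\setminus k_n),\dots$ are the layers of $\Lambda$. (iv) Let $E_l$, $l\in L$, be the projection onto the closed span $\mathcal H_l$ of the vectors $F^\Lambda(b)\zeta$, $\Lambda\le l$, $b\in\mathcal B^\Lambda$, $\zeta\in\mathcal K$. Then $P_k^*=\bigvee_{l\supseteq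 k}E_l=\bigvee_{l\supseteq k}\bigwedge_{k'\subseteq l}P^*_{k'}$ for $k\in K$, and $\bigvee_{k\subseteq l}I_k=E_l\le\bigwedge_{k\subseteq l}P_k^*$ for $l\in L$, with equality if $l$ has finitely many classes. (v) Suppose in addition that $\mathfrak A_k=\bigvee_{l\supseteq k}\mathfrak A_l$ (generated $*$-algebra) for $\emptyset\ne k\in K$ and that for all $b\in\mathfrak B$, $\zeta\in\mathcal K$ $$\lim_{l\downarrow\emptyset}\ \sup\Big|\sum_i\big(\zeta_i\big|(\kappa(b^i,b)-\kappa(b^i,e)\kappa(e,b))\zeta\big)\Big|=0,$$ the supremum being over the finite families $\zeta_i\in\mathcal K$, $b^i\in\mathfrak B_l$ with $\sum_{i,i'}(\zeta_i|\kappa(b^i,b^{i'})\zeta_{i'})\le1$, and the limit along $L$ directed downwards. Then $E_l\downarrow\mathrm P$ strongly as $l\downarrow\emptyset$, and there are faithful $*$-representations $\iota_k^*$ of $\mathfrak A_k$ on $\mathcal H$ with $\iota^*_k(1)=\bigwedge_{l\supseteq k}E_l$ for all $k\in K$ such that the conditions of (i), (ii), (iii) that do not involve $V$ hold with $\iota^*$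 in place of $\iota$; if each $s\in S$ acts surjectively on $[\mathrm T]$ (e.g. if $S$ is a group), all of (i)–(iii) hold for $\iota^*$. (vi) For $l\in L$ let $\mathcal B_l=\bigcup_{k\subseteq l}\mathcal B_k$ (cylinders), $\pi^*_l(B)=\pi_k^*(B)E_l$ for $B\in\mathcal B_k$, $k\subseteq l$, and for $a\in\mathfrak A_l$ let $\iota_l(a)=\iota_l(a)E_l$ be determined by $\iota_l(a)I_k=\iota_k(a)$, $k\subseteq l$. Suppose that on some Hilbert spaces $\mathcal G_l$, $l\in L$, there are unital σ-representations $\pi_l$ of $\mathcal B_l$ by projections (multiplicative, and σ-additive on each $\mathcal B_k$, $k\subseteq l$) and unital $*$-representations $\iota^0_l:\mathfrak A_l\to\pi_l(\mathcal B_l)'$, generating the W*-algebras $\mathcal A_l=\pi_l(\mathcal B_l)\vee\iota^0_l(\mathfrak A_l)$, and normal positive linear maps $\rho_l:\mathcal A_l\to\mathcal B(\mathcal K)$ and $\theta_{ll'}:\mathcal A_{l'}\to\mathcal A_l$, $l\le l'$, with $\rho_l(A\iota^0_l(a))=\rho_l(A)a$ for $a\in\mathfrak A_l$ and $\theta_{ll'}(A\iota^0_{l'}(a))=\theta_{ll'}(A)\iota^0_l(a)$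 for $a\in\mathfrak A_{l'}$, such that $$\kappa(b,b')=\rho_{l_1}\big(\pi_{l_1}(B_1)\theta_{l_1l_2}(\pi_{l_2}(B_2)\cdots\theta_{l_{n-1}l_n}(\pi_{l_n}(B_n))\cdots)\big),\qquad B_i=\prod_{t\in[l_i]}b(t)\cap b'(t),$$ for every chain $l_1\le\dots\le l_n$ in $L$ and all $b,b'\in\mathfrak B$ with $b(t)=b'(t)=\mathrm E_t$ for $t\notin\bigcup_i[l_i]$. Then the canonical realization has the conditional Markov property $$E_l\,\pi^*_{l'}(\mathcal B_{l'})\,E_l\subseteq\pi^*_l(\mathcal B_l)\vee\iota_l(\mathfrak A_l)\quad\text{(generated W*-algebra)},\qquad l\le l'\in L.$$ -/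

import Mathlib

open scoped ComplexOrder InnerProductSpace

universe uS uT uE uK uH uG

namespace QSP

noncomputable section

/-! ### Causality -/

section Causality

variable {T : Type uT} [Preorder T]

/-- A set of pairwise nonanticipatory points: no point strictly precedes another one.
Such sets form the class `J`; the finite ones form the class `K`. -/
def Nonanticipatory (j : Set T) : Prop :=
  ∀ t ∈ j, ∀ t' ∈ j, ¬ t < t'

/-- The causal preorder `j ≤ j'` on sets of points. -/
def CausalLE (j j' : Set T) : Prop :=
  ∀ t ∈ j, ∃ t' ∈ j', t ≤ t'

/-- Causal equivalence `j ∼ j'` of sets of points. -/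
def CausalEquiv (j j' : Set T) : Prop :=
  CausalLE j j' ∧ CausalLE j' j

/-- Causal independence `j ⋈ j'`: no point of `j` is comparable with a point of `j'`. -/
def CausalIndep (j j' : Set T) : Prop :=
  ∀ t ∈ j, ∀ t' ∈ j', ¬ t ≤ t' ∧ ¬ t' ≤ t

/-- The class `L` of the maximal sets of pairwise nonanticipatory points. -/
def Slice (T : Type uT) [Preorder T] : Type uT :=
  {l : Set T // Maximal Nonanticipatory l}

/-- The quotient of `T` by causal equivalence, a partially ordered set. -/
abbrev Cls (T : Type uT) [Preorder T] : Type uT :=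
  Antisymmetrization T (· ≤ ·)

/-- The equivalence class of a point. -/
def cls (t : T) : Cls T := toAntisymmetrization (· ≤ ·) t

/-- The set `[j]` of the classes that meet `j`. -/
def clsOf (j : Set T) : Set (Cls T) := cls '' j

/-- `c ≤ j` for a class `c` and a set of points `j`. -/
def ClsLE (c : Cls T) (j : Set T) : Prop := ∃ t ∈ j, c ≤ cls t

open Classical in
/-- The set `max Λ` of the maximal points of a finite set. -/
def top (Λ : Finset T) : Finset T :=
  Λ.filter fun t => ∀ u ∈ Λ, ¬ t < u

open Classical in
/-- The part of a finite set that lies in a given class. -/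
def inClass (Λ : Finset T) (c : Cls T) : Finset T :=
  Λ.filter fun t => cls t = c

open Classical in
/-- The union of two finite sets (with classical decidability). -/
def union (k k' : Finset T) : Finset T := k ∪ k'

open Classical in
theorem card_sdiff_top_lt {Λ : Finset T} (h : Λ ≠ ∅) : (Λ \ top Λ).card < Λ.card := by
  obtain ⟨t, ht⟩ := Finset.exists_maximal (Finset.nonempty_iff_ne_empty.mpr h)
  refine Finset.card_lt_card ⟨Finset.sdiff_subset, fun hs => ?_⟩
  have h1 := hs ht.1
  rw [Finset.mem_sdiff] at h1
  refine h1.2 (Finset.mem_filter.mpr ⟨ht.1, fun u hu htu => ?_⟩)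
  exact htu.not_ge (ht.2 hu htu.le)

open Classical in
/-- The chain `k_n > ⋯ > k_1` of the layers of a finite set `Λ`, listed from the top
`k_n = max Λ` down: remove the maximal points and repeat. -/
def layers (Λ : Finset T) : List (Finset T) :=
  if _h : Λ = ∅ then [] else top Λ :: layers (Λ \ top Λ)
termination_by Λ.card
decreasing_by exact card_sdiff_top_lt _h

end Causality

/-- A semigroup of transformations of `T` that preserve and reflect the causal preorder. -/
class CausalAction (S : Type uS) (T : Type uT) [Semigroup S] [Preorder T] extends
    SemigroupAction S T where
  smul_le_smul_iff' : ∀ (s : S) (t t' : T), s • t ≤ s • t' ↔ t ≤ t'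

section Action

variable {S : Type uS} {T : Type uT} [Semigroup S] [Preorder T] [CausalAction S T]

/-- The induced transformation of the classes. -/
def clsMap (s : S) (c : Cls T) : Cls T :=
  Quotient.liftOn' c (fun t => cls (s • t)) fun t t' (h : t ≤ t' ∧ t' ≤ t) =>
    Quotient.sound' (show s • t ≤ s • t' ∧ s • t' ≤ s • t from
      ⟨(CausalAction.smul_le_smul_iff' s t t').2 h.1,
        (CausalAction.smul_le_smul_iff' s t' t).2 h.2⟩)

open Classical in
/-- The image `s k` of a finite set of points. -/
def image (s : S) (k : Finset T) : Finset T := k.image fun t => s • t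

end Action

/-! ### The objects a process refers to -/

/-- Boolean σ-semirings of subsets of `Ω`, with unit: closed under intersection, and each
member belongs to a countable partition of the unit into members. -/
structure IsSigmaSemiring {Ω : Type*} (C : Set (Set Ω)) : Prop where
  empty_mem : ∅ ∈ C
  univ_mem : Set.univ ∈ C
  inter_mem : ∀ B ∈ C, ∀ B' ∈ C, B ∩ B' ∈ C
  partition : ∀ B ∈ C, ∃ f : ℕ → Set Ω, (∀ m, f m ∈ C) ∧
    Pairwise (fun m m' => Disjoint (f m) (f m')) ∧ (⋃ m, f m) = Set.univ ∧ ∃ m, f m = B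

/-- The data with respect to which processes are considered: the scales `E_c` of the classes, the
semirings `𝓑_k` of events, the algebras `𝔄_k` and the representations of `S` on them.
An event of `𝓑_k` is a subset of `∏_{c ∈ [k]} E_c`; it is represented by the corresponding
cylinder in `∏_c E_c`, so that `E_k` is the whole space and `B × B'` is `B ∩ B'`. -/
structure Setting (S : Type uS) (T : Type uT) (K : Type uK) [Semigroup S] [Preorder T]
    [CausalAction S T] [NormedAddCommGroup K] [InnerProductSpace ℂ K] [CompleteSpace K] where
  /-- the scale of a class -/
  E : Cls T → Type uE
  nonempty : ∀ c, Nonempty (E c)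
  /-- the semiring of events of a finite set of pairwise nonanticipatory points -/
  𝓑 : Finset T → Set (Set (∀ c, E c))
  semiring : ∀ k : Finset T, Nonanticipatory (k : Set T) → IsSigmaSemiring (𝓑 k)
  cylinder : ∀ k : Finset T, Nonanticipatory (k : Set T) → ∀ B ∈ 𝓑 k, ∀ x y : ∀ c, E c,
    (∀ c ∈ clsOf (k : Set T), x c = y c) → x ∈ B → y ∈ B
  𝓑_equiv : ∀ k k' : Finset T, Nonanticipatory (k : Set T) → Nonanticipatory (k' : Set T) →
    CausalEquiv (k : Set T) k' → 𝓑 k ∪ 𝓑 k' ⊆ 𝓑 (union k k')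
  𝓑_indep : ∀ k k' : Finset T, Nonanticipatory (k : Set T) → Nonanticipatory (k' : Set T) →
    CausalIndep (k : Set T) k' →
    𝓑 (union k k') = {A | ∃ B ∈ 𝓑 k, ∃ B' ∈ 𝓑 k', A = B ∩ B'}
  /-- the algebra of a finite set of pairwise nonanticipatory points -/
  𝔄 : Finset T → StarSubalgebra ℂ (K →L[ℂ] K)
  𝔄_empty : 𝔄 ∅ = ⊤
  𝔄_anti : ∀ k k' : Finset T, Nonanticipatory (k : Set T) → Nonanticipatory (k' : Set T) →
    CausalLE (k : Set T) k' → 𝔄 k' ≤ 𝔄 k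
  𝔄_sup : ∀ k k' : Finset T, Nonanticipatory (k : Set T) → Nonanticipatory (k' : Set T) →
    𝔄 (top (union k k')) = 𝔄 k ⊓ 𝔄 k'
  /-- the unitary representation of `S` on the space `K` -/
  U : S →ₙ* (K ≃ₗᵢ[ℂ] K)
  /-- the action of `S` on the scales -/
  g : ∀ (s : S) (c : Cls T), E c → E (clsMap s c)
  g_mul : ∀ (s s' : S) (c : Cls T) (x : E c),
    (⟨_, g s _ (g s' c x)⟩ : Σ c, E c) = ⟨_, g (s * s') c x⟩
  /-- `a ↦ U_s* a U_s` maps `𝔄_{sk}` onto `𝔄_k` -/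
  𝔄_image : ∀ (s : S) (k : Finset T), Nonanticipatory (k : Set T) →
    (fun a : K →L[ℂ] K => ContinuousLinearMap.adjoint ((U s).toContinuousLinearEquiv : K →L[ℂ] K)
      ∘L a ∘L ((U s).toContinuousLinearEquiv : K →L[ℂ] K)) '' (𝔄 (image s k)) = 𝔄 k
  /-- taking the inverse image under `g_s` maps `𝓑_{sk}` onto `𝓑_k` -/
  𝓑_image : ∀ (s : S) (k : Finset T), Nonanticipatory (k : Set T) →
    (fun B : Set (∀ c, E c) => {x : ∀ c, E c | ∃ y ∈ B, ∀ c, y (clsMap s c) = g s c (x c)}) ''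
      (𝓑 (image s k)) = 𝓑 k

section WideSense

variable {S : Type uS} {T : Type uT} {K : Type uK} [Semigroup S] [Preorder T] [CausalAction S T]
  [NormedAddCommGroup K] [InnerProductSpace ℂ K] [CompleteSpace K]

namespace Setting

variable (X : Setting.{uS, uT, uE, uK} S T K)

/-- The product of all scales. -/
abbrev Ω : Type (max uT uE) := ∀ c, X.E c

/-- The unitary operator `U_s`. -/
def Uop (s : S) : K →L[ℂ] K := ((X.U s).toContinuousLinearEquiv : K →L[ℂ] K)

/-- `a^s = U_s* a U_s`. -/
def conj (s : S) (a : K →L[ℂ] K) : K →L[ℂ] K :=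
  ContinuousLinearMap.adjoint (X.Uop s) ∘L a ∘L X.Uop s

/-- `B^s`, the inverse image of the event `B` under `g_s`. -/
def pull (s : S) (B : Set X.Ω) : Set X.Ω :=
  {x | ∃ y ∈ B, ∀ c, y (clsMap s c) = X.g s c (x c)}

/-- The set `𝔅` of the functions `b` on the classes with `b(c) ∈ 𝓑_c = ⋃_{k ⊂ c} 𝓑_k` and
`b(c) = E_c` for all but finitely many classes. -/
def Paths : Set (Cls T → Set X.Ω) :=
  {b | (∀ c, ∃ k : Finset T, (∀ t ∈ k, cls t = c) ∧ b c ∈ X.𝓑 k) ∧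
    {c | b c ≠ Set.univ}.Finite}

/-- The set `𝔅_j` of the functions `b ∈ 𝔅` with `b(c) = E_c` unless `c ≤ j`. -/
def PathsBelow (j : Set T) : Set (Cls T → Set X.Ω) :=
  {b | b ∈ X.Paths ∧ ∀ c, b c ≠ Set.univ → ClsLE c j}

/-- The set `𝓑^Λ`, embedded in `𝔅`: `b(c) ∈ 𝓑_{Λ ∩ c}` for `c ∈ [Λ]`, and `b(c) = E_c`
otherwise. -/
def PathsOn (Λ : Finset T) : Set (Cls T → Set X.Ω) :=
  {b | ∀ c, (c ∈ clsOf (Λ : Set T) → b c ∈ X.𝓑 (inClass Λ c)) ∧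
    (c ∉ clsOf (Λ : Set T) → b c = Set.univ)}

/-- The unit function `e`. -/
def unit : Cls T → Set X.Ω := fun _ => Set.univ

/-- The event `×_{c ∈ [j]} b(c)`. -/
def box (b : Cls T → Set X.Ω) (j : Set T) : Set X.Ω := ⋂ c ∈ clsOf j, b c

open Classical in
/-- `bB` for an event `B` of the class `c`. -/
def mulAt (b : Cls T → Set X.Ω) (c : Cls T) (B : Set X.Ω) : Cls T → Set X.Ω :=
  Function.update b c (b c ∩ B)

/-- `b^s(c) = b(sc)^s`. -/
def pathPull (s : S) (b : Cls T → Set X.Ω) : Cls T → Set X.Ω :=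
  fun c => X.pull s (b (clsMap s c))

/-- The algebra `𝔄_l = ⋂_{k ⊆ l} 𝔄_k` of a slice. -/
def sliceAlg (l : Slice T) : StarSubalgebra ℂ (K →L[ℂ] K) :=
  ⨅ (k : Finset T) (_ : (k : Set T) ⊆ l.1), X.𝔄 k

/-- The semiring `𝓑_l` of the cylinders of a slice. -/
def sliceEvents (l : Slice T) : Set (Set X.Ω) :=
  {B | ∃ k : Finset T, (k : Set T) ⊆ l.1 ∧ B ∈ X.𝓑 k}

/-- The `S`-covariant processes in the wide sense. The projective system of multikernels is
given by the function `κ` on `𝔅 × 𝔅`; the multikernel `κ^Λ` is its restriction to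
`𝓑^Λ × 𝓑^Λ`. (Values of `κ` outside `𝔅 × 𝔅` play no role.) -/
structure IsWideSense (κ : (Cls T → Set X.Ω) → (Cls T → Set X.Ω) → K →L[ℂ] K) : Prop where
  /-- the values of `κ^Λ` commute with `𝔄_{max Λ}` -/
  commutant : ∀ Λ : Finset T, ∀ b ∈ X.PathsOn Λ, ∀ b' ∈ X.PathsOn Λ, ∀ a ∈ X.𝔄 (top Λ),
    Commute a (κ b b')
  positivity : ∀ (m : ℕ) (b : Fin m → Cls T → Set X.Ω) (ζ : Fin m → K), (∀ i, b i ∈ X.Paths) →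
    0 ≤ ∑ i, ∑ i', ⟪ζ i, κ (b i) (b i') (ζ i')⟫_ℂ
  normalization : κ X.unit X.unit = 1
  sigma_additivity : ∀ (l : Slice T) (Λ : Finset T), CausalLE (Λ : Set T) l.1 →
    ∀ b ∈ X.PathsOn Λ, ∀ f : ℕ → Cls T → Set X.Ω, (∀ m, f m ∈ X.PathsOn Λ) →
    (∀ m, ∀ c ∉ clsOf l.1, f m c = b c) →
    Pairwise (fun m m' => Disjoint (X.box (f m) l.1) (X.box (f m') l.1)) →
    X.box b l.1 = ⋃ m, X.box (f m) l.1 →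
    ∀ ζ : K, HasSum (fun m => ⟪ζ, κ (f m) (f m) ζ⟫_ℂ) ⟪ζ, κ b b ζ⟫_ℂ
  factorizability : ∀ l : Slice T, ∀ b ∈ X.PathsBelow l.1, ∀ b' ∈ X.PathsBelow l.1,
    ∀ c ∈ clsOf l.1, ∀ k : Finset T, (∀ t ∈ k, cls t = c) → ∀ B ∈ X.𝓑 k,
    κ (X.mulAt b c B) b' = κ b (X.mulAt b' c B)
  covariance : ∀ (s : S) (Λ : Finset T), ∀ b ∈ X.PathsOn (image s Λ),
    ∀ b' ∈ X.PathsOn (image s Λ),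
    ContinuousLinearMap.adjoint (X.Uop s) ∘L κ b b' ∘L X.Uop s =
      κ (X.pathPull s b) (X.pathPull s b')

/-- Asymptotic noncorrelation with the distant past: the limit, over the slices directed
downwards, of the supremum over the finite families `(ζ_i, b^i)` with `b^i ∈ 𝔅_l` and
`∑ (ζ_i | κ(b^i, b^{i'}) ζ_{i'}) ≤ 1` is zero. -/
def AsymptoticNoncorrelation (κ : (Cls T → Set X.Ω) → (Cls T → Set X.Ω) → K →L[ℂ] K) : Prop :=
  ∀ b ∈ X.Paths, ∀ ζ : K, ∀ ε > (0 : ℝ), ∃ l₀ : Slice T, ∀ l : Slice T, CausalLE l.1 l₀.1 →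
    ∀ (m : ℕ) (f : Fin m → Cls T → Set X.Ω) (z : Fin m → K), (∀ i, f i ∈ X.PathsBelow l.1) →
      ∑ i, ∑ i', ⟪z i, κ (f i) (f i') (z i')⟫_ℂ ≤ 1 →
      ‖∑ i, ⟪z i, (κ (f i) b - κ (f i) X.unit * κ X.unit b) ζ⟫_ℂ‖ ≤ ε

end Setting

end WideSense

/-! ### Processes on a Hilbert space -/

section Processes

variable {S : Type uS} {T : Type uT} {K : Type uK} [Semigroup S] [Preorder T] [CausalAction S T]
  [NormedAddCommGroup K] [InnerProductSpace ℂ K] [CompleteSpace K]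
  (X : Setting.{uS, uT, uE, uK} S T K)
  {H : Type uH} [NormedAddCommGroup H] [InnerProductSpace ℂ H] [CompleteSpace H]
  (J : K →ₗᵢ[ℂ] H)
  (ι : ∀ k : Finset T, X.𝔄 k →⋆ₙₐ[ℂ] (H →L[ℂ] H))
  (π : Finset T → Set X.Ω → H →L[ℂ] H)
  (V : S →ₙ* (H →ₗᵢ[ℂ] H))

/-- The embedding `K → H` as a bounded operator. -/
abbrev emb : K →L[ℂ] H := J.toContinuousLinearMap

/-- Self-consistent systems of faithful representations of the algebras `𝔄_k` on a Hilbert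
space `H` that contains `K` (through the isometry `J`). The units `I_k = ι_k(1)` are projections,
in general different from the identity. -/
structure IsRepSystem : Prop where
  faithful : ∀ k : Finset T, Nonanticipatory (k : Set T) → Function.Injective (ι k)
  consistent : ∀ k k' : Finset T, Nonanticipatory (k : Set T) → Nonanticipatory (k' : Set T) →
    CausalLE (k : Set T) k' → ∀ (a : K →L[ℂ] K) (h : a ∈ X.𝔄 k) (h' : a ∈ X.𝔄 k'),
    ι k ⟨a, h⟩ = ι k' ⟨a, h'⟩ * ι k 1
  identity : ∀ a : X.𝔄 ∅,
    ι ∅ a = emb J ∘L (a : K →L[ℂ] K) ∘L ContinuousLinearMap.adjoint (emb J)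

/-- `H`-processes over `𝓑` with respect to `(𝔄, ι)`. -/
structure IsHSystem : Prop where
  projection : ∀ k : Finset T, Nonanticipatory (k : Set T) → ∀ B ∈ X.𝓑 k,
    IsStarProjection (π k B)
  normalized : ∀ k : Finset T, Nonanticipatory (k : Set T) →
    π k Set.univ * ι k 1 = ι k 1
  unit_empty : π ∅ Set.univ = 1
  equiv : ∀ k k' : Finset T, Nonanticipatory (k : Set T) → Nonanticipatory (k' : Set T) →
    CausalEquiv (k : Set T) k' → ∀ B ∈ X.𝓑 k, ∀ B' ∈ X.𝓑 k',
    π (union k k') (B ∩ B') = π k B * π k' B'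
  indep : ∀ k k' : Finset T, Nonanticipatory (k : Set T) → Nonanticipatory (k' : Set T) →
    CausalIndep (k : Set T) k' → ∀ B ∈ X.𝓑 k, ∀ B' ∈ X.𝓑 k',
    π (union k k') (B ∩ B') = π k B * π k' B' * π (union k k') Set.univ
  sigma_additive : ∀ k : Finset T, Nonanticipatory (k : Set T) → ∀ f : ℕ → Set X.Ω,
    (∀ m, f m ∈ X.𝓑 k) → Pairwise (fun m m' => Disjoint (f m) (f m')) →
    (⋃ m, f m) = Set.univ → ∀ x : H, HasSum (fun m => π k (f m) x) (π k Set.univ x)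
  commute : ∀ k : Finset T, Nonanticipatory (k : Set T) → ∀ B ∈ X.𝓑 k, ∀ a : X.𝔄 k,
    Commute (π k B) (ι k a)

/-- Covariance of `ι` and `π` with respect to an isometric representation `V` of `S` that extends
the unitary representation `U`. -/
structure IsCovariant : Prop where
  extends_U : ∀ (s : S) (ζ : K), V s (J ζ) = J (X.U s ζ)
  rep : ∀ (s : S) (k : Finset T), Nonanticipatory (k : Set T) →
    ∀ (a : K →L[ℂ] K) (h : a ∈ X.𝔄 (image s k)) (h' : X.conj s a ∈ X.𝔄 k),
    (V s).toContinuousLinearMap ∘L ι k ⟨X.conj s a, h'⟩ =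
      ι (image s k) ⟨a, h⟩ ∘L (V s).toContinuousLinearMap ∘L ι k 1
  process : ∀ (s : S) (k : Finset T), Nonanticipatory (k : Set T) →
    ∀ B ∈ X.𝓑 (image s k),
    (V s).toContinuousLinearMap ∘L π k (X.pull s B) =
      π (image s k) B ∘L (V s).toContinuousLinearMap ∘L π k Set.univ

/-- The Feynman integral `F^Λ(b) = π_{k_n}(B_n) ⋯ π_{k_1}(B_1) I_∅`, where `k_n > ⋯ > k_1` are the
layers of `Λ` and `B_i = ×_{c ∈ [k_i]} b(c)`. -/
def feynman (Λ : Finset T) (b : Cls T → Set X.Ω) : H →L[ℂ] H :=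
  ((layers Λ).map fun k => π k (X.box b (k : Set T))).prod * ι ∅ 1

/-- The process `π` realizes `κ`: `F^Λ(b)* F^Λ(b') = κ^Λ(b, b')` for all finite `Λ`, where
operators on `K` are identified with operators on the subspace `J K` of `H`. -/
def Realizes (κ : (Cls T → Set X.Ω) → (Cls T → Set X.Ω) → K →L[ℂ] K) : Prop :=
  ∀ Λ : Finset T, ∀ b ∈ X.PathsOn Λ, ∀ b' ∈ X.PathsOn Λ,
    ContinuousLinearMap.adjoint (feynman X ι π Λ b) ∘L feynman X ι π Λ b' =
      emb J ∘L κ b b' ∘L ContinuousLinearMap.adjoint (emb J)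

/-- The closed subspace `H_l` generated by the vectors `F^Λ(b) ζ`, `b ∈ 𝓑^Λ`, `Λ ≤ l`, `ζ ∈ K`. -/
abbrev sliceSpace (l : Slice T) : Submodule ℂ H :=
  (Submodule.span ℂ {x : H | ∃ Λ : Finset T, CausalLE (Λ : Set T) l.1 ∧
    ∃ b ∈ X.PathsOn Λ, ∃ ζ : K, x = feynman X ι π Λ b (J ζ)}).topologicalClosure

/-- The orthogonal projection `E_l` of `H` onto `H_l`. -/
def sliceProj (l : Slice T) : H →L[ℂ] H := (sliceSpace X J ι π l).starProjection

/-- The range of `P_k = π_k(E_k)`. -/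
abbrev rangeP (k : Finset T) : Submodule ℂ H := LinearMap.range (π k Set.univ).toLinearMap

/-- The range of `I_k = ι_k(1)`. -/
abbrev rangeI (k : Finset T) : Submodule ℂ H := LinearMap.range (ι k 1).toLinearMap

/-- Canonicity. In terms of projections: `P_k = ⋁_{l ⊇ k} E_l`, also with `⋀_{k' ⊆ l} P_{k'}` in
place of `E_l`; `⋁_{k ⊆ l} I_k = E_l ≤ ⋀_{k ⊆ l} P_k`; and `E_l = ⋀_{k ⊆ l} P_k` for every slice
`l` with finitely many classes. -/
structure IsCanonical : Prop where
  sup_slice : ∀ k : Finset T, Nonanticipatory (k : Set T) →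
    rangeP X π k =
      (⨆ (l : Slice T) (_ : (k : Set T) ⊆ l.1), sliceSpace X J ι π l).topologicalClosure
  sup_inf : ∀ k : Finset T, Nonanticipatory (k : Set T) →
    rangeP X π k = (⨆ (l : Slice T) (_ : (k : Set T) ⊆ l.1),
      ⨅ (k' : Finset T) (_ : (k' : Set T) ⊆ l.1), rangeP X π k').topologicalClosure
  sup_unit : ∀ l : Slice T, sliceSpace X J ι π l =
    (⨆ (k : Finset T) (_ : (k : Set T) ⊆ l.1), rangeI X ι k).topologicalClosure
  le_inf : ∀ l : Slice T, sliceSpace X J ι π l ≤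
    ⨅ (k : Finset T) (_ : (k : Set T) ⊆ l.1), rangeP X π k
  eq_inf : ∀ l : Slice T, (clsOf l.1).Finite → sliceSpace X J ι π l =
    ⨅ (k : Finset T) (_ : (k : Set T) ⊆ l.1), rangeP X π k

end Processes

/-! ### Regression and the conditional Markov property -/

/-- The W*-algebra generated by a set of operators (the bicommutant). -/
def wstar {G : Type*} [NormedAddCommGroup G] [InnerProductSpace ℂ G] [CompleteSpace G]
    (s : Set (G →L[ℂ] G)) : StarSubalgebra ℂ (G →L[ℂ] G) :=
  StarSubalgebra.centralizer ℂ (StarSubalgebra.centralizer ℂ s : Set (G →L[ℂ] G))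

theorem subset_wstar {G : Type*} [NormedAddCommGroup G] [InnerProductSpace ℂ G] [CompleteSpace G]
    (s : Set (G →L[ℂ] G)) : s ⊆ wstar s := by
  intro x hx
  have key : ∀ y ∈ StarSubalgebra.centralizer ℂ s, y * x = x * y := fun y hy =>
    ((StarSubalgebra.mem_centralizer_iff ℂ).1 hy x hx).1.symm
  refine (StarSubalgebra.mem_centralizer_iff ℂ).2 fun y hy => ⟨key y hy, key _ (star_mem hy)⟩

/-- Square-summable sequences of vectors. -/
def SqSummable {G : Type*} [NormedAddCommGroup G] (ξ : ℕ → G) : Prop :=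
  Summable fun n => ‖ξ n‖ ^ 2

/-- Normal (positive and ultraweakly continuous) linear maps of operator algebras: the
composition of every ultraweakly continuous functional `∑ (ξ_n | · η_n)` with the map is again of
this form. -/
structure IsNormalMap {G G' : Type*} [NormedAddCommGroup G] [InnerProductSpace ℂ G]
    [CompleteSpace G] [NormedAddCommGroup G'] [InnerProductSpace ℂ G'] [CompleteSpace G']
    {M : StarSubalgebra ℂ (G →L[ℂ] G)} (Φ : M →ₗ[ℂ] (G' →L[ℂ] G')) : Prop where
  positive : ∀ A : M, (A : G →L[ℂ] G).IsPositive → (Φ A).IsPositive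
  ultraweak : ∀ ξ η : ℕ → G', SqSummable ξ → SqSummable η →
    ∃ ξ' η' : ℕ → G, SqSummable ξ' ∧ SqSummable η' ∧
      ∀ A : M, ∑' n, ⟪ξ n, Φ A (η n)⟫_ℂ = ∑' n, ⟪ξ' n, (A : G →L[ℂ] G) (η' n)⟫_ℂ

section Regression

variable {S : Type uS} {T : Type uT} {K : Type uK} [Semigroup S] [Preorder T] [CausalAction S T]
  [NormedAddCommGroup K] [InnerProductSpace ℂ K] [CompleteSpace K]

/-- Commuting representations of `𝓑_l` and `𝔄_l` on some Hilbert spaces `G_l`, one for each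
slice `l`. -/
structure SliceReps (X : Setting.{uS, uT, uE, uK} S T K) where
  /-- the Hilbert space of a slice -/
  G : Slice T → Type uG
  [normed : ∀ l, NormedAddCommGroup (G l)]
  [inner : ∀ l, InnerProductSpace ℂ (G l)]
  [complete : ∀ l, CompleteSpace (G l)]
  /-- the representation of the events of a slice -/
  π : ∀ l, Set X.Ω → G l →L[ℂ] G l
  /-- the representation of the algebra of a slice -/
  ι : ∀ l, X.sliceAlg l →⋆ₐ[ℂ] (G l →L[ℂ] G l)
  projection : ∀ l, ∀ B ∈ X.sliceEvents l, IsStarProjection (π l B)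
  multiplicative : ∀ l, ∀ B ∈ X.sliceEvents l, ∀ B' ∈ X.sliceEvents l,
    π l (B ∩ B') = π l B * π l B'
  unital : ∀ l, π l Set.univ = 1
  sigma_additive : ∀ l, ∀ k : Finset T, (k : Set T) ⊆ l.1 → ∀ f : ℕ → Set X.Ω,
    (∀ m, f m ∈ X.𝓑 k) → Pairwise (fun m m' => Disjoint (f m) (f m')) →
    (⋃ m, f m) = Set.univ → ∀ x : G l, HasSum (fun m => π l (f m) x) x
  commute : ∀ l, ∀ B ∈ X.sliceEvents l, ∀ a : X.sliceAlg l, Commute (π l B) (ι l a)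

attribute [instance] SliceReps.normed SliceReps.inner SliceReps.complete

namespace SliceReps

variable {X : Setting.{uS, uT, uE, uK} S T K} (R : SliceReps.{uS, uT, uE, uK, uG} X)

/-- The generators of the W*-algebra of a slice. -/
def gens (l : Slice T) : Set (R.G l →L[ℂ] R.G l) :=
  (R.π l '' X.sliceEvents l) ∪ Set.range (R.ι l)

/-- The W*-algebra `𝒜_l = π_l(𝓑_l) ∨ ι_l(𝔄_l)`. -/
def alg (l : Slice T) : StarSubalgebra ℂ (R.G l →L[ℂ] R.G l) := wstar (R.gens l)

open Classical in
/-- `π_l(B)` as an element of `𝒜_l`, for `B ∈ 𝓑_l`. -/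
def event (l : Slice T) (B : Set X.Ω) : R.alg l :=
  if h : B ∈ X.sliceEvents l then ⟨R.π l B, subset_wstar _ (Or.inl ⟨B, h, rfl⟩)⟩ else 0

/-- `ι_l(a)` as an element of `𝒜_l`. -/
def iota (l : Slice T) (a : X.sliceAlg l) : R.alg l :=
  ⟨R.ι l a, subset_wstar _ (Or.inr ⟨a, rfl⟩)⟩

/-- The element
`π_{l_1}(B_1) θ_{l_1 l_2}(π_{l_2}(B_2) ⋯ θ_{l_{n-1} l_n}(π_{l_n}(B_n)) ⋯ )` of `𝒜_{l_1}` with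
`B_i = ×_{c ⊆ l_i} b(c)`, for the sequence `l_1, (l_2, …, l_n)` of slices. -/
def nested (θ : ∀ l l' : Slice T, R.alg l' →ₗ[ℂ] R.alg l) (b : Cls T → Set X.Ω) :
    (l : Slice T) → List (Slice T) → R.alg l
  | l, [] => R.event l (X.box b l.1)
  | l, l' :: ls => R.event l (X.box b l.1) * θ l l' (nested θ b l' ls)

/-- Regressions: normal maps `ρ_l : 𝒜_l → B(K)` and, for `l ≤ l'`, `θ_{ll'} : 𝒜_{l'} → 𝒜_l` that
are compatible with the representations of the algebras `𝔄_l` and determine the kernel `κ`. -/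
structure IsRegression (κ : (Cls T → Set X.Ω) → (Cls T → Set X.Ω) → K →L[ℂ] K)
    (ρ : ∀ l : Slice T, R.alg l →ₗ[ℂ] (K →L[ℂ] K))
    (θ : ∀ l l' : Slice T, R.alg l' →ₗ[ℂ] R.alg l) : Prop where
  normal_ρ : ∀ l, IsNormalMap (ρ l)
  normal_θ : ∀ l l' : Slice T, CausalLE l.1 l'.1 →
    IsNormalMap ((R.alg l).subtype.toAlgHom.toLinearMap ∘ₗ θ l l')
  module_ρ : ∀ (l : Slice T) (A : R.alg l) (a : X.sliceAlg l),
    ρ l (A * R.iota l a) = ρ l A * (a : K →L[ℂ] K)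
  module_θ : ∀ l l' : Slice T, CausalLE l.1 l'.1 → ∀ (A : R.alg l') (a : K →L[ℂ] K)
    (h : a ∈ X.sliceAlg l) (h' : a ∈ X.sliceAlg l'),
    θ l l' (A * R.iota l' ⟨a, h'⟩) = θ l l' A * R.iota l ⟨a, h⟩
  regression : ∀ (l : Slice T) (ls : List (Slice T)),
    (l :: ls).IsChain (fun l l' => CausalLE l.1 l'.1) →
    ∀ b ∈ X.Paths, ∀ b' ∈ X.Paths,
    (∀ c, (∀ l' ∈ l :: ls, c ∉ clsOf l'.1) → b c = Set.univ ∧ b' c = Set.univ) →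
    κ b b' = ρ l (R.nested θ (fun c => b c ∩ b' c) l ls)

end SliceReps

variable (X : Setting.{uS, uT, uE, uK} S T K)
  {H : Type uH} [NormedAddCommGroup H] [InnerProductSpace ℂ H] [CompleteSpace H]
  (J : K →ₗᵢ[ℂ] H)
  (ι : ∀ k : Finset T, X.𝔄 k →⋆ₙₐ[ℂ] (H →L[ℂ] H))
  (π : Finset T → Set X.Ω → H →L[ℂ] H)

/-- The operators `π_l(B) = π_k(B) E_l`, `B ∈ 𝓑_k`, `k ⊆ l`, of a slice `l`. -/
def slicePi (l : Slice T) : Set (H →L[ℂ] H) :=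
  {A | ∃ k : Finset T, (k : Set T) ⊆ l.1 ∧ ∃ B ∈ X.𝓑 k, A = π k B * sliceProj X J ι π l}

/-- The operators `ι_l(a)`, `a ∈ 𝔄_l`, of a slice `l`, determined by `ι_l(a) I_k = ι_k(a)` for
`k ⊆ l` and by `ι_l(a) = ι_l(a) E_l`. -/
def sliceIota (l : Slice T) : Set (H →L[ℂ] H) :=
  {A | ∃ a : K →L[ℂ] K, a ∈ X.sliceAlg l ∧ A = A * sliceProj X J ι π l ∧
    ∀ (k : Finset T) (h : a ∈ X.𝔄 k), (k : Set T) ⊆ l.1 → A * ι k 1 = ι k ⟨a, h⟩}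

/-- The conditional Markov property
`E_l π_{l'}(𝓑_{l'}) E_l ⊆ π_l(𝓑_l) ∨ ι_l(𝔄_l)` for `l ≤ l'`. An operator of the form `E_l A E_l`
lies in the bicommutant in `B(H)` if and only if it lies in the W*-algebra with unit `E_l`. -/
def ConditionallyMarkov : Prop :=
  ∀ l l' : Slice T, CausalLE l.1 l'.1 → ∀ A ∈ slicePi X J ι π l',
    sliceProj X J ι π l * A * sliceProj X J ι π l ∈
      wstar (slicePi X J ι π l ∪ sliceIota X J ι π l)

end Regression

end

end QSP

namespace QSP
noncomputable section

set_option linter.unusedSectionVars false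

/-! ### Operators determined on a family of vectors -/

section Hilbert

variable {H : Type*} [NormedAddCommGroup H] [InnerProductSpace ℂ H] [CompleteSpace H]
  {H' : Type*} [NormedAddCommGroup H'] [InnerProductSpace ℂ H'] [CompleteSpace H']

/-! Everything lives on one Hilbert space, the Kolmogorov decomposition of the kernel. By 1⁰ there
are `H` and operators `vec b : K → H` with `vec(b)* vec(b') = κ(b, b')` and a total set of vectors
`vec b ζ` (`exists_dilation`); 2⁰ makes `ζ ↦ vec e ζ` an embedding of `K`. The other objects are
prescribed on generators: `π_k(B)` sends `vec b ζ` to `vec (b ⊓ β) ζ` for `b` in the past of `k`,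
where `B` is the box of the path `β`; `ι_k(a)` sends `vec b ζ` to `vec b (a ζ)` for `b` below `k`;
both vanish on the complement of the generators concerned. `V_s` sends `vec (b^s) ζ` to `vec b (U_s
ζ)`.

The axioms make these prescriptions legitimate: 4⁰ turns the first into a projection
(`exists_mulOp`), commutation of `𝔄_k` with the kernel bounds the second (`exists_algOp`), 5⁰ makes
the third isometric (`exists_shift`), and 3⁰ yields σ-additivity. Axioms 3⁰ and 4⁰ speak of slices;
they reach a finite `k` because two paths in the past of `k` lie below a common slice containing `k`
(`exists_slice_of_past`, by Zorn). Now `P_k`, `I_k`, `E_l` project onto the spans of the paths in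
the past of `k`, below `k`, below `l`, so canonicity is a comparison of sets of paths; and the
layers of `Λ`, applied from the bottom to `vec e ζ`, build up `vec b ζ` (`layers_prod_apply`), which
gives (iii).

Regularity: the supremum in (v) controls the norm of `(E_l − P) vec b ζ`, so `E_l` tends to `P`. The
slices containing `k` are directed downwards, hence `𝔄_k` is the union of the `𝔄_l`, and the
operators `ι_l(a)` agree on `⋂ H_l` over `l ⊇ k`; their common restriction is `ι*_k(a)`.

Markov property: a regression forces `κ(b, b')` to depend on `d = b ⊓ b'` only. A descending chain
of slices from `l` that covers the support of `d` defines a positive ultraweakly continuous map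
`ω_d` on `𝒜_l` (`state`). The crux is `κ(dβ, dβ) = ω_d(π_l(B))` for `β` on `l` and `κ(dβ, dβ) =
ω_d(θ_{ll'}(π_{l'}(B)))` for `β` on `l'`. The regression formula gives only `≤`, since it inserts
`β` into every slice of the chain that meets its classes; but the inequalities for the members of a
countable partition add up to the same total on both sides, so they are equalities
(`kernel_eq_of_sandwich`). Hence matrix elements of the operators of the slice and of `E_l π_{l'}(B)
E_l` are given by common ultraweakly continuous functionals, evaluated at generators of `𝒜_l` and at
`θ_{ll'}(π_{l'}(B)) ∈ 𝒜_l`. A double commutant argument on `G_l ⊗ ℓ²` (`commute_of_ultraweak`) moves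
the latter into the W*-algebra generated on `H`. -/

theorem clm_ext_of_span {s : Set H} {A B : H →L[ℂ] H'} (h : ∀ x ∈ s, A x = B x)
    (h' : ∀ x ∈ (Submodule.span ℂ s).topologicalClosureᗮ, A x = B x) : A = B := by
  have key : ∀ x ∈ (Submodule.span ℂ s).topologicalClosure, A x = B x := by
    have h1 : Submodule.span ℂ s ≤ LinearMap.eqLocus A.toLinearMap B.toLinearMap :=
      Submodule.span_le.2 h
    intro x hx
    exact Submodule.topologicalClosure_minimal _ h1
      (isClosed_eq A.continuous B.continuous) hx
  ext x
  obtain ⟨y, hy, z, hz, rfl⟩ :=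
    (Submodule.span ℂ s).topologicalClosure.exists_add_mem_mem_orthogonal x
  rw [map_add, map_add, key y hy, h' z hz]

/-- A bounded linear assignment on a family of vectors extends to a bounded operator that vanishes
on the orthogonal complement of the family. -/
theorem exists_clm_of_bound {I : Type*} (v : I → H) (w : I → H') (C : ℝ)
    (h : ∀ c : I →₀ ℂ, ‖Finsupp.linearCombination ℂ w c‖ ≤ C * ‖Finsupp.linearCombination ℂ v c‖) :
    ∃ A : H →L[ℂ] H', (∀ i, A (v i) = w i) ∧
      ∀ x ∈ (Submodule.span ℂ (Set.range v)).topologicalClosureᗮ, A x = 0 := by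
  set M := (Submodule.span ℂ (Set.range v)).topologicalClosure with hM
  have hmem : ∀ c, Finsupp.linearCombination ℂ v c ∈ M := fun c =>
    Submodule.le_topologicalClosure _ (by
      rw [← Finsupp.range_linearCombination]; exact LinearMap.mem_range_self _ c)
  let e : (I →₀ ℂ) →ₗ[ℂ] M := (Finsupp.linearCombination ℂ v).codRestrict M hmem
  have hd : DenseRange e := by
    intro x
    have hx : (x : H) ∈ closure (Submodule.span ℂ (Set.range v) : Set H) := x.2
    rw [Metric.mem_closure_range_iff]
    intro ε hε
    obtain ⟨y, hy, hxy⟩ := Metric.mem_closure_iff.1 hx ε hε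
    rw [SetLike.mem_coe, ← Finsupp.range_linearCombination] at hy
    obtain ⟨c, rfl⟩ := hy
    exact ⟨c, hxy⟩
  have hb : ∃ C, ∀ c, ‖Finsupp.linearCombination ℂ w c‖ ≤ C * ‖e c‖ := ⟨C, h⟩
  refine ⟨(Finsupp.linearCombination ℂ w).extendOfNorm e ∘L M.orthogonalProjectionOnto, ?_, ?_⟩
  · intro i
    have h1 : v i = ((e (Finsupp.single i 1) : M) : H) := by simp [e]
    rw [h1, ContinuousLinearMap.comp_apply, Submodule.orthogonalProjectionOnto_mem_subspace_eq_self,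
      LinearMap.extendOfNorm_eq hd hb]
    simp
  · intro x hx
    rw [ContinuousLinearMap.comp_apply,
      Submodule.orthogonalProjectionOnto_apply_of_mem_orthogonal hx, map_zero]

theorem inner_linearCombination {I : Type*} {v w : I → H} {v' w' : I → H'}
    (h : ∀ i j, ⟪v i, w j⟫_ℂ = ⟪v' i, w' j⟫_ℂ) (c d : I →₀ ℂ) :
    ⟪Finsupp.linearCombination ℂ v c, Finsupp.linearCombination ℂ w d⟫_ℂ =
      ⟪Finsupp.linearCombination ℂ v' c, Finsupp.linearCombination ℂ w' d⟫_ℂ := by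
  simp only [Finsupp.linearCombination_apply, Finsupp.sum_inner, Finsupp.inner_sum,
    inner_smul_left, inner_smul_right, h]

/-- The hypothesis says that `v i - w i` is orthogonal to every `w j`, so `w i` is the projection of
`v i` onto the closed span of the `w j`. Boundedness is Cauchy–Schwarz: `‖w_c‖² = ⟪v_c, w_c⟫ ≤ ‖v_c‖
‖w_c‖` for linear combinations. -/
theorem exists_starProjection_of_inner {I : Type*} (v w : I → H)
    (hw : ∀ i, w i ∈ (Submodule.span ℂ (Set.range v)).topologicalClosure)
    (h : ∀ i j, ⟪w i, w j⟫_ℂ = ⟪v i, w j⟫_ℂ) :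
    ∃ A : H →L[ℂ] H, IsStarProjection A ∧ (∀ i, A (v i) = w i) ∧
      ∀ x ∈ (Submodule.span ℂ (Set.range v)).topologicalClosureᗮ, A x = 0 := by
  obtain ⟨A, hA, hA'⟩ := exists_clm_of_bound v w 1 fun c => by
    rw [one_mul]
    by_cases h0 : ‖Finsupp.linearCombination ℂ w c‖ = 0
    · rw [h0]; exact norm_nonneg _
    refine le_of_mul_le_mul_right ?_ (lt_of_le_of_ne (norm_nonneg _) (Ne.symm h0))
    calc ‖Finsupp.linearCombination ℂ w c‖ * ‖Finsupp.linearCombination ℂ w c‖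
        = ‖⟪Finsupp.linearCombination ℂ w c, Finsupp.linearCombination ℂ w c⟫_ℂ‖ := by
          rw [inner_self_eq_norm_sq_to_K]; simp [sq]
      _ = ‖⟪Finsupp.linearCombination ℂ v c, Finsupp.linearCombination ℂ w c⟫_ℂ‖ := by
          rw [inner_linearCombination h]
      _ ≤ _ := norm_inner_le_norm _ _
  refine ⟨A, ?_, hA, hA'⟩
  have hmap : ∀ x, A x ∈ (Submodule.span ℂ (Set.range v)).topologicalClosure := by
    intro x
    obtain ⟨y, hy, z, hz, rfl⟩ :=
      (Submodule.span ℂ (Set.range v)).topologicalClosure.exists_add_mem_mem_orthogonal x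
    rw [map_add, hA' z hz, add_zero]
    have h1 : Submodule.span ℂ (Set.range v) ≤
        (Submodule.span ℂ (Set.range v)).topologicalClosure.comap A.toLinearMap :=
      Submodule.span_le.2 (by rintro _ ⟨i, rfl⟩; exact Submodule.mem_comap.2 (by
        simpa only [ContinuousLinearMap.coe_coe, hA i] using hw i))
    exact Submodule.topologicalClosure_minimal _ h1
      ((Submodule.isClosed_topologicalClosure _).preimage A.continuous) hy
  -- The identity `A* A = A` gives self-adjointness and idempotence at once.
  have hAA : ContinuousLinearMap.adjoint A ∘L A = A := by
    refine clm_ext_of_span (s := Set.range v) ?_ (fun x hx => by simp [hA' x hx])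
    rintro _ ⟨j, rfl⟩
    refine ext_inner_left ℂ fun x => ?_
    rw [ContinuousLinearMap.comp_apply, ContinuousLinearMap.adjoint_inner_right, hA j]
    -- The functionals `⟪w j, A ·⟫` and `⟪w j, ·⟫` agree on the generators and on their complement;
    -- their adjoints at `1` turn this into `A* (w j) = w j`.
    have h2 : ContinuousLinearMap.adjoint (innerSL ℂ (w j) ∘L A) 1
        = ContinuousLinearMap.adjoint (innerSL ℂ (w j)) 1 := by
      congr 2
      refine clm_ext_of_span (s := Set.range v) ?_ fun x hx => ?_
      · rintro _ ⟨i, rfl⟩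
        have := congrArg (starRingEnd ℂ) (h i j)
        simpa [hA i] using this
      · simp only [ContinuousLinearMap.comp_apply, hA' x hx, innerSL_apply_apply, inner_zero_right]
        exact (((Submodule.mem_orthogonal _ _).1 hx) _ (hw j)).symm
    have h3 := congrArg (fun y => ⟪x, y⟫_ℂ) h2
    simpa [ContinuousLinearMap.adjoint_inner_right] using h3
  have hsa : IsSelfAdjoint A := by
    rw [← hAA]; exact IsSelfAdjoint.star_mul_self A
  exact ⟨by rw [IsIdempotentElem]; nth_rewrite 1 [← hsa.star_eq]; exact hAA, hsa⟩

/-- Equal Gram matrices give equal norms of linear combinations; totality of `v` extends the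
isometry to the whole space. -/
theorem exists_linearIsometry_of_inner {I : Type*} (v : I → H) (w : I → H')
    (hv : (Submodule.span ℂ (Set.range v)).topologicalClosure = ⊤)
    (h : ∀ i j, ⟪w i, w j⟫_ℂ = ⟪v i, v j⟫_ℂ) :
    ∃ V : H →ₗᵢ[ℂ] H', ∀ i, V (v i) = w i := by
  have hn : ∀ c, ‖Finsupp.linearCombination ℂ w c‖ = ‖Finsupp.linearCombination ℂ v c‖ := by
    intro c
    have := inner_linearCombination h c c
    rw [inner_self_eq_norm_sq_to_K, inner_self_eq_norm_sq_to_K] at this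
    have h2 : ‖Finsupp.linearCombination ℂ w c‖ ^ 2 = ‖Finsupp.linearCombination ℂ v c‖ ^ 2 := by
      exact_mod_cast this
    exact (pow_left_inj₀ (norm_nonneg _) (norm_nonneg _) two_ne_zero).1 h2
  obtain ⟨A, hA, -⟩ := exists_clm_of_bound v w 1 fun c => by rw [one_mul, hn]
  refine ⟨⟨A.toLinearMap, fun x => ?_⟩, hA⟩
  have hx : x ∈ (Submodule.span ℂ (Set.range v)).topologicalClosure := hv ▸ Submodule.mem_top
  have hc : IsClosed {x : H | ‖A x‖ = ‖x‖} :=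
    isClosed_eq (by fun_prop) continuous_norm
  refine closure_minimal (s := (Submodule.span ℂ (Set.range v) : Set H)) ?_ hc hx
  intro y hy
  rw [SetLike.mem_coe, ← Finsupp.range_linearCombination] at hy
  obtain ⟨c, rfl⟩ := hy
  have : A (Finsupp.linearCombination ℂ v c) = Finsupp.linearCombination ℂ w c := by
    simp [Finsupp.linearCombination_apply, Finsupp.sum, hA]
  rw [Set.mem_ofPred_eq, this, hn]

/-- Two vectors of a closed span coincide if they have the same inner products with the
generators. -/
theorem eq_of_inner_generators {s : Set H} {x y : H}
    (hx : x ∈ (Submodule.span ℂ s).topologicalClosure)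
    (hy : y ∈ (Submodule.span ℂ s).topologicalClosure) (h : ∀ z ∈ s, ⟪z, x⟫_ℂ = ⟪z, y⟫_ℂ) :
    x = y := by
  have h1 : (x - y) ∈ (Submodule.span ℂ s)ᗮ := by
    rw [Submodule.mem_orthogonal]
    intro u hu
    induction hu using Submodule.span_induction with
    | mem z hz => rw [inner_sub_right, h z hz, sub_self]
    | zero => exact inner_zero_left _
    | add a b _ _ ha hb => rw [inner_add_left, ha, hb, add_zero]
    | smul c a _ ha => rw [inner_smul_left, ha, mul_zero]
  rw [← Submodule.orthogonal_closure] at h1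
  have h2 := (Submodule.mem_orthogonal _ _).1 h1 _ (Submodule.sub_mem _ hx hy)
  exact sub_eq_zero.1 (inner_self_eq_zero.1 h2)

end Hilbert

/-! ### Slices -/

section Slices

variable {T : Type uT} [Preorder T]

theorem cls_le_cls {t t' : T} : cls t ≤ cls t' ↔ t ≤ t' :=
  toAntisymmetrization_le_toAntisymmetrization_iff

theorem cls_lt_cls {t t' : T} : cls t < cls t' ↔ t < t' :=
  toAntisymmetrization_lt_toAntisymmetrization_iff

theorem cls_eq_cls {t t' : T} : cls t = cls t' ↔ t ≤ t' ∧ t' ≤ t := by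
  rw [le_antisymm_iff, cls_le_cls, cls_le_cls]

theorem exists_cls_eq (c : Cls T) : ∃ t, cls t = c := Quotient.exists_rep c

theorem Nonanticipatory.mono {j j' : Set T} (h : Nonanticipatory j') (hj : j ⊆ j') :
    Nonanticipatory j := fun t ht t' ht' => h t (hj ht) t' (hj ht')

theorem nonanticipatory_of_cls {j : Set T} {c : Cls T} (h : ∀ t ∈ j, cls t = c) :
    Nonanticipatory j := fun t ht t' ht' hlt =>
  lt_irrefl c (by simpa [h t ht, h t' ht'] using cls_lt_cls.2 hlt)

theorem CausalLE.trans {j j' j'' : Set T} (h : CausalLE j j') (h' : CausalLE j' j'') :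
    CausalLE j j'' := fun t ht => by
  obtain ⟨u, hu, htu⟩ := h t ht
  obtain ⟨v, hv, huv⟩ := h' u hu
  exact ⟨v, hv, htu.trans huv⟩

theorem CausalLE.of_subset {j j' : Set T} (h : j ⊆ j') : CausalLE j j' :=
  fun t ht => ⟨t, h ht, le_rfl⟩

/-- In `t ≤ u ≤ v` with `t, v ∈ k`, nonanticipation excludes `t < v`; hence `v ≤ t`, and `u` is
equivalent to `t`. -/
theorem Nonanticipatory.cls_eq_of_causalEquiv {k k' : Set T} (hk : Nonanticipatory k)
    (h : CausalEquiv k k') : clsOf k ⊆ clsOf k' := by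
  rintro _ ⟨t, ht, rfl⟩
  obtain ⟨u, hu, htu⟩ := h.1 t ht
  obtain ⟨v, hv, huv⟩ := h.2 u hu
  have := hk t ht v hv
  rw [lt_iff_le_not_ge, not_and_not_right] at this
  exact ⟨u, hu, cls_eq_cls.2 ⟨huv.trans (this (htu.trans huv)), htu⟩⟩

theorem exists_slice_superset {j : Set T} (hj : Nonanticipatory j) :
    ∃ l : Slice T, j ⊆ l.1 := by
  obtain ⟨m, hm, hmax⟩ := zorn_subset_nonempty {j : Set T | Nonanticipatory j}
    (fun c hc hchain _ => ⟨⋃₀ c, by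
      rintro t ⟨a, ha, hta⟩ t' ⟨a', ha', hta'⟩
      rcases hchain.total ha ha' with h | h
      · exact hc ha' t (h hta) t' hta'
      · exact hc ha t hta t' (h hta'), fun s hs => Set.subset_sUnion_of_mem hs⟩) j hj
  exact ⟨⟨m, hmax⟩, hm⟩

theorem Slice.nonanticipatory (l : Slice T) : Nonanticipatory l.1 := l.2.1

theorem Slice.mem_of_forall (l : Slice T) {u : T} (h : ∀ t ∈ l.1, ¬ t < u ∧ ¬ u < t) : u ∈ l.1 := by
  have h1 : Nonanticipatory (insert u l.1) := by
    rintro t (rfl | ht) t' (rfl | ht')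
    · exact lt_irrefl _
    · exact (h t' ht').2
    · exact (h t ht).1
    · exact l.nonanticipatory t ht t' ht'
  exact l.2.2 h1 (Set.subset_insert _ _) (Set.mem_insert _ _)

theorem Slice.mem_of_cls_eq (l : Slice T) {t u : T} (ht : t ∈ l.1) (h : cls t = cls u) :
    u ∈ l.1 := by
  refine l.mem_of_forall fun v hv => ?_
  rw [← cls_lt_cls, ← cls_lt_cls (t := u), ← h, cls_lt_cls, cls_lt_cls]
  exact ⟨l.nonanticipatory v hv t ht, l.nonanticipatory t ht v hv⟩

theorem Slice.mem_of_cls_mem (l : Slice T) {t : T} (h : cls t ∈ clsOf l.1) : t ∈ l.1 := by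
  obtain ⟨u, hu, hut⟩ := h
  exact l.mem_of_cls_eq hu hut

theorem Slice.trichotomy (l : Slice T) (u : T) :
    u ∈ l.1 ∨ (∃ t ∈ l.1, u < t) ∨ ∃ t ∈ l.1, t < u := by
  by_contra! h
  exact h.1 (l.mem_of_forall fun t ht => ⟨h.2.2 t ht, h.2.1 t ht⟩)

theorem top_subset (Λ : Finset T) : top Λ ⊆ Λ := by
  classical
  exact Finset.filter_subset _ _

theorem mem_top {Λ : Finset T} {t : T} : t ∈ top Λ ↔ t ∈ Λ ∧ ∀ u ∈ Λ, ¬ t < u := by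
  classical
  exact Finset.mem_filter

theorem top_nonanticipatory (Λ : Finset T) : Nonanticipatory (top Λ : Set T) :=
  fun _ ht _ hu => (mem_top.1 ht).2 _ (top_subset Λ hu)

theorem causalLE_top (Λ : Finset T) : CausalLE (Λ : Set T) (top Λ : Set T) := by
  intro t ht
  obtain ⟨m, htm, hm⟩ := Λ.exists_le_maximal ht
  exact ⟨m, mem_top.2 ⟨hm.1, fun u hu hmu => hmu.not_ge (hm.2 hu hmu.le)⟩, htm⟩

/-- The maximal points of `k ∪ Λ` form a nonanticipatory set that dominates `Λ` and contains `k`,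
because nothing in `Λ` is strictly above `k`. Any slice through them will do. -/
theorem exists_slice_above {k Λ : Finset T} (hk : Nonanticipatory (k : Set T))
    (h : ∀ u ∈ Λ, ∀ t ∈ k, ¬ t < u) :
    ∃ l : Slice T, (k : Set T) ⊆ l.1 ∧ CausalLE (Λ : Set T) l.1 := by
  classical
  obtain ⟨l, hl⟩ := exists_slice_superset (top_nonanticipatory (k ∪ Λ))
  refine ⟨l, fun t ht => hl (mem_top.2 ⟨Finset.mem_union_left _ ht, fun u hu => ?_⟩), ?_⟩
  · rcases Finset.mem_union.1 hu with hu | hu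
    · exact hk t ht u hu
    · exact h u hu t ht
  · refine CausalLE.trans ?_ (CausalLE.of_subset hl)
    exact (CausalLE.of_subset (by simp)).trans (causalLE_top (k ∪ Λ))

/-- The slice is any extension of `k` together with the points of `l'` not strictly above `k`. A
point of it strictly above some `t ∈ l'` would be strictly above a point of this set: `t` itself or
some `u ∈ k` with `u < t`. -/
theorem exists_slice_below {k : Set T} (hk : Nonanticipatory k) (l' : Slice T)
    (h : CausalLE k l'.1) : ∃ l : Slice T, k ⊆ l.1 ∧ CausalLE l.1 l'.1 := by
  have hm : Nonanticipatory (k ∪ {t | t ∈ l'.1 ∧ ∀ u ∈ k, ¬ u < t}) := by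
    rintro t (ht | ht) t' (ht' | ht')
    · exact hk t ht t' ht'
    · exact ht'.2 t ht
    · intro hlt
      obtain ⟨v, hv, hv'⟩ := h t' ht'
      exact l'.nonanticipatory t ht.1 v hv (hlt.trans_le hv')
    · exact l'.nonanticipatory t ht.1 t' ht'.1
  obtain ⟨l, hl⟩ := exists_slice_superset hm
  refine ⟨l, Set.subset_union_left.trans hl, fun x hx => ?_⟩
  rcases l'.trichotomy x with h1 | ⟨t, ht, hxt⟩ | ⟨t, ht, htx⟩
  · exact ⟨x, h1, le_rfl⟩
  · exact ⟨t, ht, hxt.le⟩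
  · exfalso
    by_cases h2 : ∀ u ∈ k, ¬ u < t
    · exact l.nonanticipatory t (hl (Or.inr ⟨ht, h2⟩)) x hx htx
    · push Not at h2
      obtain ⟨u, hu, hut⟩ := h2
      exact l.nonanticipatory u (hl (Or.inl hu)) x hx (hut.trans htx)

/-- A lower envelope: the points of either slice that have no point of the other strictly below
them. It makes the slices containing `k` directed downwards, which is used for `𝔄_k = ⋃ 𝔄_l`, for `⋂
H_l` and for the limit along `l ↓ ∅`. -/
theorem exists_slice_inf {k : Set T} {l l' : Slice T} (h : k ⊆ l.1) (h' : k ⊆ l'.1) :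
    ∃ m : Slice T, k ⊆ m.1 ∧ CausalLE m.1 l.1 ∧ CausalLE m.1 l'.1 := by
  obtain ⟨m, hm⟩ := exists_slice_superset (j := {t | (t ∈ l.1 ∧ ∀ u ∈ l'.1, ¬ u < t) ∨
      (t ∈ l'.1 ∧ ∀ u ∈ l.1, ¬ u < t)}) (by
    rintro t (⟨ht, ht2⟩ | ⟨ht, ht2⟩) u (⟨hu, hu2⟩ | ⟨hu, hu2⟩)
    · exact l.nonanticipatory t ht u hu
    · exact hu2 t ht
    · exact hu2 t ht
    · exact l'.nonanticipatory t ht u hu)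
  refine ⟨m, fun t ht => hm (Or.inl ⟨h ht, fun u hu => l'.nonanticipatory u hu t (h' ht)⟩),
    fun x hx => ?_, fun x hx => ?_⟩
  · rcases l.trichotomy x with h1 | ⟨t, ht, hxt⟩ | ⟨t, ht, htx⟩
    · exact ⟨x, h1, le_rfl⟩
    · exact ⟨t, ht, hxt.le⟩
    · exfalso
      by_cases h2 : ∀ u ∈ l'.1, ¬ u < t
      · exact m.nonanticipatory t (hm (Or.inl ⟨ht, h2⟩)) x hx htx
      · push Not at h2
        obtain ⟨u, hu, hut⟩ := h2
        refine m.nonanticipatory u (hm (Or.inr ⟨hu, fun v hv hvu => ?_⟩)) x hx (hut.trans htx)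
        exact l.nonanticipatory v hv t ht (hvu.trans hut)
  · rcases l'.trichotomy x with h1 | ⟨t, ht, hxt⟩ | ⟨t, ht, htx⟩
    · exact ⟨x, h1, le_rfl⟩
    · exact ⟨t, ht, hxt.le⟩
    · exfalso
      by_cases h2 : ∀ u ∈ l.1, ¬ u < t
      · exact m.nonanticipatory t (hm (Or.inr ⟨ht, h2⟩)) x hx htx
      · push Not at h2
        obtain ⟨u, hu, hut⟩ := h2
        refine m.nonanticipatory u (hm (Or.inl ⟨hu, fun v hv hvu => ?_⟩)) x hx (hut.trans htx)
        exact l'.nonanticipatory v hv t ht (hvu.trans hut)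

/-- Finitely many points below a slice are covered by a finite descending chain of slices. -/
theorem exists_slice_chain (Λ : Finset T) : ∀ l : Slice T, CausalLE (Λ : Set T) l.1 →
    ∃ ms : List (Slice T), (l :: ms).IsChain (fun m m' => CausalLE m'.1 m.1) ∧
      ∀ t ∈ Λ, ∃ m ∈ ms, t ∈ m.1 := by
  classical
  induction Λ using Finset.strongInduction with
  | H Λ ih =>
    intro l hl
    by_cases h0 : Λ = ∅
    · subst h0; exact ⟨[], by simp, by simp⟩
    -- A slice `m ≤ l` through `max Λ` covers the top layer; only the points of `Λ` off `m` are left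
    -- to the recursion.
    obtain ⟨m, hm, hml⟩ := exists_slice_below (top_nonanticipatory Λ) l
      ((CausalLE.of_subset (top_subset Λ)).trans hl)
    have hΛm : CausalLE (Λ : Set T) m.1 := (causalLE_top Λ).trans (CausalLE.of_subset hm)
    obtain ⟨ms, hms, hcov⟩ := ih (Λ.filter (· ∉ m.1)) (by
      obtain ⟨t, ht⟩ := Finset.nonempty_iff_ne_empty.2 h0
      obtain ⟨u, hu, -⟩ := causalLE_top Λ t ht
      refine Finset.filter_ssubset.2 ⟨u, top_subset Λ hu, fun h => h (hm hu)⟩) m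
      ((CausalLE.of_subset fun x hx => (Finset.mem_filter.1 hx).1).trans hΛm)
    refine ⟨m :: ms, List.isChain_cons_cons.2 ⟨hml, hms⟩, fun t ht => ?_⟩
    by_cases htm : t ∈ m.1
    · exact ⟨m, by simp, htm⟩
    · obtain ⟨m', hm', htm'⟩ := hcov t (Finset.mem_filter.2 ⟨ht, htm⟩)
      exact ⟨m', List.mem_cons_of_mem _ hm', htm'⟩

theorem mem_inClass {Λ : Finset T} {c : Cls T} {t : T} : t ∈ inClass Λ c ↔ t ∈ Λ ∧ cls t = c := by
  classical
  exact Finset.mem_filter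

theorem mem_union {k k' : Finset T} {t : T} : t ∈ union k k' ↔ t ∈ k ∨ t ∈ k' := by
  classical
  exact Finset.mem_union

theorem clsOf_union (k k' : Finset T) :
    clsOf (union k k' : Set T) = clsOf (k : Set T) ∪ clsOf (k' : Set T) := by
  ext c
  constructor
  · rintro ⟨t, ht, rfl⟩
    rcases mem_union.1 ht with h | h
    · exact Or.inl ⟨t, h, rfl⟩
    · exact Or.inr ⟨t, h, rfl⟩
  · rintro (⟨t, ht, rfl⟩ | ⟨t, ht, rfl⟩)
    · exact ⟨t, mem_union.2 (Or.inl ht), rfl⟩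
    · exact ⟨t, mem_union.2 (Or.inr ht), rfl⟩

theorem inClass_nonempty {Λ : Finset T} {c : Cls T} (h : c ∈ clsOf (Λ : Set T)) :
    (inClass Λ c).Nonempty := by
  obtain ⟨t, ht, rfl⟩ := h
  exact ⟨t, mem_inClass.2 ⟨ht, rfl⟩⟩

theorem inClass_nonanticipatory (Λ : Finset T) (c : Cls T) :
    Nonanticipatory (inClass Λ c : Set T) :=
  nonanticipatory_of_cls (c := c) fun _ ht => (mem_inClass.1 ht).2

end Slices

/-! ### The action on points, classes and slices -/

section ActionLemmas

variable {S : Type uS} {T : Type uT} [Semigroup S] [Preorder T] [CausalAction S T]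

theorem smul_le_smul {s : S} {t t' : T} : s • t ≤ s • t' ↔ t ≤ t' :=
  CausalAction.smul_le_smul_iff' s t t'

theorem smul_lt_smul {s : S} {t t' : T} : s • t < s • t' ↔ t < t' := by
  rw [lt_iff_le_not_ge, smul_le_smul, smul_le_smul, ← lt_iff_le_not_ge]

theorem clsMap_cls (s : S) (t : T) : clsMap s (cls t) = cls (s • t) := rfl

theorem clsMap_injective (s : S) : Function.Injective (clsMap s : Cls T → Cls T) := by
  intro c c' h
  obtain ⟨t, rfl⟩ := exists_cls_eq c
  obtain ⟨t', rfl⟩ := exists_cls_eq c'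
  rw [clsMap_cls, clsMap_cls, cls_eq_cls, smul_le_smul, smul_le_smul] at h
  exact cls_eq_cls.2 h

theorem clsMap_mul (s s' : S) (c : Cls T) : clsMap (s * s') c = clsMap s (clsMap s' c) := by
  obtain ⟨t, rfl⟩ := exists_cls_eq c
  rw [clsMap_cls, clsMap_cls, clsMap_cls, mul_smul]

theorem mem_image {s : S} {k : Finset T} {u : T} : u ∈ image s k ↔ ∃ t ∈ k, s • t = u := by
  classical
  exact Finset.mem_image

theorem image_mul (s s' : S) (k : Finset T) : image (s * s') k = image s (image s' k) := by
  ext u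
  simp only [mem_image]
  constructor
  · rintro ⟨t, ht, rfl⟩; exact ⟨s' • t, ⟨t, ht, rfl⟩, (mul_smul _ _ _).symm⟩
  · rintro ⟨_, ⟨t, ht, rfl⟩, rfl⟩; exact ⟨t, ht, mul_smul _ _ _⟩

theorem image_empty (s : S) : image s (∅ : Finset T) = ∅ := by
  ext u; simp [mem_image]

theorem image_mono (s : S) {k k' : Finset T} (h : k ⊆ k') : image s k ⊆ image s k' := fun u hu => by
  obtain ⟨t, ht, rfl⟩ := mem_image.1 hu
  exact mem_image.2 ⟨t, h ht, rfl⟩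

theorem Nonanticipatory.image {k : Finset T} (h : Nonanticipatory (k : Set T)) (s : S) :
    Nonanticipatory (image s k : Set T) := by
  intro u hu v hv
  obtain ⟨t, ht, rfl⟩ := mem_image.1 hu
  obtain ⟨t', ht', rfl⟩ := mem_image.1 hv
  rw [smul_lt_smul]
  exact h t ht t' ht'

theorem causalLE_image {k : Finset T} {j : Set T} (s : S) (h : CausalLE (k : Set T) j) :
    CausalLE (image s k : Set T) ((s • ·) '' j) := by
  intro u hu
  obtain ⟨t, ht, rfl⟩ := mem_image.1 hu
  obtain ⟨v, hv, htv⟩ := h t ht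
  exact ⟨_, ⟨v, hv, rfl⟩, smul_le_smul.2 htv⟩

theorem coe_image (s : S) (k : Finset T) : (image s k : Set T) = (s • ·) '' (k : Set T) := by
  ext u; simp [mem_image]

theorem clsOf_image (s : S) (k : Finset T) :
    clsOf (image s k : Set T) = clsMap s '' clsOf (k : Set T) := by
  ext c
  constructor
  · rintro ⟨u, hu, rfl⟩
    obtain ⟨t, ht, rfl⟩ := mem_image.1 hu
    exact ⟨cls t, ⟨t, ht, rfl⟩, rfl⟩
  · rintro ⟨_, ⟨t, ht, rfl⟩, rfl⟩
    exact ⟨s • t, mem_image.2 ⟨t, ht, rfl⟩, rfl⟩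

theorem inClass_image (s : S) (Λ : Finset T) (c : Cls T) :
    inClass (image s Λ) (clsMap s c) = image s (inClass Λ c) := by
  ext u
  simp only [mem_inClass, mem_image]
  constructor
  · rintro ⟨⟨t, ht, rfl⟩, h⟩
    exact ⟨t, ⟨ht, clsMap_injective s h⟩, rfl⟩
  · rintro ⟨t, ⟨ht, rfl⟩, rfl⟩
    exact ⟨⟨t, ht, rfl⟩, rfl⟩

/-- The inverse image of a slice under a transformation that is surjective on the classes. -/
def Slice.preimage (s : S) (hs : Function.Surjective (clsMap s : Cls T → Cls T)) (l : Slice T) :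
    Slice T :=
  ⟨{t | s • t ∈ l.1}, fun t ht t' ht' hlt =>
    l.nonanticipatory _ ht _ ht' (smul_lt_smul.2 hlt), fun j hj hsub x hx => by
      refine l.mem_of_forall fun v hv => ?_
      -- Surjectivity on classes: every `v ∈ l` is equivalent to some `s • t` with `t` in the
      -- preimage, so comparisons of `s • x` with `v` reduce to comparisons of `x` with `t`.
      obtain ⟨c, hc⟩ := hs (cls v)
      obtain ⟨t, rfl⟩ := exists_cls_eq c
      have ht : s • t ∈ l.1 := l.mem_of_cls_eq hv hc.symm
      rw [← cls_lt_cls, ← cls_lt_cls (t' := v), ← hc, clsMap_cls, cls_lt_cls, cls_lt_cls,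
        smul_lt_smul, smul_lt_smul]
      exact ⟨hj t (hsub ht) x hx, hj x hx t (hsub ht)⟩⟩

end ActionLemmas

/-! ### Paths -/

section Paths

variable {S : Type uS} {T : Type uT} {K : Type uK} [Semigroup S] [Preorder T] [CausalAction S T]
  [NormedAddCommGroup K] [InnerProductSpace ℂ K] [CompleteSpace K]

namespace Setting

variable (X : Setting.{uS, uT, uE, uK} S T K)

theorem nonempty_space : Nonempty X.Ω := ⟨fun c => (X.nonempty c).some⟩

theorem events_empty {B : Set X.Ω} (hB : B ∈ X.𝓑 ∅) : B = ∅ ∨ B = Set.univ := by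
  rw [Set.eq_empty_iff_forall_notMem, Set.eq_univ_iff_forall]
  by_contra! h
  obtain ⟨⟨x, hx⟩, y, hy⟩ := h
  refine hy (X.cylinder ∅ (by simp [Nonanticipatory]) B hB x y ?_ hx)
  rintro c ⟨t, ht, -⟩
  simp at ht

/-- Nonempty sets of points of one class are causally equivalent, so `𝓑_equiv` applies. Nonemptiness
matters: `∅` is equivalent only to itself. -/
theorem events_mono {k k' : Finset T} {c : Cls T} (hk : k.Nonempty) (h : k ⊆ k')
    (hk' : ∀ t ∈ k', cls t = c) : X.𝓑 k ⊆ X.𝓑 k' := by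
  have h1 : Nonanticipatory (k' : Set T) := nonanticipatory_of_cls hk'
  have h2 := X.𝓑_equiv k k' (h1.mono h) h1 ⟨CausalLE.of_subset h, fun t ht => by
    obtain ⟨u, hu⟩ := hk
    exact ⟨u, hu, (cls_eq_cls.1 ((hk' t ht).trans (hk' u (h hu)).symm)).1⟩⟩
  have h3 : union k k' = k' := by
    ext t; rw [mem_union]; exact ⟨fun h' => h'.elim (fun x => h x) id, Or.inr⟩
  rw [h3] at h2
  exact Set.subset_union_left.trans h2

theorem univ_mem_events (k : Finset T) (hk : Nonanticipatory (k : Set T)) :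
    Set.univ ∈ X.𝓑 k := (X.semiring k hk).univ_mem

theorem pathsOn_apply {Λ : Finset T} {b : Cls T → Set X.Ω} (hb : b ∈ X.PathsOn Λ) (c : Cls T) :
    b c ∈ X.𝓑 (inClass Λ c) := by
  by_cases h : c ∈ clsOf (Λ : Set T)
  · exact (hb c).1 h
  · rw [(hb c).2 h]; exact X.univ_mem_events _ (inClass_nonanticipatory _ _)

theorem pathsOn_mono {Λ Λ' : Finset T} (h : Λ ⊆ Λ') : X.PathsOn Λ ⊆ X.PathsOn Λ' := by
  intro b hb c
  refine ⟨fun hc => ?_, fun hc => (hb c).2 fun ⟨t, ht, htc⟩ => hc ⟨t, h ht, htc⟩⟩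
  by_cases hc' : c ∈ clsOf (Λ : Set T)
  · refine X.events_mono (inClass_nonempty hc') (c := c) (fun t ht => ?_)
      (fun t ht => (mem_inClass.1 ht).2) ((hb c).1 hc')
    exact mem_inClass.2 ⟨h (mem_inClass.1 ht).1, (mem_inClass.1 ht).2⟩
  · rw [(hb c).2 hc']; exact X.univ_mem_events _ (inClass_nonanticipatory _ _)

theorem pathsOn_inter {Λ : Finset T} {b b' : Cls T → Set X.Ω} (hb : b ∈ X.PathsOn Λ)
    (hb' : b' ∈ X.PathsOn Λ) : b ⊓ b' ∈ X.PathsOn Λ := fun c =>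
  ⟨fun hc => (X.semiring _ (inClass_nonanticipatory _ _)).inter_mem _ ((hb c).1 hc) _
    ((hb' c).1 hc), fun hc => by simp [(hb c).2 hc, (hb' c).2 hc]⟩

theorem finite_clsOf (Λ : Finset T) : (clsOf (Λ : Set T)).Finite := Λ.finite_toSet.image _

theorem pathsOn_subset_paths (Λ : Finset T) : X.PathsOn Λ ⊆ X.Paths := fun b hb =>
  ⟨fun c => ⟨inClass Λ c, fun _ ht => (mem_inClass.1 ht).2, X.pathsOn_apply hb c⟩,
    (finite_clsOf Λ).subset fun c hc => by
      by_contra h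
      exact hc ((hb c).2 h)⟩

theorem exists_pathsOn {b : Cls T → Set X.Ω} (hb : b ∈ X.Paths) :
    ∃ Λ : Finset T, b ∈ X.PathsOn Λ ∧ ∀ t ∈ Λ, b (cls t) ≠ Set.univ := by
  classical
  -- An event over `k = ∅` may be the empty set. Representing it over a nonempty set of points of
  -- the class makes every nontrivial class of `b` visible in `Λ`.
  have h1 : ∀ c, ∃ k : Finset T, k.Nonempty ∧ (∀ t ∈ k, cls t = c) ∧ b c ∈ X.𝓑 k := by
    intro c
    obtain ⟨k, hk, hbk⟩ := hb.1 c
    by_cases h0 : k = ∅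
    · subst h0
      obtain ⟨t, rfl⟩ := exists_cls_eq c
      have hs : Nonanticipatory (({t} : Finset T) : Set T) := by simp [Nonanticipatory]
      refine ⟨{t}, by simp, by simp, ?_⟩
      rcases X.events_empty hbk with h | h
      · rw [h]; exact (X.semiring _ hs).empty_mem
      · rw [h]; exact (X.semiring _ hs).univ_mem
    · exact ⟨k, Finset.nonempty_iff_ne_empty.2 h0, hk, hbk⟩
  choose k hk0 hk hbk using h1
  refine ⟨hb.2.toFinset.biUnion k, fun c => ⟨fun hc => ?_, fun hc => ?_⟩, fun t ht => ?_⟩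
  · obtain ⟨t, ht, rfl⟩ := hc
    obtain ⟨c, hc, htc⟩ := Finset.mem_biUnion.1 ht
    have : inClass (hb.2.toFinset.biUnion k) (cls t) = k (cls t) := by
      ext u
      rw [mem_inClass, Finset.mem_biUnion]
      constructor
      · rintro ⟨⟨c', hc', hu⟩, hut⟩
        rw [← hut, hk c' u hu]; exact hu
      · intro hu
        exact ⟨⟨c, hc, by rwa [← hk c t htc]⟩, hk _ u hu⟩
    rw [this]; exact hbk _
  · by_contra h
    obtain ⟨t, ht⟩ := hk0 c
    exact hc ⟨t, Finset.mem_biUnion.2 ⟨c, by simpa using h, ht⟩, hk c t ht⟩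
  · obtain ⟨c, hc, htc⟩ := Finset.mem_biUnion.1 ht
    rw [hk c t htc]
    simpa using hc

theorem unit_mem_pathsOn (Λ : Finset T) : X.unit ∈ X.PathsOn Λ := fun _ =>
  ⟨fun _ => X.univ_mem_events _ (inClass_nonanticipatory _ _), fun _ => rfl⟩

theorem unit_mem_paths : X.unit ∈ X.Paths := X.pathsOn_subset_paths ∅ (X.unit_mem_pathsOn ∅)

theorem pathsOn_empty {b : Cls T → Set X.Ω} (hb : b ∈ X.PathsOn ∅) : b = X.unit :=
  funext fun c => (hb c).2 (by rintro ⟨t, ht, -⟩; simp at ht)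

theorem paths_inter {b b' : Cls T → Set X.Ω} (hb : b ∈ X.Paths) (hb' : b' ∈ X.Paths) :
    b ⊓ b' ∈ X.Paths := by
  classical
  obtain ⟨Λ, hΛ, -⟩ := X.exists_pathsOn hb
  obtain ⟨Λ', hΛ', -⟩ := X.exists_pathsOn hb'
  exact X.pathsOn_subset_paths (Λ ∪ Λ') (X.pathsOn_inter
    (X.pathsOn_mono Finset.subset_union_left hΛ) (X.pathsOn_mono Finset.subset_union_right hΛ'))

theorem mem_pathsBelow_iff {j : Set T} {b : Cls T → Set X.Ω} :
    b ∈ X.PathsBelow j ↔ ∃ Λ : Finset T, CausalLE (Λ : Set T) j ∧ b ∈ X.PathsOn Λ := by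
  constructor
  · rintro ⟨hb, h⟩
    obtain ⟨Λ, hΛ, hs⟩ := X.exists_pathsOn hb
    refine ⟨Λ, fun t ht => ?_, hΛ⟩
    obtain ⟨u, hu, htu⟩ := h _ (hs t ht)
    exact ⟨u, hu, cls_le_cls.1 htu⟩
  · rintro ⟨Λ, hΛ, hb⟩
    refine ⟨X.pathsOn_subset_paths Λ hb, fun c hc => ?_⟩
    have : c ∈ clsOf (Λ : Set T) := by
      by_contra h
      exact hc ((hb c).2 h)
    obtain ⟨t, ht, rfl⟩ := this
    obtain ⟨u, hu, htu⟩ := hΛ t ht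
    exact ⟨u, hu, cls_le_cls.2 htu⟩

theorem pathsBelow_subset_paths (j : Set T) : X.PathsBelow j ⊆ X.Paths := fun _ h => h.1

theorem pathsBelow_mono {j j' : Set T} (h : CausalLE j j') : X.PathsBelow j ⊆ X.PathsBelow j' := by
  intro b hb
  obtain ⟨Λ, hΛ, hb⟩ := X.mem_pathsBelow_iff.1 hb
  exact X.mem_pathsBelow_iff.2 ⟨Λ, hΛ.trans h, hb⟩

theorem unit_mem_pathsBelow (j : Set T) : X.unit ∈ X.PathsBelow j :=
  ⟨X.unit_mem_paths, fun _ h => absurd rfl h⟩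

theorem eq_unit_of_mem_pathsBelow_empty {b : Cls T → Set X.Ω} (hb : b ∈ X.PathsBelow ∅) :
    b = X.unit := by
  funext c
  by_contra h
  obtain ⟨t, ht, -⟩ := hb.2 c h
  exact ht

theorem inter_ne_univ {b b' : Cls T → Set X.Ω} {c : Cls T} (h : (b ⊓ b') c ≠ Set.univ) :
    b c ≠ Set.univ ∨ b' c ≠ Set.univ := by
  by_contra! h'
  exact h (by simp [h'.1, h'.2])

theorem pathsBelow_inter {j : Set T} {b b' : Cls T → Set X.Ω} (hb : b ∈ X.PathsBelow j)
    (hb' : b' ∈ X.PathsBelow j) : b ⊓ b' ∈ X.PathsBelow j :=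
  ⟨X.paths_inter hb.1 hb'.1, fun c hc =>
    (X.inter_ne_univ hc).elim (fun h => hb.2 c h) fun h => hb'.2 c h⟩

theorem pathsOn_subset_pathsBelow {k : Finset T} {j : Set T} (h : CausalLE (k : Set T) j) :
    X.PathsOn k ⊆ X.PathsBelow j := fun _ hb => X.mem_pathsBelow_iff.2 ⟨k, h, hb⟩

/-- The paths whose support contains no class that strictly succeeds a point of `k`. -/
def Past (k : Set T) : Set (Cls T → Set X.Ω) :=
  {b | b ∈ X.Paths ∧ ∀ c, b c ≠ Set.univ → ∀ t ∈ k, ¬ cls t < c}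

theorem past_inter {k : Set T} {b b' : Cls T → Set X.Ω} (hb : b ∈ X.Past k)
    (hb' : b' ∈ X.Past k) : b ⊓ b' ∈ X.Past k :=
  ⟨X.paths_inter hb.1 hb'.1, fun c hc =>
    (X.inter_ne_univ hc).elim (fun h => hb.2 c h) fun h => hb'.2 c h⟩

theorem past_anti {k k' : Set T} (h : k ⊆ k') : X.Past k' ⊆ X.Past k :=
  fun _ hb => ⟨hb.1, fun c hc t ht => hb.2 c hc t (h ht)⟩

theorem past_eq_of_clsOf {k k' : Set T} (h : clsOf k = clsOf k') : X.Past k = X.Past k' := by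
  have key : ∀ {k k' : Set T}, clsOf k ⊆ clsOf k' → X.Past k' ⊆ X.Past k := by
    intro k k' h b hb
    refine ⟨hb.1, fun c hc t ht => ?_⟩
    obtain ⟨u, hu, hut⟩ := h ⟨t, ht, rfl⟩
    rw [← hut]; exact hb.2 c hc u hu
  exact (key h.symm.le).antisymm (key h.le)

theorem pathsBelow_subset_past {k j : Set T} (hj : Nonanticipatory j) (h : k ⊆ j) :
    X.PathsBelow j ⊆ X.Past k := by
  rintro b hb
  refine ⟨hb.1, fun c hc t ht hlt => ?_⟩
  obtain ⟨u, hu, hcu⟩ := hb.2 c hc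
  exact hj t (h ht) u hu (cls_lt_cls.1 (hlt.trans_le hcu))

theorem pathsOn_subset_past {k : Finset T} (hk : Nonanticipatory (k : Set T)) :
    X.PathsOn k ⊆ X.Past (k : Set T) :=
  (X.pathsOn_subset_pathsBelow (CausalLE.of_subset subset_rfl)).trans
    (X.pathsBelow_subset_past hk subset_rfl)

theorem past_pathsOn {k : Set T} {b : Cls T → Set X.Ω} {Λ : Finset T} (hb : b ∈ X.PathsOn Λ)
    (h : ∀ u ∈ Λ, ∀ t ∈ k, ¬ t < u) : b ∈ X.Past k := by
  refine ⟨X.pathsOn_subset_paths Λ hb, fun c hc t ht hlt => ?_⟩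
  have : c ∈ clsOf (Λ : Set T) := by
    by_contra h
    exact hc ((hb c).2 h)
  obtain ⟨u, hu, rfl⟩ := this
  exact h u hu t ht (cls_lt_cls.1 hlt)

/-- Finitely many paths in the past of `k` lie below a common slice that contains `k`. -/
theorem exists_slice_of_past {k : Finset T} (hk : Nonanticipatory (k : Set T))
    {b b' : Cls T → Set X.Ω} (hb : b ∈ X.Past (k : Set T)) (hb' : b' ∈ X.Past (k : Set T)) :
    ∃ l : Slice T, (k : Set T) ⊆ l.1 ∧ b ∈ X.PathsBelow l.1 ∧ b' ∈ X.PathsBelow l.1 := by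
  classical
  obtain ⟨Λ, hΛ, hs⟩ := X.exists_pathsOn hb.1
  obtain ⟨Λ', hΛ', hs'⟩ := X.exists_pathsOn hb'.1
  obtain ⟨l, hl, hle⟩ := exists_slice_above (Λ := Λ ∪ Λ') hk (by
    intro u hu t ht hlt
    rcases Finset.mem_union.1 hu with hu | hu
    · exact hb.2 _ (hs u hu) t ht (cls_lt_cls.2 hlt)
    · exact hb'.2 _ (hs' u hu) t ht (cls_lt_cls.2 hlt))
  refine ⟨l, hl, X.mem_pathsBelow_iff.2 ⟨Λ, ?_, hΛ⟩, X.mem_pathsBelow_iff.2 ⟨Λ', ?_, hΛ'⟩⟩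
  · exact (CausalLE.of_subset (by simp)).trans hle
  · exact (CausalLE.of_subset (by simp)).trans hle

theorem box_inter (b b' : Cls T → Set X.Ω) (j : Set T) :
    X.box (b ⊓ b') j = X.box b j ∩ X.box b' j := by
  ext x
  simp only [box, Set.mem_iInter, Set.mem_inter_iff, Pi.inf_apply, Set.inf_eq_inter]
  exact ⟨fun h => ⟨fun c hc => (h c hc).1, fun c hc => (h c hc).2⟩,
    fun h c hc => ⟨h.1 c hc, h.2 c hc⟩⟩

theorem box_unit (j : Set T) : X.box X.unit j = Set.univ := by simp [box, unit]

theorem box_congr {b b' : Cls T → Set X.Ω} {j : Set T} (h : ∀ c ∈ clsOf j, b c = b' c) :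
    X.box b j = X.box b' j := by
  unfold box
  exact Set.iInter₂_congr h

theorem box_eq_of_subset {b : Cls T → Set X.Ω} {k j : Set T} (h : clsOf k ⊆ clsOf j)
    (hb : ∀ c ∈ clsOf j, c ∉ clsOf k → b c = Set.univ) : X.box b k = X.box b j := by
  ext x
  simp only [box, Set.mem_iInter]
  refine ⟨fun hx c hc => ?_, fun hx c hc => hx c (h hc)⟩
  by_cases hck : c ∈ clsOf k
  · exact hx c hck
  · rw [hb c hc hck]; trivial

open Classical in
/-- The path that coincides with `b` on a set of classes and is trivial elsewhere. -/
def restrict (b : Cls T → Set X.Ω) (C : Set (Cls T)) : Cls T → Set X.Ω :=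
  fun c => if c ∈ C then b c else Set.univ

theorem restrict_of_mem (b : Cls T → Set X.Ω) {C : Set (Cls T)} {c : Cls T} (h : c ∈ C) :
    X.restrict b C c = b c := if_pos h

theorem restrict_of_notMem (b : Cls T → Set X.Ω) {C : Set (Cls T)} {c : Cls T} (h : c ∉ C) :
    X.restrict b C c = Set.univ := if_neg h

theorem restrict_inf_compl (b : Cls T → Set X.Ω) (C : Set (Cls T)) :
    X.restrict b Cᶜ ⊓ X.restrict b C = b := by
  funext c
  by_cases h : c ∈ C
  · simp [restrict_of_mem X b h, restrict_of_notMem X b (C := Cᶜ) (not_not.2 h)]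
  · simp [restrict_of_notMem X b h, restrict_of_mem X b (C := Cᶜ) h]

theorem restrict_ne_univ {b : Cls T → Set X.Ω} {C : Set (Cls T)} {c : Cls T}
    (h : X.restrict b C c ≠ Set.univ) : c ∈ C ∧ b c ≠ Set.univ := by
  by_cases hc : c ∈ C
  · exact ⟨hc, by rwa [restrict_of_mem X b hc] at h⟩
  · exact absurd (restrict_of_notMem X b hc) h

theorem restrict_mem_paths {b : Cls T → Set X.Ω} (hb : b ∈ X.Paths) (C : Set (Cls T)) :
    X.restrict b C ∈ X.Paths := by
  refine ⟨fun c => ?_, hb.2.subset fun c hc => (X.restrict_ne_univ hc).2⟩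
  by_cases hc : c ∈ C
  · rw [restrict_of_mem X b hc]; exact hb.1 c
  · rw [restrict_of_notMem X b hc]
    exact ⟨∅, by simp, X.univ_mem_events _ (by simp [Nonanticipatory])⟩

theorem restrict_mem_pathsBelow {b : Cls T → Set X.Ω} {j : Set T} (hb : b ∈ X.PathsBelow j)
    (C : Set (Cls T)) : X.restrict b C ∈ X.PathsBelow j :=
  ⟨X.restrict_mem_paths hb.1 C, fun c hc => hb.2 c (X.restrict_ne_univ hc).2⟩

theorem restrict_mem_pathsOn {b : Cls T → Set X.Ω} {Λ Λ' : Finset T} (hb : b ∈ X.PathsOn Λ)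
    (h : ∀ c ∈ clsOf (Λ' : Set T), inClass Λ' c = inClass Λ c) :
    X.restrict b (clsOf (Λ' : Set T)) ∈ X.PathsOn Λ' := by
  refine fun c => ⟨fun hc => ?_, fun hc => restrict_of_notMem X b hc⟩
  rw [restrict_of_mem X b hc, h c hc]
  exact X.pathsOn_apply hb c

/-- The part of a path that lies on a slice. -/
theorem exists_pathsOn_slice {b : Cls T → Set X.Ω} (hb : b ∈ X.Paths) (l : Slice T) :
    ∃ k : Finset T, (k : Set T) ⊆ l.1 ∧ X.restrict b (clsOf l.1) ∈ X.PathsOn k ∧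
      X.box (X.restrict b (clsOf l.1)) (k : Set T) = X.box b l.1 ∧
      ∀ t ∈ k, b (cls t) ≠ Set.univ := by
  classical
  obtain ⟨Λ, hΛ, hs⟩ := X.exists_pathsOn hb
  have hk : ((Λ.filter (· ∈ l.1) : Finset T) : Set T) ⊆ l.1 := fun t ht => (Finset.mem_filter.1 ht).2
  have hcl : ∀ c ∈ clsOf l.1, c ∉ clsOf ((Λ.filter (· ∈ l.1) : Finset T) : Set T) →
      b c = Set.univ := by
    intro c hc hck
    refine (hΛ c).2 ?_
    rintro ⟨t, ht, rfl⟩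
    exact hck ⟨t, Finset.mem_filter.2 ⟨ht, l.mem_of_cls_mem hc⟩, rfl⟩
  have heq : X.restrict b (clsOf l.1) =
      X.restrict b (clsOf ((Λ.filter (· ∈ l.1) : Finset T) : Set T)) := by
    funext c
    by_cases hc : c ∈ clsOf ((Λ.filter (· ∈ l.1) : Finset T) : Set T)
    · rw [restrict_of_mem X b hc, 
        restrict_of_mem X b (show c ∈ clsOf l.1 from Set.image_mono hk hc)]
    · rw [restrict_of_notMem X b hc]
      by_cases hc' : c ∈ clsOf l.1
      · rw [restrict_of_mem X b hc', hcl c hc' hc]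
      · rw [restrict_of_notMem X b hc']
  refine ⟨Λ.filter (· ∈ l.1), hk, ?_, ?_, fun t ht => hs t (Finset.mem_filter.1 ht).1⟩
  · rw [heq]
    refine X.restrict_mem_pathsOn hΛ fun c hc => ?_
    ext t
    rw [mem_inClass, mem_inClass, Finset.mem_filter]
    refine ⟨fun h => ⟨h.1.1, h.2⟩, fun h => ⟨⟨h.1, ?_⟩, h.2⟩⟩
    exact l.mem_of_cls_mem (h.2 ▸ Set.image_mono hk hc)
  · rw [X.box_eq_of_subset (Set.image_mono hk)]
    · exact X.box_congr fun c hc => restrict_of_mem X b hc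
    · intro c hc hck
      rw [restrict_of_mem X b hc, hcl c hc hck]

theorem causalIndep_inClass_sdiff {k : Finset T} [DecidableEq T]
    (hk : Nonanticipatory (k : Set T)) (c : Cls T) :
    CausalIndep (inClass k c : Set T) (k \ inClass k c : Finset T) := by
  intro t ht u hu
  have ht := mem_inClass.1 ht
  have hu := Finset.mem_sdiff.1 hu
  have hne : cls u ≠ cls t := fun h => hu.2 (mem_inClass.2 ⟨hu.1, h.trans ht.2⟩)
  refine ⟨fun h => ?_, fun h => ?_⟩
  · exact hk t ht.1 u hu.1 (cls_lt_cls.1 (lt_of_le_of_ne (cls_le_cls.2 h) hne.symm))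
  · exact hk u hu.1 t ht.1 (cls_lt_cls.1 (lt_of_le_of_ne (cls_le_cls.2 h) hne))

theorem union_inClass_sdiff {k : Finset T} [DecidableEq T] (c : Cls T) :
    union (inClass k c) (k \ inClass k c) = k := by
  ext t
  rw [mem_union, Finset.mem_sdiff]
  refine ⟨fun h => h.elim (fun h => (mem_inClass.1 h).1) fun h => h.1, fun h => ?_⟩
  by_cases h' : t ∈ inClass k c
  · exact Or.inl h'
  · exact Or.inr ⟨h, h'⟩

theorem inClass_sdiff_of_ne {k : Finset T} [DecidableEq T] {c c' : Cls T} (h : c' ≠ c) :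
    inClass (k \ inClass k c) c' = inClass k c' := by
  ext t
  simp only [mem_inClass, Finset.mem_sdiff]
  refine ⟨fun ht => ⟨ht.1.1, ht.2⟩, fun ht => ⟨⟨ht.1, fun h' => h ?_⟩, ht.2⟩⟩
  rw [← ht.2, h'.2]

theorem clsOf_sdiff_inClass {k : Finset T} [DecidableEq T] (c : Cls T) :
    clsOf ((k \ inClass k c : Finset T) : Set T) = clsOf (k : Set T) \ {c} := by
  ext c'
  constructor
  · rintro ⟨t, ht, rfl⟩
    have ht := Finset.mem_sdiff.1 ht
    exact ⟨⟨t, ht.1, rfl⟩, fun h => ht.2 (mem_inClass.2 ⟨ht.1, h⟩)⟩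
  · rintro ⟨⟨t, ht, rfl⟩, hne⟩
    exact ⟨t, Finset.mem_sdiff.2 ⟨ht, fun h => hne (mem_inClass.1 h).2⟩, rfl⟩

theorem box_insert_class {k : Finset T} [DecidableEq T] (β : Cls T → Set X.Ω) {c : Cls T}
    (hc : c ∈ clsOf (k : Set T)) :
    X.box β (k : Set T) = β c ∩ X.box β ((k \ inClass k c : Finset T) : Set T) := by
  ext x
  simp only [box, clsOf_sdiff_inClass, Set.mem_iInter, Set.mem_inter_iff]
  refine ⟨fun h => ⟨h c hc, fun c' hc' => h c' hc'.1⟩, fun h c' hc' => ?_⟩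
  by_cases h' : c' = c
  · rw [h']; exact h.1
  · exact h.2 c' ⟨hc', h'⟩

/-- The events of a finite nonanticipatory set are the products of events of its classes. -/
theorem box_mem_events (k : Finset T) (hk : Nonanticipatory (k : Set T)) :
    ∀ β ∈ X.PathsOn k, X.box β (k : Set T) ∈ X.𝓑 k := by
  classical
  induction k using Finset.strongInduction with
  | H k ih =>
    intro β hβ
    by_cases h0 : k = ∅
    · subst h0
      rw [X.pathsOn_empty hβ, box_unit]
      exact X.univ_mem_events _ hk
    obtain ⟨t, ht⟩ := Finset.nonempty_iff_ne_empty.2 h0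
    have hc : cls t ∈ clsOf (k : Set T) := ⟨t, ht, rfl⟩
    have hsub : k \ inClass k (cls t) ⊂ k := Finset.sdiff_ssubset
      (fun u hu => (mem_inClass.1 hu).1) (inClass_nonempty hc)
    have hk2 : Nonanticipatory ((k \ inClass k (cls t) : Finset T) : Set T) := hk.mono hsub.1
    have h1 := X.𝓑_indep _ _ (inClass_nonanticipatory k (cls t)) hk2
      (causalIndep_inClass_sdiff hk (cls t))
    rw [union_inClass_sdiff] at h1
    rw [h1, X.box_insert_class β hc]
    refine ⟨β (cls t), (hβ _).1 hc, _, ?_, rfl⟩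
    have h2 := ih _ hsub hk2 (X.restrict β (clsOf ((k \ inClass k (cls t) : Finset T) : Set T)))
      (X.restrict_mem_pathsOn hβ fun c' hc' => inClass_sdiff_of_ne (by
        rw [clsOf_sdiff_inClass] at hc'; exact hc'.2))
    rwa [X.box_congr (b' := β) (fun c' hc' => restrict_of_mem X β hc')] at h2

/-- Iterating `𝓑_indep` splits off one class at a time. The proviso for `k = ∅` is needed because
the only path there is `X.unit`, whose box is everything, while `∅ ∈ 𝓑 ∅`. -/
theorem exists_box_eq (k : Finset T) (hk : Nonanticipatory (k : Set T)) :
    ∀ B ∈ X.𝓑 k, (k = ∅ → B = Set.univ) → ∃ β ∈ X.PathsOn k, X.box β (k : Set T) = B := by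
  classical
  induction k using Finset.strongInduction with
  | H k ih =>
    intro B hB hB0
    by_cases h0 : k = ∅
    · exact ⟨X.unit, X.unit_mem_pathsOn k, by rw [box_unit, hB0 h0]⟩
    obtain ⟨t, ht⟩ := Finset.nonempty_iff_ne_empty.2 h0
    have hc : cls t ∈ clsOf (k : Set T) := ⟨t, ht, rfl⟩
    have hsub : k \ inClass k (cls t) ⊂ k := Finset.sdiff_ssubset
      (fun u hu => (mem_inClass.1 hu).1) (inClass_nonempty hc)
    have hk2 : Nonanticipatory ((k \ inClass k (cls t) : Finset T) : Set T) := hk.mono hsub.1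
    obtain ⟨B₁, hB₁, β₂, hβ₂, rfl⟩ : ∃ B₁ ∈ X.𝓑 (inClass k (cls t)),
        ∃ β₂ ∈ X.PathsOn (k \ inClass k (cls t)),
          B = B₁ ∩ X.box β₂ ((k \ inClass k (cls t) : Finset T) : Set T) := by
      -- If `k` lies in one class, the second factor would be an event over `∅`, possibly empty and
      -- then not a box; so the whole event is kept as the first factor.
      by_cases h2 : k \ inClass k (cls t) = ∅
      · refine ⟨B, ?_, X.unit, X.unit_mem_pathsOn _, by rw [box_unit, Set.inter_univ]⟩
        have : inClass k (cls t) = k :=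
          (show inClass k (cls t) ⊆ k from fun u hu => (mem_inClass.1 hu).1).antisymm
            (Finset.sdiff_eq_empty_iff_subset.1 h2)
        rwa [this]
      · have h1 := X.𝓑_indep _ _ (inClass_nonanticipatory k (cls t)) hk2
          (causalIndep_inClass_sdiff hk (cls t))
        rw [union_inClass_sdiff] at h1
        rw [h1] at hB
        obtain ⟨B₁, hB₁, B₂, hB₂, rfl⟩ := hB
        obtain ⟨β₂, hβ₂, rfl⟩ := ih _ hsub hk2 B₂ hB₂ fun h => absurd h h2
        exact ⟨B₁, hB₁, β₂, hβ₂, rfl⟩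
    refine ⟨Function.update β₂ (cls t) B₁, fun c => ⟨fun hc' => ?_, fun hc' => ?_⟩, ?_⟩
    · by_cases hct : c = cls t
      · subst hct; rw [Function.update_self]; exact hB₁
      · rw [Function.update_of_ne hct, ← inClass_sdiff_of_ne hct]
        exact X.pathsOn_apply hβ₂ c
    · have hct : c ≠ cls t := fun h => hc' (h ▸ hc)
      rw [Function.update_of_ne hct]
      exact (hβ₂ c).2 fun h => hc' (by rw [clsOf_sdiff_inClass] at h; exact h.1)
    · rw [X.box_insert_class _ hc, Function.update_self]
      congr 1
      refine X.box_congr fun c' hc' => Function.update_of_ne ?_ _ _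
      rw [clsOf_sdiff_inClass] at hc'
      exact hc'.2

/-- An event of one class depends on the coordinate of that class only. -/
theorem paths_cylinder {b : Cls T → Set X.Ω} (hb : b ∈ X.Paths) {c : Cls T} {x y : X.Ω}
    (h : x c = y c) (hx : x ∈ b c) : y ∈ b c := by
  obtain ⟨k, hk, hbk⟩ := hb.1 c
  refine X.cylinder k (nonanticipatory_of_cls hk) _ hbk x y ?_ hx
  rintro _ ⟨t, ht, rfl⟩
  rw [hk t ht]; exact h

/-- The projection of an event to the coordinate of one class. -/
def coord (B : Set X.Ω) (c : Cls T) : Set X.Ω := {x | ∃ y ∈ B, y c = x c}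

/-- A nonempty product determines its factors. This is what allows `evOp` to be a function of the
event rather than of a path representing it. -/
theorem coord_box {β : Cls T → Set X.Ω} (hβ : β ∈ X.Paths) {j : Set T}
    (hj : ∀ c ∉ clsOf j, β c = Set.univ) (hne : (X.box β j).Nonempty) :
    X.coord (X.box β j) = β := by
  classical
  obtain ⟨z, hz⟩ := hne
  rw [box, Set.mem_iInter₂] at hz
  funext c
  ext x
  constructor
  · rintro ⟨y, hy, hyx⟩
    by_cases hc : c ∈ clsOf j
    · exact X.paths_cylinder hβ hyx (Set.mem_iInter₂.1 hy c hc)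
    · rw [hj c hc]; trivial
  · intro hx
    refine ⟨Function.update z c (x c), Set.mem_iInter₂.2 fun c' hc' => ?_, Function.update_self ..⟩
    by_cases h : c' = c
    · subst h
      exact X.paths_cylinder hβ (Function.update_self ..).symm hx
    · exact X.paths_cylinder hβ (Function.update_of_ne h ..).symm (hz c' hc')

theorem exists_empty_of_box_empty {β : Cls T → Set X.Ω} (hβ : β ∈ X.Paths) {j : Set T}
    (h : X.box β j = ∅) : ∃ c ∈ clsOf j, β c = ∅ := by
  by_contra! h'
  have := X.nonempty_space
  choose! y hy using h'
  have : (fun c => y c c) ∈ X.box β j := Set.mem_iInter₂.2 fun c hc =>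
    X.paths_cylinder hβ rfl (hy c hc)
  rw [h] at this
  exact this

end Setting

end Paths

/-! ### The dilation of a kernel -/

section Dilation

variable {S : Type uS} {T : Type uT} {K : Type uK} [Semigroup S] [Preorder T] [CausalAction S T]
  [NormedAddCommGroup K] [InnerProductSpace ℂ K] [CompleteSpace K]
  {X : Setting.{uS, uT, uE, uK} S T K}
  {κ : (Cls T → Set X.Ω) → (Cls T → Set X.Ω) → K →L[ℂ] K}
  {H : Type uH} [NormedAddCommGroup H] [InnerProductSpace ℂ H] [CompleteSpace H]
  {vec : (Cls T → Set X.Ω) → K →L[ℂ] H}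

/-- The minimal decomposition `κ(b, b') = vec(b)* vec(b')` of a positive definite kernel. -/
structure IsDilation (X : Setting.{uS, uT, uE, uK} S T K)
    (κ : (Cls T → Set X.Ω) → (Cls T → Set X.Ω) → K →L[ℂ] K)
    (vec : (Cls T → Set X.Ω) → K →L[ℂ] H) : Prop where
  inner : ∀ b ∈ X.Paths, ∀ b' ∈ X.Paths, ∀ ζ ζ' : K,
    ⟪vec b ζ, vec b' ζ'⟫_ℂ = ⟪ζ, κ b b' ζ'⟫_ℂ
  total : (Submodule.span ℂ {x : H | ∃ b ∈ X.Paths, ∃ ζ, x = vec b ζ}).topologicalClosure = ⊤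

/-- The complex inequality `0 ≤` in 1⁰ includes reality. For the pair `b, b'` the sum of the
off-diagonal terms is real; taking `ζ'` and then `i ζ'` separates imaginary and real parts. -/
theorem kernel_hermitian (hκ : X.IsWideSense κ) {b b' : Cls T → Set X.Ω} (hb : b ∈ X.Paths)
    (hb' : b' ∈ X.Paths) (ζ ζ' : K) :
    ⟪ζ, κ b b' ζ'⟫_ℂ = (starRingEnd ℂ) ⟪ζ', κ b' b ζ⟫_ℂ := by
  have h1 : ∀ (b : Cls T → Set X.Ω) (_ : b ∈ X.Paths) (ζ : K), (⟪ζ, κ b b ζ⟫_ℂ).im = 0 := by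
    intro b hb ζ
    have := hκ.positivity 1 (fun _ => b) (fun _ => ζ) (fun _ => hb)
    simp only [Finset.univ_unique, Finset.sum_singleton] at this
    exact ((Complex.le_def.1 this).2).symm
  have h2 : ∀ z : K, (⟪ζ, κ b b' z⟫_ℂ).im + (⟪z, κ b' b ζ⟫_ℂ).im = 0 := by
    intro z
    have := hκ.positivity 2 ![b, b'] ![ζ, z] (by
      intro i; fin_cases i <;> simp [hb, hb'])
    simp only [Fin.sum_univ_two, Matrix.cons_val_zero, Matrix.cons_val_one] at this
    have := (Complex.le_def.1 this).2
    simp only [Complex.zero_im, Complex.add_im, h1 b hb, h1 b' hb'] at this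
    linarith
  have h3 := h2 ζ'
  have h4 := h2 (Complex.I • ζ')
  simp only [map_smul, inner_smul_right, inner_smul_left, Complex.conj_I, Complex.mul_im,
    Complex.I_re, Complex.I_im, Complex.neg_re, Complex.neg_im] at h4
  apply Complex.ext
  · simp only [Complex.conj_re]; linarith
  · simp only [Complex.conj_im]; linarith

/-- Kolmogorov decomposition: `H` is the reproducing kernel Hilbert space of the operator matrix
`(κ(b, b'))`, and its kernel functions serve as `vec`. -/
theorem exists_dilation (hκ : X.IsWideSense κ) :
    ∃ (H : Type (max uT uE uK)) (_ : NormedAddCommGroup H) (_ : InnerProductSpace ℂ H)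
      (_ : CompleteSpace H) (vec : (Cls T → Set X.Ω) → K →L[ℂ] H), IsDilation X κ vec := by
  classical
  let M : Matrix X.Paths X.Paths (K →L[ℂ] K) := fun b b' => κ b b'
  have hM : M.PosSemidef := by
    have htfae := (RKHS.posSemidef_tfae (K := M)).out 0 2
    refine htfae.2 ⟨?_, fun vv => ?_⟩
    · ext b b' ζ
      refine ext_inner_left ℂ fun z => ?_
      rw [Matrix.conjTranspose_apply, ContinuousLinearMap.star_eq_adjoint,
        ContinuousLinearMap.adjoint_inner_right, ← inner_conj_symm]
      exact (kernel_hermitian hκ b.2 b'.2 z ζ).symm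
    · let e := vv.support.equivFin.symm
      have h1 := hκ.positivity vv.support.card (fun i => ((e i : X.Paths) : Cls T → Set X.Ω))
        (fun i => vv (e i)) (fun i => (e i : X.Paths).2)
      have h2 := (Complex.le_def.1 h1).1
      refine (h2.trans (Complex.conj_re _).ge).trans (le_of_eq ?_)
      change _ = Complex.re _
      congr 1
      simp only [map_sum, inner_conj_symm]
      rw [Finset.sum_comm]
      simp only [Finsupp.sum]
      rw [← Finset.sum_coe_sort vv.support, ← Equiv.sum_comp e]
      refine Finset.sum_congr rfl fun i _ => ?_
      rw [← Finset.sum_coe_sort vv.support, ← Equiv.sum_comp e]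
  have : Fact M.PosSemidef := ⟨hM⟩
  refine ⟨RKHS.OfKernel M, inferInstance, inferInstance, inferInstance,
    fun b => if h : b ∈ X.Paths then RKHS.kerFun (RKHS.OfKernel M) ⟨b, h⟩ else 0, ?_, ?_⟩
  · intro b hb b' hb' ζ ζ'
    rw [dif_pos hb, dif_pos hb', ← inner_conj_symm, ← inner_conj_symm ζ, ← RKHS.kernel_inner,
      RKHS.OfKernel.kernel_ofKernel, inner_conj_symm, kernel_hermitian hκ hb hb', inner_conj_symm]
  · rw [← RKHS.kerFun_dense (H := RKHS.OfKernel M)]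
    congr 2
    ext x
    constructor
    · rintro ⟨b, hb, ζ, rfl⟩
      rw [dif_pos hb]; exact ⟨_, _, rfl⟩
    · rintro ⟨b, ζ, rfl⟩
      exact ⟨b, b.2, ζ, by rw [dif_pos b.2]⟩

/-! ### Identities for kernels -/

/-- Factorizability moves an event of one class from one argument to the other; induction over the
finitely many classes of `β` moves the whole path. -/
theorem kernel_inf_below (hκ : X.IsWideSense κ) {l : Slice T} {k : Finset T}
    (hkl : (k : Set T) ⊆ l.1) {β : Cls T → Set X.Ω} (hβ : β ∈ X.PathsOn k)
    {b b' : Cls T → Set X.Ω} (hb : b ∈ X.PathsBelow l.1) (hb' : b' ∈ X.PathsBelow l.1) :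
    κ (b ⊓ β) b' = κ b (b' ⊓ β) := by
  classical
  have hβl : β ∈ X.PathsBelow l.1 := X.pathsOn_subset_pathsBelow (CausalLE.of_subset hkl) hβ
  have key : ∀ C : Finset (Cls T), (C : Set (Cls T)) ⊆ clsOf (k : Set T) →
      ∀ b' ∈ X.PathsBelow l.1,
      κ (b ⊓ X.restrict β C) b' = κ b (b' ⊓ X.restrict β C) := by
    intro C
    induction C using Finset.induction_on with
    | empty =>
      intro _ b' _
      have : X.restrict β ((∅ : Finset (Cls T)) : Set (Cls T)) = ⊤ := by
        funext c; exact X.restrict_of_notMem β (by simp)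
      rw [this, inf_top_eq, inf_top_eq]
    | insert c C hc ih =>
      intro hC b' hb'
      rw [Finset.coe_insert, Set.insert_subset_iff] at hC
      have h1 : ∀ b : Cls T → Set X.Ω, b ⊓ X.restrict β ((insert c C : Finset (Cls T)) : Set (Cls T))
          = X.mulAt (b ⊓ X.restrict β (C : Set (Cls T))) c (β c) := by
        intro b
        funext c'
        unfold Setting.mulAt
        by_cases h : c' = c
        · subst h
          simp [X.restrict_of_mem β (C := insert c' (C : Set (Cls T)))
            (c := c') (by simp), X.restrict_of_notMem β (C := (C : Set (Cls T))) (c := c')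
            (by simpa using hc)]
        · rw [Function.update_of_ne h, Pi.inf_apply, Pi.inf_apply]
          congr 1
          by_cases h' : c' ∈ C
          · rw [X.restrict_of_mem β (by simp [h']), X.restrict_of_mem β (by simp [h'])]
          · rw [X.restrict_of_notMem β (by simp [h, h']), X.restrict_of_notMem β (by simp [h'])]
      have h2 : ∀ b : Cls T → Set X.Ω, X.mulAt (b ⊓ X.restrict β (C : Set (Cls T))) c (β c)
          = X.mulAt b c (β c) ⊓ X.restrict β (C : Set (Cls T)) := by
        intro b
        funext c'
        unfold Setting.mulAt
        by_cases h : c' = c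
        · subst h
          simp only [Function.update_self, Pi.inf_apply]
          exact Set.inter_right_comm _ _ _
        · simp [Function.update_of_ne h]
      have h3 : X.mulAt b' c (β c) ∈ X.PathsBelow l.1 := by
        have : X.mulAt b' c (β c) = b' ⊓ X.restrict β {c} := by
          funext c'
          unfold Setting.mulAt
          by_cases h : c' = c
          · subst h
            simp [X.restrict_of_mem β (C := {c'}) (c := c') rfl]
          · simp [Function.update_of_ne h, X.restrict_of_notMem β (C := {c}) (c := c') h]
        rw [this]
        exact X.pathsBelow_inter hb' (X.restrict_mem_pathsBelow hβl _)
      rw [h1, h1, hκ.factorizability l _ (X.pathsBelow_inter hb (X.restrict_mem_pathsBelow hβl _))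
        b' hb' c (Set.image_mono hkl hC.1) (inClass k c) (fun t ht => (mem_inClass.1 ht).2) (β c)
        (X.pathsOn_apply hβ c), ih hC.2 _ h3, h2]
  have h4 := key (Setting.finite_clsOf k).toFinset (by simp) b' hb'
  have h5 : X.restrict β ((Setting.finite_clsOf k).toFinset : Set (Cls T)) = β := by
    funext c
    by_cases hc : c ∈ clsOf (k : Set T)
    · rw [X.restrict_of_mem β (by simpa using hc)]
    · rw [X.restrict_of_notMem β (by simpa using hc), (hβ c).2 hc]
  rwa [h5] at h4

theorem kernel_inf_past (hκ : X.IsWideSense κ) {k : Finset T} (hk : Nonanticipatory (k : Set T))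
    {β : Cls T → Set X.Ω} (hβ : β ∈ X.PathsOn k)
    {b b' : Cls T → Set X.Ω} (hb : b ∈ X.Past (k : Set T)) (hb' : b' ∈ X.Past (k : Set T)) :
    κ (b ⊓ β) b' = κ b (b' ⊓ β) := by
  obtain ⟨l, hl, h1, h2⟩ := X.exists_slice_of_past hk hb hb'
  exact kernel_inf_below hκ hl hβ h1 h2

/-- An empty factor on a slice makes the box empty, and an empty box is the disjoint union of
countably many copies of itself. By 3⁰ the constant series of values converges, so its term
vanishes. -/
theorem kernel_eq_zero (hκ : X.IsWideSense κ) {k : Finset T} (hk : Nonanticipatory (k : Set T))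
    {b : Cls T → Set X.Ω} (hb : b ∈ X.Past (k : Set T)) {c : Cls T} (hc : c ∈ clsOf (k : Set T))
    (h : b c = ∅) (ζ : K) : ⟪ζ, κ b b ζ⟫_ℂ = 0 := by
  obtain ⟨l, hl, h1, -⟩ := X.exists_slice_of_past hk hb hb
  obtain ⟨Λ, hΛ, hbΛ⟩ := X.mem_pathsBelow_iff.1 h1
  have hbox : X.box b l.1 = ∅ := by
    rw [Set.eq_empty_iff_forall_notMem]
    intro x hx
    have := Set.mem_iInter₂.1 hx c (Set.image_mono hl hc)
    rw [h] at this
    exact this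
  have h2 := hκ.sigma_additivity l Λ hΛ b hbΛ (fun _ => b) (fun _ => hbΛ) (fun _ _ _ => rfl)
    (fun _ _ _ => by simp [hbox]) (by simp [hbox]) ζ
  exact (summable_const_iff _).1 h2.summable

theorem commute_kernel (hκ : X.IsWideSense κ) {k : Finset T} (hk : Nonanticipatory (k : Set T))
    {a : K →L[ℂ] K} (ha : a ∈ X.𝔄 k) {b b' : Cls T → Set X.Ω}
    (hb : b ∈ X.PathsBelow (k : Set T)) (hb' : b' ∈ X.PathsBelow (k : Set T)) :
    Commute a (κ b b') := by
  classical
  obtain ⟨Λ, hΛ, hb⟩ := X.mem_pathsBelow_iff.1 hb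
  obtain ⟨Λ', hΛ', hb'⟩ := X.mem_pathsBelow_iff.1 hb'
  refine hκ.commutant (Λ ∪ Λ') b (X.pathsOn_mono Finset.subset_union_left hb) b'
    (X.pathsOn_mono Finset.subset_union_right hb') a
    (X.𝔄_anti _ _ (top_nonanticipatory _) hk ?_ ha)
  intro t ht
  rcases Finset.mem_union.1 (top_subset _ ht) with h | h
  · exact hΛ t h
  · exact hΛ' t h

theorem exists_finset_causalLE {Λ : Finset T} {j : Set T} (h : CausalLE (Λ : Set T) j) :
    ∃ k : Finset T, (k : Set T) ⊆ j ∧ CausalLE (Λ : Set T) (k : Set T) := by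
  classical
  choose! f hf hf' using h
  refine ⟨Λ.image f, fun u hu => ?_, fun t ht => ⟨f t, ?_, hf' t ht⟩⟩
  · obtain ⟨t, ht, rfl⟩ := Finset.mem_image.1 hu
    exact hf t ht
  · exact Finset.mem_image.2 ⟨t, ht, rfl⟩

theorem mem_sliceAlg {l : Slice T} {a : K →L[ℂ] K} :
    a ∈ X.sliceAlg l ↔ ∀ k : Finset T, (k : Set T) ⊆ l.1 → a ∈ X.𝔄 k := by
  simp [Setting.sliceAlg, StarSubalgebra.mem_iInf]

theorem commute_kernel_slice (hκ : X.IsWideSense κ) {l : Slice T}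
    {a : K →L[ℂ] K} (ha : a ∈ X.sliceAlg l) {b b' : Cls T → Set X.Ω}
    (hb : b ∈ X.PathsBelow l.1) (hb' : b' ∈ X.PathsBelow l.1) : Commute a (κ b b') := by
  classical
  obtain ⟨Λ, hΛ, hb⟩ := X.mem_pathsBelow_iff.1 hb
  obtain ⟨Λ', hΛ', hb'⟩ := X.mem_pathsBelow_iff.1 hb'
  obtain ⟨k, hk, h⟩ := exists_finset_causalLE hΛ
  obtain ⟨k', hk', h'⟩ := exists_finset_causalLE hΛ'
  have hkk : ((k ∪ k' : Finset T) : Set T) ⊆ l.1 := by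
    rw [Finset.coe_union]; exact Set.union_subset hk hk'
  refine commute_kernel hκ (l.nonanticipatory.mono hkk) (mem_sliceAlg.1 ha _ hkk)
    (X.mem_pathsBelow_iff.2 ⟨Λ, h.trans (CausalLE.of_subset (by simp)), hb⟩)
    (X.mem_pathsBelow_iff.2 ⟨Λ', h'.trans (CausalLE.of_subset (by simp)), hb'⟩)

/-! ### Operators on the space of a dilation -/

/-- The closed subspace generated by the vectors `vec b ζ` with `b ∈ A`. -/
def gen (vec : (Cls T → Set X.Ω) → K →L[ℂ] H) (A : Set (Cls T → Set X.Ω)) : Submodule ℂ H :=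
  (Submodule.span ℂ {x : H | ∃ b ∈ A, ∃ ζ, x = vec b ζ}).topologicalClosure

instance (A : Set (Cls T → Set X.Ω)) : (gen vec A).HasOrthogonalProjection := by
  unfold gen; infer_instance

theorem isClosed_gen (A : Set (Cls T → Set X.Ω)) : IsClosed (gen vec A : Set H) :=
  Submodule.isClosed_topologicalClosure _

theorem vec_mem_gen {A : Set (Cls T → Set X.Ω)} {b : Cls T → Set X.Ω} (hb : b ∈ A) (ζ : K) :
    vec b ζ ∈ gen vec A :=
  Submodule.le_topologicalClosure _ (Submodule.subset_span ⟨b, hb, ζ, rfl⟩)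

theorem gen_le {A : Set (Cls T → Set X.Ω)} {M : Submodule ℂ H} (hM : IsClosed (M : Set H))
    (h : ∀ b ∈ A, ∀ ζ, vec b ζ ∈ M) : gen vec A ≤ M := by
  refine Submodule.topologicalClosure_minimal _ (Submodule.span_le.2 ?_) hM
  rintro _ ⟨b, hb, ζ, rfl⟩
  exact h b hb ζ

theorem gen_mono {A A' : Set (Cls T → Set X.Ω)} (h : A ⊆ A') : gen vec A ≤ gen vec A' :=
  gen_le (isClosed_gen _) fun _ hb ζ => vec_mem_gen (h hb) ζ

theorem IsDilation.gen_paths (hv : IsDilation X κ vec) : gen vec X.Paths = ⊤ := hv.total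

theorem gen_clm_ext {H' : Type*} [NormedAddCommGroup H'] [InnerProductSpace ℂ H'] [CompleteSpace H']
    (A : Set (Cls T → Set X.Ω)) {P Q : H →L[ℂ] H'} (h : ∀ b ∈ A, ∀ ζ, P (vec b ζ) = Q (vec b ζ))
    (h' : ∀ x ∈ (gen vec A)ᗮ, P x = Q x) : P = Q := by
  refine clm_ext_of_span (s := {x : H | ∃ b ∈ A, ∃ ζ, x = vec b ζ}) ?_ h'
  rintro _ ⟨b, hb, ζ, rfl⟩
  exact h b hb ζ

theorem gen_eqOn {H' : Type*} [NormedAddCommGroup H'] [InnerProductSpace ℂ H']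
    (A : Set (Cls T → Set X.Ω)) {P Q : H →L[ℂ] H'} (h : ∀ b ∈ A, ∀ ζ, P (vec b ζ) = Q (vec b ζ))
    {x : H} (hx : x ∈ gen vec A) : P x = Q x := by
  have : gen vec A ≤ LinearMap.eqLocus P.toLinearMap Q.toLinearMap :=
    gen_le (isClosed_eq P.continuous Q.continuous) h
  exact this hx

theorem range_vec (A : Set (Cls T → Set X.Ω)) :
    Set.range (fun i : A × K => vec i.1 i.2) = {x : H | ∃ b ∈ A, ∃ ζ, x = vec b ζ} := by
  ext x
  constructor
  · rintro ⟨⟨b, ζ⟩, rfl⟩; exact ⟨b, b.2, ζ, rfl⟩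
  · rintro ⟨b, hb, ζ, rfl⟩; exact ⟨⟨⟨b, hb⟩, ζ⟩, rfl⟩

theorem mem_orthogonal_of_map {M : Submodule ℂ H} {P : H →L[ℂ] H}
    (h : ∀ x ∈ M, ContinuousLinearMap.adjoint P x ∈ M) {x : H} (hx : x ∈ Mᗮ) : P x ∈ Mᗮ := by
  rw [Submodule.mem_orthogonal] at hx ⊢
  intro u hu
  rw [← ContinuousLinearMap.adjoint_inner_left]
  exact hx _ (h u hu)

end Dilation

/-! ### Sums of orthogonal projections -/

section Projections

variable {H : Type*} [NormedAddCommGroup H] [InnerProductSpace ℂ H] [CompleteSpace H]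

theorem norm_sq_of_isStarProjection {P : H →L[ℂ] H} (hP : IsStarProjection P) (x : H) :
    ‖P x‖ ^ 2 = (⟪x, P x⟫_ℂ).re := by
  have h1 : ⟪x, P x⟫_ℂ = ⟪P x, P x⟫_ℂ := by
    rw [← ContinuousLinearMap.adjoint_inner_right, ← ContinuousLinearMap.star_eq_adjoint,
      hP.isSelfAdjoint.star_eq]
    exact congrArg (fun A : H →L[ℂ] H => ⟪x, A x⟫_ℂ) hP.isIdempotentElem.symm
  rw [h1, ← inner_self_eq_norm_sq (𝕜 := ℂ)]
  rfl

theorem norm_apply_le_of_isStarProjection {P : H →L[ℂ] H} (hP : IsStarProjection P) (x : H) :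
    ‖P x‖ ≤ ‖x‖ := by
  by_cases h0 : ‖P x‖ = 0
  · rw [h0]; exact norm_nonneg _
  refine le_of_mul_le_mul_right ?_ (lt_of_le_of_ne (norm_nonneg _) (Ne.symm h0))
  rw [← sq, norm_sq_of_isStarProjection hP]
  exact (Complex.re_le_norm _).trans (norm_inner_le_norm _ _)

/-- The differences `Q - ∑ P m` are projections, hence `‖Q x - ∑ P m x‖² = ‖Q x‖² - ∑ ‖P m x‖²`:
convergence of squared norms gives strong convergence. Since these differences are contractions, the
vectors with convergence form a closed subspace, and a generating set suffices. -/
theorem hasSum_of_projections {P : ℕ → H →L[ℂ] H} {Q : H →L[ℂ] H}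
    (hP : ∀ m, IsStarProjection (P m)) (hQ : IsStarProjection Q)
    (horth : Pairwise fun m m' => P m * P m' = 0) (hPQ : ∀ m, P m * Q = P m) {s : Set H}
    (hs : ∀ x, Q x ∈ (Submodule.span ℂ s).topologicalClosure)
    (h : ∀ x ∈ s, HasSum (fun m => ‖P m x‖ ^ 2) (‖Q x‖ ^ 2)) (x : H) :
    HasSum (fun m => P m x) (Q x) := by
  classical
  have hproj : ∀ F : Finset ℕ, IsStarProjection (∑ m ∈ F, P m) := by
    intro F
    induction F using Finset.induction_on with
    | empty => simp
    | insert m F hm ih =>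
      rw [Finset.sum_insert hm]
      refine (hP m).add ih ?_
      rw [Finset.mul_sum]
      exact Finset.sum_eq_zero fun m' hm' => horth fun h => hm (h ▸ hm')
  have hsub : ∀ F : Finset ℕ, IsStarProjection (Q - ∑ m ∈ F, P m) := fun F =>
    (hproj F).sub_of_mul_eq_left hQ (by rw [Finset.sum_mul]; simp [hPQ])
  have hnorm : ∀ (F : Finset ℕ) (x : H),
      ‖Q x - ∑ m ∈ F, P m x‖ ^ 2 = ‖Q x‖ ^ 2 - ∑ m ∈ F, ‖P m x‖ ^ 2 := by
    intro F x
    have h1 := norm_sq_of_isStarProjection (hsub F) x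
    rw [sub_apply, sum_apply] at h1
    rw [h1, inner_sub_right, Complex.sub_re, inner_sum, Complex.re_sum, norm_sq_of_isStarProjection hQ]
    congr 1
    exact Finset.sum_congr rfl fun m _ => (norm_sq_of_isStarProjection (hP m) x).symm
  have hgen : ∀ x ∈ s, HasSum (fun m => P m x) (Q x) := by
    intro x hx
    have h1 : Filter.Tendsto (fun F : Finset ℕ => ‖Q x‖ ^ 2 - ∑ m ∈ F, ‖P m x‖ ^ 2)
        Filter.atTop (nhds (‖Q x‖ ^ 2 - ‖Q x‖ ^ 2)) := (h x hx).const_sub _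
    rw [sub_self] at h1
    have h2 : Filter.Tendsto (fun F : Finset ℕ => ‖Q x - ∑ m ∈ F, P m x‖)
        Filter.atTop (nhds 0) := by
      have := (Real.continuous_sqrt.tendsto 0).comp h1
      rw [Real.sqrt_zero] at this
      refine this.congr fun F => ?_
      rw [Function.comp_apply, ← hnorm, Real.sqrt_sq (norm_nonneg _)]
    rw [HasSum, SummationFilter.unconditional_filter, tendsto_iff_norm_sub_tendsto_zero]
    exact h2.congr fun F => norm_sub_rev _ _
  let M : Submodule ℂ H :=
    { carrier := {x | HasSum (fun m => P m x) (Q x)}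
      zero_mem' := by simp
      add_mem' := fun {x y} hx hy => by
        have : HasSum (fun m => P m x + P m y) (Q x + Q y) := HasSum.add hx hy
        simpa using this
      smul_mem' := fun c x hx => by
        have : HasSum (fun m => c • P m x) (c • Q x) := HasSum.const_smul c hx
        simpa using this }
  have hM : IsClosed (M : Set H) := by
    refine isClosed_of_closure_subset fun x hx => ?_
    change HasSum _ _
    rw [HasSum, SummationFilter.unconditional_filter, Metric.tendsto_atTop]
    intro ε hε
    obtain ⟨y, hy, hxy⟩ := Metric.mem_closure_iff.1 hx (ε / 2) (by positivity)
    have hy' : HasSum (fun m => P m y) (Q y) := hy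
    rw [HasSum, SummationFilter.unconditional_filter, Metric.tendsto_atTop] at hy'
    obtain ⟨N, hN⟩ := hy' (ε / 2) (by positivity)
    refine ⟨N, fun F hF => ?_⟩
    have h1 := hN F hF
    have h2 := norm_apply_le_of_isStarProjection (hsub F) (x - y)
    rw [dist_eq_norm, norm_sub_rev] at h1 ⊢
    have h3 : Q x - ∑ m ∈ F, P m x
        = (Q - ∑ m ∈ F, P m) (x - y) + (Q y - ∑ m ∈ F, P m y) := by
      simp only [sub_apply, sum_apply, map_sub]
      abel
    rw [dist_eq_norm] at hxy
    rw [h3]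
    calc _ ≤ _ := norm_add_le _ _
      _ < ε / 2 + ε / 2 := add_lt_add (h2.trans_lt hxy) h1
      _ = ε := by ring
  -- Convergence is obtained at `Q x`, which lies in the closed span; `P m * Q = P m` carries it
  -- back to `x`.
  have h1 : Q x ∈ M :=
    Submodule.topologicalClosure_minimal _ (Submodule.span_le.2 fun x hx => hgen x hx) hM (hs x)
  have h2 : HasSum (fun m => P m (Q x)) (Q (Q x)) := h1
  have h3 : ∀ m, P m (Q x) = P m x := fun m => congrArg (fun A : H →L[ℂ] H => A x) (hPQ m)
  have h4 : Q (Q x) = Q x := congrArg (fun A : H →L[ℂ] H => A x) hQ.isIdempotentElem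
  simpa only [h3, h4] using h2

end Projections

/-! ### Multiplication operators and the representation of algebras on generators -/

section Operators

variable {S : Type uS} {T : Type uT} {K : Type uK} [Semigroup S] [Preorder T] [CausalAction S T]
  [NormedAddCommGroup K] [InnerProductSpace ℂ K] [CompleteSpace K]
  {X : Setting.{uS, uT, uE, uK} S T K}
  {κ : (Cls T → Set X.Ω) → (Cls T → Set X.Ω) → K →L[ℂ] K}
  {H : Type uH} [NormedAddCommGroup H] [InnerProductSpace ℂ H] [CompleteSpace H]
  {vec : (Cls T → Set X.Ω) → K →L[ℂ] H}

/-- `P` maps `vec b ζ` to `f b ζ` for `b ∈ A`, and vanishes on the orthogonal complement of these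
vectors. -/
structure IsOpOn (vec : (Cls T → Set X.Ω) → K →L[ℂ] H) (A : Set (Cls T → Set X.Ω))
    (f : (Cls T → Set X.Ω) → K → H) (P : H →L[ℂ] H) : Prop where
  on : ∀ b ∈ A, ∀ ζ, P (vec b ζ) = f b ζ
  off : ∀ x ∈ (gen vec A)ᗮ, P x = 0

theorem IsOpOn.unique {A : Set (Cls T → Set X.Ω)} {f : (Cls T → Set X.Ω) → K → H}
    {P Q : H →L[ℂ] H} (hP : IsOpOn vec A f P) (hQ : IsOpOn vec A f Q) : P = Q :=
  gen_clm_ext A (fun b hb ζ => (hP.on b hb ζ).trans (hQ.on b hb ζ).symm)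
    fun x hx => (hP.off x hx).trans (hQ.off x hx).symm

open Classical in
/-- The operator determined by its values `f b ζ` on the vectors `vec b ζ`, `b ∈ A`, if there is
one. -/
def opOn (vec : (Cls T → Set X.Ω) → K →L[ℂ] H) (A : Set (Cls T → Set X.Ω))
    (f : (Cls T → Set X.Ω) → K → H) : H →L[ℂ] H :=
  if h : ∃ P, IsOpOn vec A f P then h.choose else 0

theorem IsOpOn.eq {A : Set (Cls T → Set X.Ω)} {f : (Cls T → Set X.Ω) → K → H}
    {P : H →L[ℂ] H} (hP : IsOpOn vec A f P) : opOn vec A f = P := by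
  have h : ∃ P, IsOpOn vec A f P := ⟨P, hP⟩
  rw [opOn, dif_pos h]
  exact h.choose_spec.unique hP

/-- Factorizability and `β ⊓ β = β` give `κ(bβ, b'β) = κ(b, b'β)`, which is the Gram condition of
`exists_starProjection_of_inner`. -/
theorem exists_mulOp (hv : IsDilation X κ vec) {A : Set (Cls T → Set X.Ω)} (hA : A ⊆ X.Paths)
    {β : Cls T → Set X.Ω} (hβ : ∀ b ∈ A, b ⊓ β ∈ A)
    (h : ∀ b ∈ A, ∀ b' ∈ A, κ (b ⊓ β) b' = κ b (b' ⊓ β)) :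
    ∃ P, IsStarProjection P ∧ IsOpOn vec A (fun b ζ => vec (b ⊓ β) ζ) P := by
  obtain ⟨P, hP, hon, hoff⟩ := exists_starProjection_of_inner
    (fun i : A × K => vec i.1 i.2) (fun i : A × K => vec (i.1 ⊓ β) i.2)
    (fun i => by rw [range_vec]; exact vec_mem_gen (hβ _ i.1.2) _) (fun i j => by
      rw [hv.inner _ (hA (hβ _ i.1.2)) _ (hA (hβ _ j.1.2)), hv.inner _ (hA i.1.2) _
        (hA (hβ _ j.1.2)), h _ i.1.2 _ (hβ _ j.1.2), inf_assoc, inf_idem])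
  refine ⟨P, hP, fun b hb ζ => hon ⟨⟨b, hb⟩, ζ⟩, ?_⟩
  rw [range_vec] at hoff
  exact hoff

/-- Write `‖a‖² - a* a = d²` with `d ≥ 0`. As `a`, `a*` and `d` commute with the kernel on `A`,
inserting `a` and `d` into a combination of generators yields vectors `y`, `z` with `‖y‖² + ‖z‖² =
‖a‖² ‖x‖²`; so the assignment is bounded by `‖a‖`. -/
theorem exists_algOp (hv : IsDilation X κ vec) {A : Set (Cls T → Set X.Ω)} (hA : A ⊆ X.Paths)
    {a : K →L[ℂ] K} (h : ∀ b ∈ A, ∀ b' ∈ A, Commute a (κ b b'))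
    (h' : ∀ b ∈ A, ∀ b' ∈ A, Commute (star a) (κ b b')) :
    ∃ P, IsOpOn vec A (fun b ζ => vec b (a ζ)) P := by
  set e : K →L[ℂ] K := algebraMap ℝ _ (‖a‖ ^ 2) - star a * a with he
  have he0 : 0 ≤ e := sub_nonneg.2 CStarAlgebra.star_mul_le_algebraMap_norm_sq
  set d : K →L[ℂ] K := CFC.sqrt e with hd
  have hdd : d * d = e := CFC.sqrt_mul_sqrt_self e he0
  have hdsa : star d = d := (CFC.sqrt_nonneg e).isSelfAdjoint.star_eq
  have hdc : ∀ b ∈ A, ∀ b' ∈ A, Commute d (κ b b') := by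
    -- Being a square root, `d` is a continuous function of `a* a`, and so commutes with whatever
    -- commutes with `a* a`.
    intro b hb b' hb'
    refine Commute.cfcₙ_nnreal ?_ _
    rw [he]
    refine Commute.sub_left ?_ ((h' b hb b' hb').mul_left (h b hb b' hb'))
    exact Algebra.commutes _ _
  have hmove : ∀ (q : K →L[ℂ] K) (b : A) (b' : A) (ζ ζ' : K),
      Commute (star q) (κ b b') →
      ⟪vec b (q ζ), vec b' (q ζ')⟫_ℂ = ⟪ζ, κ b b' ((star q * q) ζ')⟫_ℂ := by
    intro q b b' ζ ζ' hc
    rw [hv.inner _ (hA b.2) _ (hA b'.2), ← ContinuousLinearMap.adjoint_inner_right,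
      ← ContinuousLinearMap.star_eq_adjoint]
    exact congrArg (fun C : K →L[ℂ] K => ⟪ζ, C (q ζ')⟫_ℂ) hc.eq
  have hsum : ∀ i j : A × K, ⟪vec i.1 (a i.2), vec j.1 (a j.2)⟫_ℂ
      + ⟪vec i.1 (d i.2), vec j.1 (d j.2)⟫_ℂ = (‖a‖ ^ 2 : ℝ) * ⟪vec i.1 i.2, vec j.1 j.2⟫_ℂ := by
    intro i j
    rw [hmove a _ _ _ _ (h' _ i.1.2 _ j.1.2), hmove d _ _ _ _ (hdsa.symm ▸ hdc _ i.1.2 _ j.1.2),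
      hv.inner _ (hA i.1.2) _ (hA j.1.2), ← inner_add_right, ← map_add, hdsa, hdd, he,
      ← add_apply, add_sub_cancel, Algebra.algebraMap_eq_smul_one,
      smul_apply, one_apply_eq_self]
    rw [show (‖a‖ ^ 2 : ℝ) • j.2 = ((‖a‖ ^ 2 : ℝ) : ℂ) • j.2 from (Complex.coe_smul _ _).symm,
      map_smul, inner_smul_right]
  obtain ⟨P, hon, hoff⟩ := exists_clm_of_bound (fun i : A × K => vec i.1 i.2)
    (fun i : A × K => vec i.1 (a i.2)) ‖a‖ (fun c => by
      set x := Finsupp.linearCombination ℂ (fun i : A × K => vec i.1 i.2) c with hx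
      set y := Finsupp.linearCombination ℂ (fun i : A × K => vec i.1 (a i.2)) c with hy
      set z := Finsupp.linearCombination ℂ (fun i : A × K => vec i.1 (d i.2)) c with hz
      have h1 : ⟪y, y⟫_ℂ + ⟪z, z⟫_ℂ = (‖a‖ ^ 2 : ℝ) * ⟪x, x⟫_ℂ := by
        simp only [hx, hy, hz, Finsupp.linearCombination_apply, Finsupp.sum_inner,
          Finsupp.inner_sum, inner_smul_left, inner_smul_right]
        simp only [Finsupp.sum, Finset.mul_sum, ← Finset.sum_add_distrib]
        refine Finset.sum_congr rfl fun i _ => Finset.sum_congr rfl fun j _ => ?_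
        linear_combination (c i * (starRingEnd ℂ) (c j)) * hsum j i
      have h2 := congrArg Complex.re h1
      rw [Complex.add_re, Complex.re_ofReal_mul] at h2
      change RCLike.re ⟪y, y⟫_ℂ + RCLike.re ⟪z, z⟫_ℂ = _ * RCLike.re ⟪x, x⟫_ℂ at h2
      rw [inner_self_eq_norm_sq, inner_self_eq_norm_sq, inner_self_eq_norm_sq] at h2
      refine abs_le_of_sq_le_sq' ?_ (by positivity) |>.2
      nlinarith [sq_nonneg ‖z‖])
  refine ⟨P, fun b hb ζ => hon ⟨⟨b, hb⟩, ζ⟩, ?_⟩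
  rw [range_vec] at hoff
  exact hoff

/-- The operator `vec b ζ ↦ vec b (a ζ)`. -/
def algOp (vec : (Cls T → Set X.Ω) → K →L[ℂ] H) (A : Set (Cls T → Set X.Ω)) (a : K →L[ℂ] K) :
    H →L[ℂ] H := opOn vec A fun b ζ => vec b (a ζ)

/-- The algebra `𝔄` commutes with the values of the kernel on `A`. -/
def CommutesOn (κ : (Cls T → Set X.Ω) → (Cls T → Set X.Ω) → K →L[ℂ] K)
    (A : Set (Cls T → Set X.Ω)) (𝔄 : StarSubalgebra ℂ (K →L[ℂ] K)) : Prop :=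
  ∀ a ∈ 𝔄, ∀ b ∈ A, ∀ b' ∈ A, Commute a (κ b b')

section AlgOp

variable {A : Set (Cls T → Set X.Ω)} {𝔄 : StarSubalgebra ℂ (K →L[ℂ] K)} {a a' : K →L[ℂ] K}

theorem isOpOn_algOp (hv : IsDilation X κ vec) (hA : A ⊆ X.Paths) (h : CommutesOn κ A 𝔄)
    (ha : a ∈ 𝔄) : IsOpOn vec A (fun b ζ => vec b (a ζ)) (algOp vec A a) := by
  obtain ⟨P, hP⟩ := exists_algOp hv hA (h a ha) (h _ (star_mem ha))
  rw [algOp, hP.eq]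
  exact hP

theorem algOp_mem (hv : IsDilation X κ vec) (hA : A ⊆ X.Paths) (h : CommutesOn κ A 𝔄)
    (ha : a ∈ 𝔄) {A' : Set (Cls T → Set X.Ω)} (hA' : A' ⊆ A) {x : H} (hx : x ∈ gen vec A') :
    algOp vec A a x ∈ gen vec A' := by
  have h1 : gen vec A' ≤ (gen vec A').comap (algOp vec A a).toLinearMap :=
    gen_le ((isClosed_gen A').preimage (algOp vec A a).continuous) fun b hb ζ => by
      rw [Submodule.mem_comap, ContinuousLinearMap.coe_coe,
        (isOpOn_algOp hv hA h ha).on b (hA' hb)]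
      exact vec_mem_gen hb _
  exact h1 hx

theorem algOp_mul (hv : IsDilation X κ vec) (hA : A ⊆ X.Paths) (h : CommutesOn κ A 𝔄)
    (ha : a ∈ 𝔄) (ha' : a' ∈ 𝔄) : algOp vec A (a * a') = algOp vec A a * algOp vec A a' := by
  refine (isOpOn_algOp hv hA h (mul_mem ha ha')).unique ⟨fun b hb ζ => ?_, fun x hx => ?_⟩
  · rw [mul_apply_eq_comp, (isOpOn_algOp hv hA h ha').on b hb,
      (isOpOn_algOp hv hA h ha).on b hb]
    rfl
  · rw [mul_apply_eq_comp, (isOpOn_algOp hv hA h ha').off x hx, map_zero]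

theorem algOp_add (hv : IsDilation X κ vec) (hA : A ⊆ X.Paths) (h : CommutesOn κ A 𝔄)
    (ha : a ∈ 𝔄) (ha' : a' ∈ 𝔄) : algOp vec A (a + a') = algOp vec A a + algOp vec A a' := by
  refine (isOpOn_algOp hv hA h (add_mem ha ha')).unique ⟨fun b hb ζ => ?_, fun x hx => ?_⟩
  · simp [(isOpOn_algOp hv hA h ha').on b hb, (isOpOn_algOp hv hA h ha).on b hb]
  · simp [(isOpOn_algOp hv hA h ha').off x hx, (isOpOn_algOp hv hA h ha).off x hx]

theorem algOp_smul (hv : IsDilation X κ vec) (hA : A ⊆ X.Paths) (h : CommutesOn κ A 𝔄)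
    (ha : a ∈ 𝔄) (c : ℂ) : algOp vec A (c • a) = c • algOp vec A a := by
  refine (isOpOn_algOp hv hA h (𝔄.smul_mem ha c)).unique ⟨fun b hb ζ => ?_, fun x hx => ?_⟩
  · simp [(isOpOn_algOp hv hA h ha).on b hb]
  · simp [(isOpOn_algOp hv hA h ha).off x hx]

/-- On generators this is the commutation of `a` with the kernel; on the complement the adjoint
vanishes because `algOp vec A a` preserves the closed span. -/
theorem algOp_star (hv : IsDilation X κ vec) (hA : A ⊆ X.Paths) (h : CommutesOn κ A 𝔄)
    (ha : a ∈ 𝔄) : algOp vec A (star a) = star (algOp vec A a) := by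
  have h1 := isOpOn_algOp hv hA h ha
  have h2 := isOpOn_algOp hv hA h (star_mem ha)
  have hoff : ∀ x ∈ (gen vec A)ᗮ, star (algOp vec A a) x = 0 := by
    intro x hx
    refine ext_inner_left ℂ fun y => ?_
    rw [ContinuousLinearMap.star_eq_adjoint, ContinuousLinearMap.adjoint_inner_right,
      inner_zero_right]
    obtain ⟨u, hu, w, hw, rfl⟩ := (gen vec A).exists_add_mem_mem_orthogonal y
    rw [map_add, h1.off w hw, add_zero]
    exact (Submodule.mem_orthogonal _ _).1 hx _ (algOp_mem hv hA h ha subset_rfl hu)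
  refine h2.unique ⟨fun b hb ζ => ?_, hoff⟩
  refine ext_inner_left ℂ fun y => ?_
  rw [ContinuousLinearMap.star_eq_adjoint, ContinuousLinearMap.adjoint_inner_right]
  obtain ⟨u, hu, w, hw, rfl⟩ := (gen vec A).exists_add_mem_mem_orthogonal y
  rw [map_add, h1.off w hw, add_zero, inner_add_left,
    Submodule.inner_left_of_mem_orthogonal (vec_mem_gen hb _) hw, add_zero]
  have := gen_eqOn A (P := innerSL ℂ (vec b ζ) ∘L algOp vec A a)
    (Q := innerSL ℂ (vec b (star a ζ))) (fun b' hb' ζ' => by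
      rw [ContinuousLinearMap.comp_apply, h1.on b' hb', innerSL_apply_apply, innerSL_apply_apply,
        hv.inner _ (hA hb) _ (hA hb'), hv.inner _ (hA hb) _ (hA hb'),
        ContinuousLinearMap.star_eq_adjoint, ContinuousLinearMap.adjoint_inner_left]
      exact (congrArg (fun C : K →L[ℂ] K => ⟪ζ, C ζ'⟫_ℂ) (h a ha b hb b' hb').eq).symm) hu
  rw [ContinuousLinearMap.comp_apply, innerSL_apply_apply, innerSL_apply_apply] at this
  rw [← inner_conj_symm, this, inner_conj_symm]

/-- The representation `a ↦ algOp vec A a` of an algebra that commutes with the kernel on `A`. -/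
def algHom (hv : IsDilation X κ vec) (hA : A ⊆ X.Paths) (h : CommutesOn κ A 𝔄) :
    𝔄 →⋆ₙₐ[ℂ] (H →L[ℂ] H) where
  toFun a := algOp vec A a
  map_smul' c a := algOp_smul hv hA h a.2 c
  map_zero' := by
    have := algOp_smul hv hA h (zero_mem 𝔄) 0
    rwa [zero_smul, zero_smul] at this
  map_add' a a' := algOp_add hv hA h a.2 a'.2
  map_mul' a a' := algOp_mul hv hA h a.2 a'.2
  map_star' a := algOp_star hv hA h a.2

theorem algOp_one (hv : IsDilation X κ vec) (hA : A ⊆ X.Paths) (h : CommutesOn κ A 𝔄) :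
    algOp vec A 1 = (gen vec A).starProjection := by
  refine (isOpOn_algOp hv hA h (one_mem 𝔄)).unique ⟨fun b hb ζ => ?_, fun x hx => ?_⟩
  · exact Submodule.starProjection_eq_self_iff.2 (vec_mem_gen hb _)
  · exact (Submodule.starProjection_apply_eq_zero_iff _).2 hx

end AlgOp

end Operators

/-! ### The canonical realization -/

section Canonical

variable {S : Type uS} {T : Type uT} {K : Type uK} [Semigroup S] [Preorder T] [CausalAction S T]
  [NormedAddCommGroup K] [InnerProductSpace ℂ K] [CompleteSpace K]
  {X : Setting.{uS, uT, uE, uK} S T K}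
  {κ : (Cls T → Set X.Ω) → (Cls T → Set X.Ω) → K →L[ℂ] K}
  {H : Type uH} [NormedAddCommGroup H] [InnerProductSpace ℂ H] [CompleteSpace H]
  {vec : (Cls T → Set X.Ω) → K →L[ℂ] H}

open Classical in
/-- The projection `π_k(B)`: it maps `vec b ζ` to `vec (bB) ζ` if `b` is in the past of `k`, and
vanishes on the orthogonal complement of these vectors. -/
def evOp (vec : (Cls T → Set X.Ω) → K →L[ℂ] H) (k : Finset T) (B : Set X.Ω) : H →L[ℂ] H :=
  if B = ∅ then 0 else opOn vec (X.Past (k : Set T)) fun b ζ => vec (b ⊓ X.coord B) ζ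

theorem evOp_empty (k : Finset T) : evOp vec k ∅ = 0 := if_pos rfl

/-- For a nonempty box the path is recovered by `coord_box` and `exists_mulOp` applies. An empty box
does not determine its path; there the value `0` is consistent, since `b ⊓ β` has an empty factor
and `vec (b ⊓ β) ζ = 0` by `kernel_eq_zero`. -/
theorem evOp_box_spec (hκ : X.IsWideSense κ) (hv : IsDilation X κ vec) {k : Finset T}
    (hk : Nonanticipatory (k : Set T)) {β : Cls T → Set X.Ω} (hβ : β ∈ X.PathsOn k) :
    IsStarProjection (evOp vec k (X.box β (k : Set T))) ∧
      IsOpOn vec (X.Past (k : Set T)) (fun b ζ => vec (b ⊓ β) ζ)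
        (evOp vec k (X.box β (k : Set T))) := by
  have hβ' := X.pathsOn_subset_past hk hβ
  by_cases h0 : X.box β (k : Set T) = ∅
  · rw [h0, evOp_empty]
    refine ⟨IsStarProjection.zero _, fun b hb ζ => ?_, fun _ _ => rfl⟩
    obtain ⟨c, hc, hβc⟩ := X.exists_empty_of_box_empty hβ'.1 h0
    have hb' := X.past_inter hb hβ'
    have h1 := kernel_eq_zero hκ hk hb' hc (by simp [hβc]) ζ
    rw [← hv.inner _ hb'.1 _ hb'.1, inner_self_eq_zero] at h1
    rw [h1]; rfl
  · obtain ⟨P, hP, hon⟩ := exists_mulOp hv (fun b hb => hb.1) (fun b hb => X.past_inter hb hβ')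
      (fun b hb b' hb' => kernel_inf_past hκ hk hβ hb hb')
    have h1 : evOp vec k (X.box β (k : Set T)) = P := by
      rw [evOp, if_neg h0, X.coord_box hβ'.1 (fun c hc => (hβ c).2 hc)
        (Set.nonempty_iff_ne_empty.2 h0)]
      exact hon.eq
    rw [h1]
    exact ⟨hP, hon⟩

/-- Reduces statements on events to statements on paths. The first alternative is indispensable only
for `k = ∅`, where no path has an empty box. -/
theorem events_cases {k : Finset T} (hk : Nonanticipatory (k : Set T)) {B : Set X.Ω}
    (hB : B ∈ X.𝓑 k) : B = ∅ ∨ ∃ β ∈ X.PathsOn k, X.box β (k : Set T) = B := by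
  by_cases h0 : k = ∅
  · subst h0
    rcases X.events_empty hB with h | h
    · exact Or.inl h
    · exact Or.inr (X.exists_box_eq ∅ hk B hB fun _ => h)
  · exact Or.inr (X.exists_box_eq k hk B hB fun h => absurd h h0)

theorem evOp_univ (hκ : X.IsWideSense κ) (hv : IsDilation X κ vec) {k : Finset T}
    (hk : Nonanticipatory (k : Set T)) :
    evOp vec k Set.univ = (gen vec (X.Past (k : Set T))).starProjection := by
  have h := (evOp_box_spec hκ hv hk (X.unit_mem_pathsOn k)).2
  rw [X.box_unit] at h
  refine h.unique ⟨fun b hb ζ => ?_, fun x hx => ?_⟩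
  · rw [show b ⊓ X.unit = b from inf_top_eq b]
    exact Submodule.starProjection_eq_self_iff.2 (vec_mem_gen hb _)
  · exact (Submodule.starProjection_apply_eq_zero_iff _).2 hx

theorem evOp_isStarProjection (hκ : X.IsWideSense κ) (hv : IsDilation X κ vec) {k : Finset T}
    (hk : Nonanticipatory (k : Set T)) {B : Set X.Ω} (hB : B ∈ X.𝓑 k) :
    IsStarProjection (evOp vec k B) := by
  rcases events_cases hk hB with rfl | ⟨β, hβ, rfl⟩
  · rw [evOp_empty]; exact IsStarProjection.zero _
  · exact (evOp_box_spec hκ hv hk hβ).1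

theorem evOp_off (hκ : X.IsWideSense κ) (hv : IsDilation X κ vec) {k : Finset T}
    (hk : Nonanticipatory (k : Set T)) {B : Set X.Ω} (hB : B ∈ X.𝓑 k) {x : H}
    (hx : x ∈ (gen vec (X.Past (k : Set T)))ᗮ) : evOp vec k B x = 0 := by
  rcases events_cases hk hB with rfl | ⟨β, hβ, rfl⟩
  · rw [evOp_empty]; rfl
  · exact (evOp_box_spec hκ hv hk hβ).2.off x hx

/-- The operators `π_k(B)` preserve the subspaces generated by sets of paths in the past of `k`
that are closed under multiplication by paths on `k`. -/
theorem evOp_mem_gen (hκ : X.IsWideSense κ) (hv : IsDilation X κ vec) {k : Finset T}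
    (hk : Nonanticipatory (k : Set T)) {B : Set X.Ω} (hB : B ∈ X.𝓑 k)
    {A : Set (Cls T → Set X.Ω)} (hA : A ⊆ X.Past (k : Set T))
    (hA' : ∀ b ∈ A, ∀ β ∈ X.PathsOn k, b ⊓ β ∈ A) {x : H} (hx : x ∈ gen vec A) :
    evOp vec k B x ∈ gen vec A := by
  rcases events_cases hk hB with rfl | ⟨β, hβ, rfl⟩
  · rw [evOp_empty]; exact zero_mem _
  · have h1 : gen vec A ≤ (gen vec A).comap (evOp vec k (X.box β (k : Set T))).toLinearMap :=
      gen_le ((isClosed_gen A).preimage (evOp vec k (X.box β (k : Set T))).continuous)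
        fun b hb ζ => by
          rw [Submodule.mem_comap, ContinuousLinearMap.coe_coe,
            (evOp_box_spec hκ hv hk hβ).2.on b (hA hb)]
          exact vec_mem_gen (hA' b hb β hβ) _
    exact h1 hx

theorem evOp_mem_gen_below (hκ : X.IsWideSense κ) (hv : IsDilation X κ vec) {k : Finset T}
    {j : Set T} (hj : Nonanticipatory j) (hkj : (k : Set T) ⊆ j) {B : Set X.Ω} (hB : B ∈ X.𝓑 k)
    {x : H} (hx : x ∈ gen vec (X.PathsBelow j)) : evOp vec k B x ∈ gen vec (X.PathsBelow j) :=
  evOp_mem_gen hκ hv (hj.mono hkj) hB (X.pathsBelow_subset_past hj hkj)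
    (fun _ hb _ hβ => X.pathsBelow_inter hb
      (X.pathsOn_subset_pathsBelow (CausalLE.of_subset hkj) hβ)) hx

/-- The embedding `ζ ↦ vec e ζ`. -/
def embK (hκ : X.IsWideSense κ) (hv : IsDilation X κ vec) : K →ₗᵢ[ℂ] H :=
  ⟨(vec X.unit).toLinearMap, fun ζ => by
    have h := hv.inner _ X.unit_mem_paths _ X.unit_mem_paths ζ ζ
    rw [hκ.normalization, one_apply_eq_self, inner_self_eq_norm_sq_to_K,
      inner_self_eq_norm_sq_to_K] at h
    have h2 : ‖vec X.unit ζ‖ ^ 2 = ‖ζ‖ ^ 2 := by exact_mod_cast h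
    exact (pow_left_inj₀ (norm_nonneg _) (norm_nonneg _) two_ne_zero).1 h2⟩

theorem embK_apply (hκ : X.IsWideSense κ) (hv : IsDilation X κ vec) (ζ : K) :
    embK hκ hv ζ = vec X.unit ζ := rfl

theorem emb_embK (hκ : X.IsWideSense κ) (hv : IsDilation X κ vec) :
    emb (embK hκ hv) = vec X.unit := rfl

theorem commutesOn_below (hκ : X.IsWideSense κ) {k : Finset T}
    (hk : Nonanticipatory (k : Set T)) : CommutesOn κ (X.PathsBelow (k : Set T)) (X.𝔄 k) :=
  fun _ ha _ hb _ hb' => commute_kernel hκ hk ha hb hb'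

theorem commutesOn_slice (hκ : X.IsWideSense κ) (l : Slice T) :
    CommutesOn κ (X.PathsBelow l.1) (X.sliceAlg l) :=
  fun _ ha _ hb _ hb' => commute_kernel_slice hκ ha hb hb'

open Classical in
/-- The representations `ι_k`. -/
def iotaRep (hκ : X.IsWideSense κ) (hv : IsDilation X κ vec) (k : Finset T) :
    X.𝔄 k →⋆ₙₐ[ℂ] (H →L[ℂ] H) :=
  if hk : Nonanticipatory (k : Set T) then
    algHom hv (X.pathsBelow_subset_paths (k : Set T)) (commutesOn_below hκ hk) else 0

theorem iotaRep_apply (hκ : X.IsWideSense κ) (hv : IsDilation X κ vec) {k : Finset T}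
    (hk : Nonanticipatory (k : Set T)) (a : X.𝔄 k) :
    iotaRep hκ hv k a = algOp vec (X.PathsBelow (k : Set T)) a := by
  rw [iotaRep, dif_pos hk]; rfl

theorem iotaRep_one (hκ : X.IsWideSense κ) (hv : IsDilation X κ vec) {k : Finset T}
    (hk : Nonanticipatory (k : Set T)) :
    iotaRep hκ hv k 1 = (gen vec (X.PathsBelow (k : Set T))).starProjection := by
  rw [iotaRep_apply hκ hv hk]
  exact algOp_one hv (X.pathsBelow_subset_paths _) (commutesOn_below hκ hk)

theorem nonanticipatory_empty : Nonanticipatory ((∅ : Finset T) : Set T) := by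
  simp [Nonanticipatory]

theorem isOpOn_iotaRep (hκ : X.IsWideSense κ) (hv : IsDilation X κ vec) {k : Finset T}
    (hk : Nonanticipatory (k : Set T)) (a : X.𝔄 k) :
    IsOpOn vec (X.PathsBelow (k : Set T)) (fun b ζ => vec b ((a : K →L[ℂ] K) ζ))
      (iotaRep hκ hv k a) := by
  rw [iotaRep_apply hκ hv hk]
  exact isOpOn_algOp hv (X.pathsBelow_subset_paths _) (commutesOn_below hκ hk) a.2

theorem adjoint_emb_off (hκ : X.IsWideSense κ) (hv : IsDilation X κ vec) {j : Set T} {x : H}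
    (hx : x ∈ (gen vec (X.PathsBelow j))ᗮ) :
    ContinuousLinearMap.adjoint (emb (embK hκ hv)) x = 0 := by
  refine ext_inner_left ℂ fun ζ => ?_
  rw [ContinuousLinearMap.adjoint_inner_right, inner_zero_right]
  exact (Submodule.mem_orthogonal _ _).1 hx _ (vec_mem_gen (X.unit_mem_pathsBelow j) ζ)

theorem adjoint_emb_vec (hκ : X.IsWideSense κ) (hv : IsDilation X κ vec) {b : Cls T → Set X.Ω}
    (hb : b ∈ X.Paths) (ζ : K) :
    ContinuousLinearMap.adjoint (emb (embK hκ hv)) (vec b ζ) = κ X.unit b ζ := by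
  refine ext_inner_left ℂ fun z => ?_
  rw [ContinuousLinearMap.adjoint_inner_right, emb_embK, hv.inner _ X.unit_mem_paths _ hb]

theorem isRepSystem (hκ : X.IsWideSense κ) (hv : IsDilation X κ vec) :
    IsRepSystem X (embK hκ hv) (iotaRep hκ hv) where
  faithful k hk a a' h := by
    refine Subtype.ext (ContinuousLinearMap.ext fun ζ => ?_)
    have h1 := congrArg (fun P : H →L[ℂ] H => P (vec X.unit ζ)) h
    simp only [(isOpOn_iotaRep hκ hv hk a).on _ (X.unit_mem_pathsBelow _),
      (isOpOn_iotaRep hκ hv hk a').on _ (X.unit_mem_pathsBelow _)] at h1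
    exact (embK hκ hv).injective h1
  consistent k k' hk hk' hkk a h h' := by
    refine (isOpOn_iotaRep hκ hv hk _).unique ⟨fun b hb ζ => ?_, fun x hx => ?_⟩
    · rw [mul_apply_eq_comp, (isOpOn_iotaRep hκ hv hk 1).on b hb,
        (isOpOn_iotaRep hκ hv hk' _).on b (X.pathsBelow_mono hkk hb)]
      rfl
    · rw [mul_apply_eq_comp, (isOpOn_iotaRep hκ hv hk 1).off x hx, map_zero]
  identity a := by
    refine (isOpOn_iotaRep hκ hv nonanticipatory_empty a).unique ⟨fun b hb ζ => ?_, fun x hx => ?_⟩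
    · rw [Finset.coe_empty] at hb
      rw [X.eq_unit_of_mem_pathsBelow_empty hb, ContinuousLinearMap.comp_apply,
        ContinuousLinearMap.comp_apply, adjoint_emb_vec hκ hv X.unit_mem_paths,
        hκ.normalization]
      rfl
    · rw [ContinuousLinearMap.comp_apply, ContinuousLinearMap.comp_apply,
        adjoint_emb_off hκ hv hx, map_zero, map_zero]

theorem evOp_mul_univ (hκ : X.IsWideSense κ) (hv : IsDilation X κ vec) {k : Finset T}
    (hk : Nonanticipatory (k : Set T)) {B : Set X.Ω} (hB : B ∈ X.𝓑 k) :
    evOp vec k B * evOp vec k Set.univ = evOp vec k B := by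
  rw [evOp_univ hκ hv hk]
  ext x
  obtain ⟨u, hu, w, hw, rfl⟩ := (gen vec (X.Past (k : Set T))).exists_add_mem_mem_orthogonal x
  rw [mul_apply_eq_comp, map_add, map_add, map_add, Submodule.starProjection_eq_self_iff.2 hu,
    (Submodule.starProjection_apply_eq_zero_iff _).2 hw, map_zero, evOp_off hκ hv hk hB hw]

/-- Equivalent sets meet the same classes and therefore have the same past; on it both sides send
`vec b ζ` to `vec (b ⊓ β ⊓ β') ζ`. -/
theorem evOp_inter_of_equiv (hκ : X.IsWideSense κ) (hv : IsDilation X κ vec) {k k' : Finset T}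
    (hk : Nonanticipatory (k : Set T)) (hk' : Nonanticipatory (k' : Set T))
    (h : CausalEquiv (k : Set T) k') {B B' : Set X.Ω} (hB : B ∈ X.𝓑 k) (hB' : B' ∈ X.𝓑 k') :
    evOp vec (union k k') (B ∩ B') = evOp vec k B * evOp vec k' B' := by
  rcases events_cases hk hB with rfl | ⟨β, hβ, rfl⟩
  · rw [Set.empty_inter, evOp_empty, evOp_empty, zero_mul]
  rcases events_cases hk' hB' with rfl | ⟨β', hβ', rfl⟩
  · rw [Set.inter_empty, evOp_empty, evOp_empty, mul_zero]
  have hc : clsOf (k : Set T) = clsOf (k' : Set T) :=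
    (hk.cls_eq_of_causalEquiv h).antisymm (hk'.cls_eq_of_causalEquiv h.symm)
  have hcu : clsOf (union k k' : Set T) = clsOf (k : Set T) := by
    rw [clsOf_union, ← hc, Set.union_self]
  have hu : Nonanticipatory (union k k' : Set T) := by
    intro t ht u hu hlt
    have h1 : cls t ∈ clsOf (k : Set T) := hcu ▸ ⟨t, ht, rfl⟩
    have h2 : cls u ∈ clsOf (k : Set T) := hcu ▸ ⟨u, hu, rfl⟩
    obtain ⟨t', ht', h1⟩ := h1
    obtain ⟨u', hu', h2⟩ := h2
    rw [← cls_lt_cls, ← h1, ← h2, cls_lt_cls] at hlt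
    exact hk _ ht' _ hu' hlt
  have hβu : β ⊓ β' ∈ X.PathsOn (union k k') := X.pathsOn_inter
    (X.pathsOn_mono (fun t ht => mem_union.2 (Or.inl ht)) hβ)
    (X.pathsOn_mono (fun t ht => mem_union.2 (Or.inr ht)) hβ')
  have hbox : X.box β (k : Set T) ∩ X.box β' (k' : Set T) =
      X.box (β ⊓ β') (union k k' : Set T) := by
    rw [X.box_inter]
    unfold Setting.box
    rw [hcu, ← hc]
  rw [hbox]
  have hp := X.past_eq_of_clsOf hcu
  have hp' := X.past_eq_of_clsOf hc
  refine (evOp_box_spec hκ hv hu hβu).2.unique ⟨fun b hb ζ => ?_, fun x hx => ?_⟩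
  · rw [hp] at hb
    rw [mul_apply_eq_comp, (evOp_box_spec hκ hv hk' hβ').2.on b (hp' ▸ hb),
      (evOp_box_spec hκ hv hk hβ).2.on _ (X.past_inter hb
        (hp'.symm ▸ X.pathsOn_subset_past hk' hβ')), inf_assoc, inf_comm β']
  · rw [hp, hp'] at hx
    rw [mul_apply_eq_comp, (evOp_box_spec hκ hv hk' hβ').2.off x hx, map_zero]

theorem nonanticipatory_union_of_indep {k k' : Finset T}
    (hk : Nonanticipatory (k : Set T)) (hk' : Nonanticipatory (k' : Set T))
    (h : CausalIndep (k : Set T) k') : Nonanticipatory (union k k' : Set T) := by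
  intro t ht u hu hlt
  rcases mem_union.1 ht with ht | ht <;> rcases mem_union.1 hu with hu | hu
  · exact hk t ht u hu hlt
  · exact (h t ht u hu).1 hlt.le
  · exact (h u hu t ht).2 hlt.le
  · exact hk' t ht u hu hlt

/-- The two sides agree on the past of the union, which may be smaller than the pasts of `k` and
`k'`; this is why the factor `P_{k ∪ k'}` appears. -/
theorem evOp_inter_of_indep (hκ : X.IsWideSense κ) (hv : IsDilation X κ vec) {k k' : Finset T}
    (hk : Nonanticipatory (k : Set T)) (hk' : Nonanticipatory (k' : Set T))
    (h : CausalIndep (k : Set T) k') {B B' : Set X.Ω} (hB : B ∈ X.𝓑 k) (hB' : B' ∈ X.𝓑 k') :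
    evOp vec (union k k') (B ∩ B') =
      evOp vec k B * evOp vec k' B' * evOp vec (union k k') Set.univ := by
  rcases events_cases hk hB with rfl | ⟨β, hβ, rfl⟩
  · rw [Set.empty_inter, evOp_empty, evOp_empty, zero_mul, zero_mul]
  rcases events_cases hk' hB' with rfl | ⟨β', hβ', rfl⟩
  · rw [Set.inter_empty, evOp_empty, evOp_empty, mul_zero, zero_mul]
  have hu := nonanticipatory_union_of_indep hk hk' h
  have hβ1 := X.pathsOn_mono (fun t ht => mem_union.2 (Or.inl ht)) hβ (Λ' := union k k')
  have hβ2 := X.pathsOn_mono (fun t ht => mem_union.2 (Or.inr ht)) hβ' (Λ' := union k k')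
  have hbox : X.box β (k : Set T) ∩ X.box β' (k' : Set T) =
      X.box (β ⊓ β') (union k k' : Set T) := by
    rw [X.box_inter, X.box_eq_of_subset (b := β) (k := (k : Set T)) (j := (union k k' : Set T)),
      X.box_eq_of_subset (b := β') (k := (k' : Set T)) (j := (union k k' : Set T))]
    · rw [clsOf_union]; exact Set.subset_union_right
    · exact fun c _ hc => (hβ' c).2 hc
    · rw [clsOf_union]; exact Set.subset_union_left
    · exact fun c _ hc => (hβ c).2 hc
  have hsub : X.Past (union k k' : Set T) ⊆ X.Past (k : Set T) :=
    X.past_anti fun t ht => mem_union.2 (Or.inl ht)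
  have hsub' : X.Past (union k k' : Set T) ⊆ X.Past (k' : Set T) :=
    X.past_anti fun t ht => mem_union.2 (Or.inr ht)
  rw [hbox, evOp_univ hκ hv hu]
  refine (evOp_box_spec hκ hv hu (X.pathsOn_inter hβ1 hβ2)).2.unique
    ⟨fun b hb ζ => ?_, fun x hx => ?_⟩
  · rw [mul_apply_eq_comp, mul_apply_eq_comp,
      Submodule.starProjection_eq_self_iff.2 (vec_mem_gen hb _),
      (evOp_box_spec hκ hv hk' hβ').2.on b (hsub' hb), (evOp_box_spec hκ hv hk hβ).2.on _
        (hsub (X.past_inter hb (X.pathsOn_subset_past hu hβ2))), inf_assoc, inf_comm β']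
  · rw [mul_apply_eq_comp, (Submodule.starProjection_apply_eq_zero_iff _).2 hx, map_zero]

theorem evOp_inter (hκ : X.IsWideSense κ) (hv : IsDilation X κ vec) {k : Finset T}
    (hk : Nonanticipatory (k : Set T)) {B B' : Set X.Ω} (hB : B ∈ X.𝓑 k) (hB' : B' ∈ X.𝓑 k) :
    evOp vec k (B ∩ B') = evOp vec k B * evOp vec k B' := by
  have h := evOp_inter_of_equiv hκ hv hk hk
    ⟨CausalLE.of_subset subset_rfl, CausalLE.of_subset subset_rfl⟩ hB hB'
  have : union k k = k := by ext t; rw [mem_union, or_self]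
  rwa [this] at h

theorem evOp_sigma_additive (hκ : X.IsWideSense κ) (hv : IsDilation X κ vec) {k : Finset T}
    (hk : Nonanticipatory (k : Set T)) {f : ℕ → Set X.Ω} (hf : ∀ m, f m ∈ X.𝓑 k)
    (hd : Pairwise fun m m' => Disjoint (f m) (f m')) (hun : (⋃ m, f m) = Set.univ) (x : H) :
    HasSum (fun m => evOp vec k (f m) x) (evOp vec k Set.univ x) := by
  classical
  -- Over `∅` the only events are `∅` and the whole space, so a partition has one nonempty member.
  by_cases h0 : k = ∅
  · subst h0
    obtain ⟨y⟩ := X.nonempty_space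
    have hy : y ∈ ⋃ m, f m := hun ▸ Set.mem_univ y
    obtain ⟨m, hm⟩ := Set.mem_iUnion.1 hy
    have hfm : f m = Set.univ := (X.events_empty (hf m)).resolve_left fun h => by
      rw [h] at hm; exact hm
    rw [← hfm]
    refine hasSum_single m fun m' hm' => ?_
    have : f m' = ∅ := by
      have : Disjoint (f m') (f m) := hd hm'
      rw [hfm] at this
      exact Set.disjoint_univ.1 this
    rw [this, evOp_empty]; rfl
  have hbox : ∀ m, ∃ β ∈ X.PathsOn k, X.box β (k : Set T) = f m := fun m =>
    X.exists_box_eq k hk _ (hf m) fun h => absurd h h0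
  choose β hβ hβf using hbox
  refine hasSum_of_projections (s := {x : H | ∃ b ∈ X.Past (k : Set T), ∃ ζ, x = vec b ζ})
    (fun m => evOp_isStarProjection hκ hv hk (hf m))
    (evOp_isStarProjection hκ hv hk (X.univ_mem_events k hk)) (fun m m' hmm => ?_)
    (fun m => evOp_mul_univ hκ hv hk (hf m)) (fun x => ?_) ?_ x
  · change evOp vec k (f m) * evOp vec k (f m') = 0
    have hdj : Disjoint (f m) (f m') := hd hmm
    rw [← evOp_inter hκ hv hk (hf m) (hf m'), hdj.inter_eq, evOp_empty]
  · rw [evOp_univ hκ hv hk]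
    exact Submodule.starProjection_apply_mem _ _
  rintro _ ⟨b, hb, ζ, rfl⟩
  obtain ⟨l, hl, hbl, -⟩ := X.exists_slice_of_past hk hb hb
  obtain ⟨Λ, hΛ, hbΛ⟩ := X.mem_pathsBelow_iff.1 hbl
  have hbu : b ∈ X.PathsOn (Λ ∪ k) := X.pathsOn_mono Finset.subset_union_left hbΛ
  have hβu : ∀ m, b ⊓ β m ∈ X.PathsOn (Λ ∪ k) := fun m =>
    X.pathsOn_inter hbu (X.pathsOn_mono Finset.subset_union_right (hβ m))
  have hle : CausalLE ((Λ ∪ k : Finset T) : Set T) l.1 := by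
    intro t ht
    rcases Finset.mem_union.1 ht with ht | ht
    · exact hΛ t ht
    · exact ⟨t, hl ht, le_rfl⟩
  have hboxl : ∀ m, X.box (b ⊓ β m) l.1 = X.box b l.1 ∩ f m := by
    intro m
    rw [X.box_inter, ← hβf m,
      X.box_eq_of_subset (Set.image_mono hl) fun c _ hc => (hβ m c).2 hc]
  -- The slice `l` contains `k` and dominates `b`, so multiplication by `β m` changes `b` on `[l]`
  -- only and cuts its box on `l` by `f m`: the situation of 3⁰.
  have h1 := hκ.sigma_additivity l (Λ ∪ k) hle b hbu (fun m => b ⊓ β m) hβu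
    (fun m c hc => by
      rw [Pi.inf_apply, (hβ m c).2 fun h => hc (Set.image_mono hl h)]
      exact inf_top_eq _)
    (fun m m' hmm => by
      change Disjoint (X.box (b ⊓ β m) l.1) (X.box (b ⊓ β m') l.1)
      rw [hboxl, hboxl]
      exact (hd hmm).mono Set.inter_subset_right Set.inter_subset_right)
    (by simp_rw [hboxl]; rw [← Set.inter_iUnion, hun, Set.inter_univ]) ζ
  have h2 := Complex.hasSum_re h1
  have h3 : ∀ b ∈ X.Paths, (⟪ζ, κ b b ζ⟫_ℂ).re = ‖vec b ζ‖ ^ 2 := by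
    intro b hb
    rw [← hv.inner b hb b hb, ← inner_self_eq_norm_sq (𝕜 := ℂ)]
    rfl
  rw [h3 b hb.1] at h2
  have h4 : evOp vec k Set.univ (vec b ζ) = vec b ζ := by
    rw [evOp_univ hκ hv hk]
    exact Submodule.starProjection_eq_self_iff.2 (vec_mem_gen hb _)
  rw [h4]
  refine h2.congr_fun fun m => ?_
  rw [h3 _ (X.pathsOn_subset_paths _ (hβu m)), ← hβf m, (evOp_box_spec hκ hv hk (hβ m)).2.on b hb]

/-- `π_k(B)` commutes with `vec b ζ ↦ vec b (a ζ)` on the paths below `j ⊇ k`. -/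
theorem evOp_commute_algOp (hκ : X.IsWideSense κ) (hv : IsDilation X κ vec) {k : Finset T}
    {j : Set T} (hj : Nonanticipatory j) (hkj : (k : Set T) ⊆ j) {B : Set X.Ω} (hB : B ∈ X.𝓑 k)
    {𝔄 : StarSubalgebra ℂ (K →L[ℂ] K)} (h : CommutesOn κ (X.PathsBelow j) 𝔄) {a : K →L[ℂ] K}
    (ha : a ∈ 𝔄) : Commute (evOp vec k B) (algOp vec (X.PathsBelow j) a) := by
  have hk : Nonanticipatory (k : Set T) := hj.mono hkj
  have ho := isOpOn_algOp hv (X.pathsBelow_subset_paths j) h ha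
  refine gen_clm_ext (vec := vec) (X.PathsBelow j) (fun b hb ζ => ?_) fun x hx => ?_
  · rw [mul_apply_eq_comp, mul_apply_eq_comp, ho.on b hb]
    rcases events_cases hk hB with rfl | ⟨β, hβ, rfl⟩
    · simp [evOp_empty]
    · have hbp := X.pathsBelow_subset_past hj hkj hb
      rw [(evOp_box_spec hκ hv hk hβ).2.on b hbp, (evOp_box_spec hκ hv hk hβ).2.on b hbp,
        ho.on _ (X.pathsBelow_inter hb
          (X.pathsOn_subset_pathsBelow (CausalLE.of_subset hkj) hβ))]
  · rw [mul_apply_eq_comp, mul_apply_eq_comp, ho.off x hx, map_zero]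
    refine (ho.off _ (mem_orthogonal_of_map (fun y hy => ?_) hx)).symm
    rw [← ContinuousLinearMap.star_eq_adjoint,
      (evOp_isStarProjection hκ hv hk hB).isSelfAdjoint.star_eq]
    exact evOp_mem_gen_below hκ hv hj hkj hB hy

theorem isHSystem (hκ : X.IsWideSense κ) (hv : IsDilation X κ vec) :
    IsHSystem X (iotaRep hκ hv) (evOp vec) where
  projection k hk B hB := evOp_isStarProjection hκ hv hk hB
  normalized k hk := by
    rw [evOp_univ hκ hv hk, iotaRep_one hκ hv hk]
    ext x
    rw [mul_apply_eq_comp]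
    exact Submodule.starProjection_eq_self_iff.2
      (gen_mono (X.pathsBelow_subset_past hk subset_rfl) (Submodule.starProjection_apply_mem _ _))
  unit_empty := by
    rw [evOp_univ hκ hv nonanticipatory_empty]
    have : X.Past ((∅ : Finset T) : Set T) = X.Paths := by
      ext b; exact ⟨fun h => h.1, fun h => ⟨h, fun c _ t ht => by simp at ht⟩⟩
    ext x
    rw [one_apply_eq_self]
    refine Submodule.starProjection_eq_self_iff.2 ?_
    rw [this, hv.gen_paths]
    trivial
  equiv k k' hk hk' h B hB B' hB' := evOp_inter_of_equiv hκ hv hk hk' h hB hB'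
  indep k k' hk hk' h B hB B' hB' := evOp_inter_of_indep hκ hv hk hk' h hB hB'
  sigma_additive k hk f hf hd hun x := evOp_sigma_additive hκ hv hk hf hd hun x
  commute k hk B hB a := by
    rw [iotaRep_apply hκ hv hk]
    exact evOp_commute_algOp hκ hv hk subset_rfl hB (commutesOn_below hκ hk) a.2

end Canonical

/-! ### Feynman integrals and canonicity -/

section Realization

variable {S : Type uS} {T : Type uT} {K : Type uK} [Semigroup S] [Preorder T] [CausalAction S T]
  [NormedAddCommGroup K] [InnerProductSpace ℂ K] [CompleteSpace K]
  {X : Setting.{uS, uT, uE, uK} S T K}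
  {κ : (Cls T → Set X.Ω) → (Cls T → Set X.Ω) → K →L[ℂ] K}
  {H : Type uH} [NormedAddCommGroup H] [InnerProductSpace ℂ H] [CompleteSpace H]
  {vec : (Cls T → Set X.Ω) → K →L[ℂ] H}

theorem layers_empty : layers (∅ : Finset T) = [] := by
  rw [layers, dif_pos rfl]

open Classical in
theorem layers_of_ne {Λ : Finset T} (h : Λ ≠ ∅) : layers Λ = top Λ :: layers (Λ \ top Λ) := by
  rw [layers, dif_neg h]

theorem subset_of_mem_layers (Λ : Finset T) : ∀ k ∈ layers Λ, k ⊆ Λ := by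
  classical
  induction Λ using Finset.strongInduction with
  | H Λ ih =>
    intro k hk
    by_cases h0 : Λ = ∅
    · subst h0; rw [layers_empty] at hk; simp at hk
    rw [layers_of_ne h0] at hk
    rcases List.mem_cons.1 hk with rfl | hk
    · exact top_subset Λ
    · refine (ih _ ?_ k hk).trans Finset.sdiff_subset
      exact Finset.sdiff_subset.ssubset_of_ne fun h =>
        (card_sdiff_top_lt h0).ne (congrArg Finset.card h)

theorem mem_top_of_cls_eq {Λ : Finset T} {t u : T} (ht : t ∈ top Λ) (hu : u ∈ Λ)
    (h : cls t = cls u) : u ∈ top Λ := by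
  refine mem_top.2 ⟨hu, fun v hv => ?_⟩
  rw [← cls_lt_cls, ← h, cls_lt_cls]
  exact (mem_top.1 ht).2 v hv

/-- The layers act from the bottom up. The part of `b` below `max Λ` is in the past of `max Λ`, so
the top projection multiplies it by the part on `max Λ`, and the product of the two parts is `b`. -/
theorem layers_prod_apply (hκ : X.IsWideSense κ) (hv : IsDilation X κ vec) (ζ : K)
    (Λ : Finset T) : ∀ b ∈ X.PathsOn Λ,
    ((layers Λ).map fun k => evOp vec k (X.box b (k : Set T))).prod (vec X.unit ζ) = vec b ζ := by
  classical
  induction Λ using Finset.strongInduction with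
  | H Λ ih =>
    intro b hb
    by_cases h0 : Λ = ∅
    · subst h0
      rw [layers_empty, X.pathsOn_empty hb]; simp
    have hss : Λ \ top Λ ⊂ Λ := Finset.sdiff_subset.ssubset_of_ne fun h =>
      (card_sdiff_top_lt h0).ne (congrArg Finset.card h)
    -- A class that meets `max Λ` has its whole share of `Λ` there (`mem_top_of_cls_eq`); so the
    -- layers do not split classes and the restrictions of `b` are paths on them.
    have h1 : X.restrict b (clsOf ((Λ \ top Λ : Finset T) : Set T)) ∈ X.PathsOn (Λ \ top Λ) := by
      refine X.restrict_mem_pathsOn hb ?_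
      rintro _ ⟨t, ht, rfl⟩
      ext u
      have ht := Finset.mem_sdiff.1 ht
      rw [mem_inClass, mem_inClass, Finset.mem_sdiff]
      exact ⟨fun h => ⟨h.1.1, h.2⟩, fun h =>
        ⟨⟨h.1, fun h' => ht.2 (mem_top_of_cls_eq h' ht.1 h.2)⟩, h.2⟩⟩
    have h2 : X.restrict b (clsOf (top Λ : Set T)) ∈ X.PathsOn (top Λ) := by
      refine X.restrict_mem_pathsOn hb ?_
      rintro _ ⟨t, ht, rfl⟩
      ext u
      rw [mem_inClass, mem_inClass]
      exact ⟨fun h => ⟨top_subset Λ h.1, h.2⟩, fun h => ⟨mem_top_of_cls_eq ht h.1 h.2.symm, h.2⟩⟩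
    have h3 : X.restrict b (clsOf ((Λ \ top Λ : Finset T) : Set T)) ⊓
        X.restrict b (clsOf (top Λ : Set T)) = b := by
      funext c
      rw [Pi.inf_apply]
      by_cases hc1 : c ∈ clsOf ((Λ \ top Λ : Finset T) : Set T) <;>
        by_cases hc2 : c ∈ clsOf (top Λ : Set T)
      · rw [X.restrict_of_mem b hc1, X.restrict_of_mem b hc2, inf_idem]
      · rw [X.restrict_of_mem b hc1, X.restrict_of_notMem b hc2]; exact inf_top_eq _
      · rw [X.restrict_of_notMem b hc1, X.restrict_of_mem b hc2]; exact top_inf_eq _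
      · rw [X.restrict_of_notMem b hc1, X.restrict_of_notMem b hc2, inf_idem]
        refine ((hb c).2 ?_).symm
        rintro ⟨t, ht, rfl⟩
        by_cases htt : t ∈ top Λ
        · exact hc2 ⟨t, htt, rfl⟩
        · exact hc1 ⟨t, Finset.mem_sdiff.2 ⟨ht, htt⟩, rfl⟩
    have h4 : (layers (Λ \ top Λ)).map (fun k => evOp vec k (X.box b (k : Set T))) =
        (layers (Λ \ top Λ)).map (fun k => evOp vec k
          (X.box (X.restrict b (clsOf ((Λ \ top Λ : Finset T) : Set T))) (k : Set T))) := by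
      refine List.map_congr_left fun k hk => ?_
      rw [X.box_congr (b' := X.restrict b (clsOf ((Λ \ top Λ : Finset T) : Set T)))]
      exact fun c hc => (X.restrict_of_mem b
        (Set.image_mono (Finset.coe_subset.2 (subset_of_mem_layers _ k hk)) hc)).symm
    rw [layers_of_ne h0, List.map_cons, List.prod_cons, mul_apply_eq_comp, h4, ih _ hss _ h1,
      ← X.box_congr (b := X.restrict b (clsOf (top Λ : Set T))) (b' := b)
        fun c hc => X.restrict_of_mem b hc,
      (evOp_box_spec hκ hv (top_nonanticipatory Λ) h2).2.on _ (X.past_pathsOn h1 ?_), h3]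
    exact fun u hu t ht => (mem_top.1 ht).2 u (Finset.mem_sdiff.1 hu).1

theorem iotaRep_empty_one (hκ : X.IsWideSense κ) (hv : IsDilation X κ vec) :
    iotaRep hκ hv ∅ 1 =
      emb (embK hκ hv) ∘L ContinuousLinearMap.adjoint (emb (embK hκ hv)) :=
  (isRepSystem hκ hv).identity 1

theorem feynman_eq (hκ : X.IsWideSense κ) (hv : IsDilation X κ vec) {Λ : Finset T}
    {b : Cls T → Set X.Ω} (hb : b ∈ X.PathsOn Λ) :
    feynman X (iotaRep hκ hv) (evOp vec) Λ b =
      vec b ∘L ContinuousLinearMap.adjoint (emb (embK hκ hv)) := by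
  ext x
  rw [feynman, iotaRep_empty_one, mul_apply_eq_comp, ContinuousLinearMap.comp_apply, emb_embK,
    layers_prod_apply hκ hv _ Λ b hb]
  rfl

theorem adjoint_emb_emb (hκ : X.IsWideSense κ) (hv : IsDilation X κ vec) (ζ : K) :
    ContinuousLinearMap.adjoint (emb (embK hκ hv)) (vec X.unit ζ) = ζ := by
  rw [adjoint_emb_vec hκ hv X.unit_mem_paths, hκ.normalization, one_apply_eq_self]

theorem feynman_apply (hκ : X.IsWideSense κ) (hv : IsDilation X κ vec) {Λ : Finset T}
    {b : Cls T → Set X.Ω} (hb : b ∈ X.PathsOn Λ) (ζ : K) :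
    feynman X (iotaRep hκ hv) (evOp vec) Λ b (embK hκ hv ζ) = vec b ζ := by
  rw [feynman_eq hκ hv hb, ContinuousLinearMap.comp_apply, embK_apply, adjoint_emb_emb]

theorem realizes (hκ : X.IsWideSense κ) (hv : IsDilation X κ vec) :
    Realizes X (embK hκ hv) (iotaRep hκ hv) (evOp vec) κ := by
  intro Λ b hb b' hb'
  rw [feynman_eq hκ hv hb, feynman_eq hκ hv hb']
  ext x
  refine ext_inner_left ℂ fun y => ?_
  simp only [ContinuousLinearMap.comp_apply, ContinuousLinearMap.adjoint_inner_right]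
  rw [hv.inner _ (X.pathsOn_subset_paths _ hb) _ (X.pathsOn_subset_paths _ hb'),
    ContinuousLinearMap.adjoint_inner_left]

theorem sliceSpace_eq (hκ : X.IsWideSense κ) (hv : IsDilation X κ vec) (l : Slice T) :
    sliceSpace X (embK hκ hv) (iotaRep hκ hv) (evOp vec) l = gen vec (X.PathsBelow l.1) := by
  unfold sliceSpace gen
  congr 2
  ext x
  constructor
  · rintro ⟨Λ, hΛ, b, hb, ζ, rfl⟩
    exact ⟨b, X.mem_pathsBelow_iff.2 ⟨Λ, hΛ, hb⟩, ζ, feynman_apply hκ hv hb ζ⟩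
  · rintro ⟨b, hb, ζ, rfl⟩
    obtain ⟨Λ, hΛ, hb⟩ := X.mem_pathsBelow_iff.1 hb
    exact ⟨Λ, hΛ, b, hb, ζ, (feynman_apply hκ hv hb ζ).symm⟩

theorem range_starProjection (M : Submodule ℂ H) [M.HasOrthogonalProjection] :
    LinearMap.range M.starProjection.toLinearMap = M := by
  ext x
  constructor
  · rintro ⟨y, rfl⟩
    exact Submodule.starProjection_apply_mem _ _
  · exact fun hx => ⟨x, Submodule.starProjection_eq_self_iff.2 hx⟩

theorem rangeP_eq (hκ : X.IsWideSense κ) (hv : IsDilation X κ vec) {k : Finset T}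
    (hk : Nonanticipatory (k : Set T)) :
    rangeP X (evOp vec) k = gen vec (X.Past (k : Set T)) := by
  rw [rangeP, evOp_univ hκ hv hk, range_starProjection]

theorem rangeI_eq (hκ : X.IsWideSense κ) (hv : IsDilation X κ vec) {k : Finset T}
    (hk : Nonanticipatory (k : Set T)) :
    rangeI X (iotaRep hκ hv) k = gen vec (X.PathsBelow (k : Set T)) := by
  rw [rangeI, iotaRep_one hκ hv hk, range_starProjection]

theorem gen_below_le_rangeP (hκ : X.IsWideSense κ) (hv : IsDilation X κ vec) (l : Slice T) :
    gen vec (X.PathsBelow l.1) ≤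
      ⨅ (k : Finset T) (_ : (k : Set T) ⊆ l.1), rangeP X (evOp vec) k := by
  refine le_iInf₂ fun k hk => ?_
  rw [rangeP_eq hκ hv (l.nonanticipatory.mono hk)]
  exact gen_mono (X.pathsBelow_subset_past l.nonanticipatory hk)

/-- A matter of generating sets of paths: the past of `k` is the union of the paths below the slices
`l ⊇ k`; the paths below `l` are the union of those below finite `k ⊆ l`; and if `k ⊆ l` meets every
class of `l`, the past of `k` consists of the paths below `l`, since each point is on, below or
above a slice. -/
theorem isCanonical (hκ : X.IsWideSense κ) (hv : IsDilation X κ vec) :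
    IsCanonical X (embK hκ hv) (iotaRep hκ hv) (evOp vec) := by
  have hsup : ∀ k : Finset T, Nonanticipatory (k : Set T) → rangeP X (evOp vec) k ≤
      (⨆ (l : Slice T) (_ : (k : Set T) ⊆ l.1),
        gen vec (X.PathsBelow l.1)).topologicalClosure := by
    intro k hk
    rw [rangeP_eq hκ hv hk]
    refine gen_le (Submodule.isClosed_topologicalClosure _) fun b hb ζ => ?_
    obtain ⟨l, hl, hbl, -⟩ := X.exists_slice_of_past hk hb hb
    exact Submodule.le_topologicalClosure _
      (Submodule.mem_iSup_of_mem l (Submodule.mem_iSup_of_mem hl (vec_mem_gen hbl ζ)))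
  have hclosed : ∀ k : Finset T, Nonanticipatory (k : Set T) →
      IsClosed (rangeP X (evOp vec) k : Set H) := fun k hk => by
    rw [rangeP_eq hκ hv hk]; exact isClosed_gen _
  refine ⟨fun k hk => ?_, fun k hk => ?_, fun l => ?_, fun l => ?_, fun l hl => ?_⟩
  · simp only [sliceSpace_eq hκ hv]
    refine (hsup k hk).antisymm (Submodule.topologicalClosure_minimal _ ?_ (hclosed k hk))
    refine iSup₂_le fun l hl => (gen_below_le_rangeP hκ hv l).trans (iInf₂_le k hl)
  · refine ((hsup k hk).trans (Submodule.topologicalClosure_mono ?_)).antisymm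
      (Submodule.topologicalClosure_minimal _ ?_ (hclosed k hk))
    · exact iSup₂_mono fun l _ => gen_below_le_rangeP hκ hv l
    · exact iSup₂_le fun l hl => iInf₂_le k hl
  · rw [sliceSpace_eq hκ hv]
    refine le_antisymm (gen_le (Submodule.isClosed_topologicalClosure _) fun b hb ζ => ?_)
      (Submodule.topologicalClosure_minimal _ (iSup₂_le fun k hk => ?_) (isClosed_gen _))
    · obtain ⟨Λ, hΛ, hbΛ⟩ := X.mem_pathsBelow_iff.1 hb
      obtain ⟨k, hk, hle⟩ := exists_finset_causalLE hΛ
      refine Submodule.le_topologicalClosure _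
        (Submodule.mem_iSup_of_mem k (Submodule.mem_iSup_of_mem hk ?_))
      rw [rangeI_eq hκ hv (l.nonanticipatory.mono hk)]
      exact vec_mem_gen (X.mem_pathsBelow_iff.2 ⟨Λ, hle, hbΛ⟩) ζ
    · rw [rangeI_eq hκ hv (l.nonanticipatory.mono hk)]
      exact gen_mono (X.pathsBelow_mono (CausalLE.of_subset hk))
  · rw [sliceSpace_eq hκ hv]; exact gen_below_le_rangeP hκ hv l
  · rw [sliceSpace_eq hκ hv]
    refine (gen_below_le_rangeP hκ hv l).antisymm ?_
    classical
    -- One representative from each of the finitely many classes of `l`; then the single projection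
    -- `P_k` already has range `H_l`.
    obtain ⟨k, hk, hkc⟩ : ∃ k : Finset T, (k : Set T) ⊆ l.1 ∧ clsOf (k : Set T) = clsOf l.1 := by
      have hsub : (hl.toFinset : Set (Cls T)) ⊆ cls '' l.1 := by
        rw [Set.Finite.coe_toFinset]; exact subset_rfl
      obtain ⟨k, hk, he⟩ := Finset.subset_set_image_iff.1 hsub
      exact ⟨k, hk, by rw [clsOf, ← Finset.coe_image, he, Set.Finite.coe_toFinset]⟩
    have hkn := l.nonanticipatory.mono hk
    refine (iInf₂_le k hk).trans ?_
    rw [rangeP_eq hκ hv hkn]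
    refine gen_mono fun b hb => ?_
    rw [X.past_eq_of_clsOf hkc] at hb
    refine ⟨hb.1, fun c hc => ?_⟩
    obtain ⟨u, rfl⟩ := exists_cls_eq c
    rcases l.trichotomy u with h | ⟨t, ht, hut⟩ | ⟨t, ht, htu⟩
    · exact ⟨u, h, le_rfl⟩
    · exact ⟨t, ht, cls_le_cls.2 hut.le⟩
    · exact absurd (cls_lt_cls.2 htu) (hb.2 _ hc t ht)

end Realization

/-! ### Covariance -/

section Covariance

variable {S : Type uS} {T : Type uT} {K : Type uK} [Semigroup S] [Preorder T] [CausalAction S T]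
  [NormedAddCommGroup K] [InnerProductSpace ℂ K] [CompleteSpace K]
  {X : Setting.{uS, uT, uE, uK} S T K}
  {κ : (Cls T → Set X.Ω) → (Cls T → Set X.Ω) → K →L[ℂ] K}
  {H : Type uH} [NormedAddCommGroup H] [InnerProductSpace ℂ H] [CompleteSpace H]
  {vec : (Cls T → Set X.Ω) → K →L[ℂ] H}

namespace Setting

variable (X)

/-- Injectivity of the map of classes makes the prescribed coordinates consistent; those off its
image are arbitrary. Thus `pull` is determined by membership of any such extension, as events of
`𝓑_{sk}` ignore the other coordinates. -/
theorem exists_extension (s : S) (x : X.Ω) : ∃ y : X.Ω, ∀ c, y (clsMap s c) = X.g s c (x c) := by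
  classical
  have h : ∀ (c c' : Cls T) (e : clsMap s c' = clsMap s c),
      (e ▸ X.g s c' (x c') : X.E (clsMap s c)) = X.g s c (x c) := by
    intro c c' e
    obtain rfl := clsMap_injective s e
    rfl
  refine ⟨fun c => if e : ∃ c', clsMap s c' = c then e.choose_spec ▸ X.g s _ (x e.choose)
    else (X.nonempty c).some, fun c => ?_⟩
  have he : ∃ c', clsMap s c' = clsMap s c := ⟨c, rfl⟩
  beta_reduce
  rw [dif_pos he]
  exact h c _ he.choose_spec

theorem pull_univ (s : S) : X.pull s Set.univ = Set.univ := by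
  rw [Set.eq_univ_iff_forall]
  intro x
  obtain ⟨y, hy⟩ := X.exists_extension s x
  exact ⟨y, trivial, hy⟩

theorem mem_of_mem_image {s : S} {k : Finset T} (hk : Nonanticipatory (k : Set T)) {B : Set X.Ω}
    (hB : B ∈ X.𝓑 (image s k)) {y y' : X.Ω} (h : ∀ c, y (clsMap s c) = y' (clsMap s c))
    (hy : y ∈ B) : y' ∈ B := by
  refine X.cylinder _ (hk.image s) B hB y y' ?_ hy
  rw [clsOf_image]
  rintro _ ⟨c, -, rfl⟩
  exact h c

theorem pull_inter {s : S} {k : Finset T} (hk : Nonanticipatory (k : Set T)) {B B' : Set X.Ω}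
    (hB' : B' ∈ X.𝓑 (image s k)) : X.pull s (B ∩ B') = X.pull s B ∩ X.pull s B' := by
  ext x
  constructor
  · rintro ⟨y, hy, h⟩
    exact ⟨⟨y, hy.1, h⟩, ⟨y, hy.2, h⟩⟩
  · rintro ⟨⟨y, hy, h⟩, ⟨y', hy', h'⟩⟩
    exact ⟨y, ⟨hy, X.mem_of_mem_image hk hB' (fun c => (h' c).trans (h c).symm) hy'⟩, h⟩

theorem pull_mem {s : S} {k : Finset T} (hk : Nonanticipatory (k : Set T)) {B : Set X.Ω}
    (hB : B ∈ X.𝓑 (image s k)) : X.pull s B ∈ X.𝓑 k := by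
  rw [← X.𝓑_image s k hk]
  exact ⟨B, hB, rfl⟩

theorem pull_mul {s s' : S} {k : Finset T} (hk : Nonanticipatory (k : Set T)) {B : Set X.Ω}
    (hB : B ∈ X.𝓑 (image (s * s') k)) : X.pull s' (X.pull s B) = X.pull (s * s') B := by
  -- The two sides of `g_mul` lie in scales indexed by different expressions for one class;
  -- comparison with a fixed point `y` turns the equality of pairs into a usable equivalence.
  have hg : ∀ (y x : X.Ω) (c : Cls T), y (clsMap (s * s') c) = X.g (s * s') c (x c) ↔
      y (clsMap s (clsMap s' c)) = X.g s _ (X.g s' c (x c)) := by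
    intro y x c
    have h : ∀ {p q : Σ c, X.E c}, p = q → (y p.1 = p.2 ↔ y q.1 = q.2) := by
      rintro _ _ rfl; rfl
    exact h (X.g_mul s s' c (x c)).symm
  ext x
  constructor
  · rintro ⟨y, ⟨z, hz, hzy⟩, hyx⟩
    refine ⟨z, hz, fun c => (hg z x c).2 ?_⟩
    rw [hzy, hyx]
  · rintro ⟨z, hz, hzx⟩
    obtain ⟨y, hy⟩ := X.exists_extension s' x
    obtain ⟨z', hz'⟩ := X.exists_extension s y
    refine ⟨y, ⟨z', X.mem_of_mem_image hk hB (fun c => ?_) hz, hz'⟩, hy⟩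
    rw [hzx c]
    exact ((hg z' x c).2 (by rw [hz', hy])).symm

theorem pathPull_mem {s : S} {Λ : Finset T} {b : Cls T → Set X.Ω}
    (hb : b ∈ X.PathsOn (image s Λ)) : X.pathPull s b ∈ X.PathsOn Λ := by
  refine fun c => ⟨fun hc => ?_, fun hc => ?_⟩
  · refine X.pull_mem (inClass_nonanticipatory Λ c) ?_
    rw [← inClass_image]
    exact X.pathsOn_apply hb _
  · rw [pathPull, (hb _).2, pull_univ]
    rw [clsOf_image]
    rintro ⟨c', hc', h⟩
    exact hc (clsMap_injective s h ▸ hc')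

theorem pathPull_apply_mem {s : S} {Λ : Finset T} {b : Cls T → Set X.Ω}
    (hb : b ∈ X.PathsOn (image s Λ)) (c : Cls T) :
    b (clsMap s c) ∈ X.𝓑 (image s (inClass Λ c)) := by
  rw [← inClass_image]
  exact X.pathsOn_apply hb _

theorem pathPull_inf {s : S} {Λ : Finset T} {b b' : Cls T → Set X.Ω}
    (hb' : b' ∈ X.PathsOn (image s Λ)) :
    X.pathPull s (b ⊓ b') = X.pathPull s b ⊓ X.pathPull s b' :=
  funext fun c => X.pull_inter (inClass_nonanticipatory Λ c) (X.pathPull_apply_mem hb' c)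

theorem pathPull_mul {s s' : S} {Λ : Finset T} {b : Cls T → Set X.Ω}
    (hb : b ∈ X.PathsOn (image (s * s') Λ)) :
    X.pathPull s' (X.pathPull s b) = X.pathPull (s * s') b := by
  funext c
  change X.pull s' (X.pull s (b (clsMap s (clsMap s' c)))) = X.pull (s * s') _
  rw [← clsMap_mul]
  exact X.pull_mul (inClass_nonanticipatory Λ c) (X.pathPull_apply_mem hb c)

/-- By `𝓑_image` each factor is an inverse image of an event of the image class; classes off the
image get the trivial factor. Hence every generator has the form `vec (b^s) ζ`, and `V_s` is defined
on all of `H`. -/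
theorem exists_pathPull_eq (s : S) {Λ : Finset T} {b : Cls T → Set X.Ω} (hb : b ∈ X.PathsOn Λ) :
    ∃ b' ∈ X.PathsOn (image s Λ), X.pathPull s b' = b := by
  have h1 : ∀ c, ∃ B, B ∈ X.𝓑 (image s (inClass Λ c)) ∧ X.pull s B = b c ∧
      (c ∉ clsOf (Λ : Set T) → B = Set.univ) := by
    intro c
    by_cases hc : c ∈ clsOf (Λ : Set T)
    · have h := X.pathsOn_apply hb c
      rw [← X.𝓑_image s _ (inClass_nonanticipatory Λ c)] at h
      obtain ⟨B, hB, h⟩ := h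
      exact ⟨B, hB, h, fun h' => absurd hc h'⟩
    · exact ⟨Set.univ, X.univ_mem_events _ ((inClass_nonanticipatory Λ c).image s), by
        rw [pull_univ, (hb c).2 hc], fun _ => rfl⟩
  choose B hB hBb hBu using h1
  have hext : ∀ c, Function.extend (clsMap s) B (fun _ => Set.univ) (clsMap s c) = B c :=
    fun c => (clsMap_injective s).extend_apply _ _ c
  refine ⟨Function.extend (clsMap s) B fun _ => Set.univ, fun c' => ⟨fun hc' => ?_, fun hc' => ?_⟩,
    funext fun c => ?_⟩
  · rw [clsOf_image] at hc'
    obtain ⟨c, -, rfl⟩ := hc'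
    rw [hext, inClass_image]
    exact hB c
  · by_cases h : ∃ c, clsMap s c = c'
    · obtain ⟨c, rfl⟩ := h
      rw [hext]
      refine hBu c fun hc => hc' ?_
      rw [clsOf_image]
      exact ⟨c, hc, rfl⟩
    · exact Function.extend_apply' _ _ _ h
  · rw [pathPull, hext, hBb]

end Setting

theorem inner_vec_pathPull (hκ : X.IsWideSense κ) (hv : IsDilation X κ vec) (s : S)
    {Λ Λ' : Finset T} {b b' : Cls T → Set X.Ω} (hb : b ∈ X.PathsOn (image s Λ))
    (hb' : b' ∈ X.PathsOn (image s Λ')) (ζ ζ' : K) :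
    ⟪vec b (X.U s ζ), vec b' (X.U s ζ')⟫_ℂ =
      ⟪vec (X.pathPull s b) ζ, vec (X.pathPull s b') ζ'⟫_ℂ := by
  classical
  have h1 := X.pathsOn_mono (image_mono s (Finset.subset_union_left (s₁ := Λ) (s₂ := Λ'))) hb
  have h2 := X.pathsOn_mono (image_mono s (Finset.subset_union_right (s₁ := Λ) (s₂ := Λ'))) hb'
  rw [hv.inner _ (X.pathsOn_subset_paths _ h1) _ (X.pathsOn_subset_paths _ h2),
    hv.inner _ (X.pathsOn_subset_paths _ (X.pathPull_mem h1)) _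
      (X.pathsOn_subset_paths _ (X.pathPull_mem h2)),
    ← hκ.covariance s (Λ ∪ Λ') b h1 b' h2]
  rw [ContinuousLinearMap.comp_apply, ContinuousLinearMap.comp_apply,
    ContinuousLinearMap.adjoint_inner_right]
  rfl

/-- Covariance equates the Gram matrices of the vectors `vec b (U_s ζ)` and `vec (b^s) ζ`. A choice
of one lift for each path defines the isometry. -/
theorem exists_shift (hκ : X.IsWideSense κ) (hv : IsDilation X κ vec) (s : S) :
    ∃ V : H →ₗᵢ[ℂ] H, ∀ (Λ : Finset T), ∀ b ∈ X.PathsOn (image s Λ), ∀ ζ,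
      V (vec (X.pathPull s b) ζ) = vec b (X.U s ζ) := by
  have h1 : ∀ b : X.Paths, ∃ (Λ : Finset T) (b' : Cls T → Set X.Ω), b' ∈ X.PathsOn (image s Λ) ∧
      X.pathPull s b' = b := by
    intro b
    obtain ⟨Λ, hb, -⟩ := X.exists_pathsOn b.2
    obtain ⟨b', hb', h⟩ := X.exists_pathPull_eq s hb
    exact ⟨Λ, b', hb', h⟩
  choose Λ b' hb' hbb using h1
  obtain ⟨V, hV⟩ := exists_linearIsometry_of_inner (fun i : X.Paths × K => vec i.1 i.2)
    (fun i : X.Paths × K => vec (b' i.1) (X.U s i.2)) (by rw [range_vec]; exact hv.gen_paths)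
    (fun i j => by
      rw [inner_vec_pathPull hκ hv s (hb' i.1) (hb' j.1), hbb, hbb])
  refine ⟨V, fun Λ₀ b hb ζ => ?_⟩
  have hp := X.pathsOn_subset_paths _ (X.pathPull_mem hb)
  refine (hV ⟨⟨_, hp⟩, ζ⟩).trans ?_
  have hq := hb' ⟨_, hp⟩
  have hqq := hbb ⟨_, hp⟩
  -- Independence of the chosen lift: two lifts of one path give vectors with identical inner
  -- products, so their difference has norm zero.
  rw [← sub_eq_zero, ← inner_self_eq_zero (𝕜 := ℂ), inner_sub_left, inner_sub_right,
    inner_sub_right, inner_vec_pathPull hκ hv s hq hq, inner_vec_pathPull hκ hv s hq hb,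
    inner_vec_pathPull hκ hv s hb hq, inner_vec_pathPull hκ hv s hb hb, hqq]
  simp

/-- The isometric representation of the semigroup on the space of the dilation. -/
def shift (hκ : X.IsWideSense κ) (hv : IsDilation X κ vec) : S →ₙ* (H →ₗᵢ[ℂ] H) where
  toFun s := (exists_shift hκ hv s).choose
  map_mul' s s' := by
    have key : ((exists_shift hκ hv (s * s')).choose).toContinuousLinearMap =
        ((exists_shift hκ hv s).choose).toContinuousLinearMap ∘L
          ((exists_shift hκ hv s').choose).toContinuousLinearMap := by
      refine gen_clm_ext (vec := vec) X.Paths (fun b hb ζ => ?_) fun x hx => ?_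
      · obtain ⟨Λ, hb, -⟩ := X.exists_pathsOn hb
        obtain ⟨b', hb', rfl⟩ := X.exists_pathPull_eq (s * s') hb
        have h2 : b' ∈ X.PathsOn (image s (image s' Λ)) := image_mul s s' Λ ▸ hb'
        have h3 := (exists_shift hκ hv (s * s')).choose_spec Λ b' hb' ζ
        have h4 := (exists_shift hκ hv s').choose_spec Λ _ (X.pathPull_mem h2) ζ
        have h5 := (exists_shift hκ hv s).choose_spec _ b' h2 (X.U s' ζ)
        rw [X.pathPull_mul hb'] at h4
        rw [ContinuousLinearMap.comp_apply]
        refine h3.trans ?_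
        rw [map_mul]
        exact h5.symm.trans (congrArg _ h4.symm)
      · rw [hv.gen_paths, Submodule.top_orthogonal_eq_bot, Submodule.mem_bot] at hx
        rw [hx, map_zero, map_zero]
    ext x
    exact congrArg (fun P : H →L[ℂ] H => P x) key

theorem shift_vec (hκ : X.IsWideSense κ) (hv : IsDilation X κ vec) (s : S) {Λ : Finset T}
    {b : Cls T → Set X.Ω} (hb : b ∈ X.PathsOn (image s Λ)) (ζ : K) :
    shift hκ hv s (vec (X.pathPull s b) ζ) = vec b (X.U s ζ) :=
  (exists_shift hκ hv s).choose_spec Λ b hb ζ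

theorem Uop_conj (s : S) (a : K →L[ℂ] K) (ζ : K) : X.U s (X.conj s a ζ) = a (X.U s ζ) := by
  have h : ∀ z : K, X.Uop s (ContinuousLinearMap.adjoint (X.Uop s) z) = z := by
    intro z
    obtain ⟨w, rfl⟩ := (X.U s).surjective z
    refine congrArg (X.U s) (ext_inner_left ℂ fun y => ?_)
    rw [ContinuousLinearMap.adjoint_inner_right]
    exact (X.U s).inner_map_map y w
  exact h _

/-- A path in a class of paths pulled back by `s` comes from a path on the image. -/
theorem exists_pathPull_below (s : S) {j : Set T} {b : Cls T → Set X.Ω}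
    (hb : b ∈ X.PathsBelow j) : ∃ (Λ : Finset T) (b' : Cls T → Set X.Ω),
      b' ∈ X.PathsOn (image s Λ) ∧ X.pathPull s b' = b ∧ CausalLE (Λ : Set T) j := by
  obtain ⟨Λ, hΛ, hbΛ⟩ := X.mem_pathsBelow_iff.1 hb
  obtain ⟨b', hb', h⟩ := X.exists_pathPull_eq s hbΛ
  exact ⟨Λ, b', hb', h, hΛ⟩

theorem isCovariant (hκ : X.IsWideSense κ) (hv : IsDilation X κ vec) :
    IsCovariant X (embK hκ hv) (iotaRep hκ hv) (evOp vec) (shift hκ hv) where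
  extends_U s ζ := by
    have h := shift_vec hκ hv s (X.unit_mem_pathsOn (image s ∅)) ζ
    have h' : X.pathPull s X.unit = X.unit := X.pathsOn_empty (X.pathPull_mem (X.unit_mem_pathsOn _))
    rw [h'] at h
    exact h
  rep s k hk a h h' := by
    have hk' := hk.image s
    refine gen_clm_ext (vec := vec) (X.PathsBelow (k : Set T)) (fun b hb ζ => ?_) fun x hx => ?_
    · obtain ⟨Λ, b', hb', rfl, hΛ⟩ := exists_pathPull_below s hb
      have hle : CausalLE (image s Λ : Set T) (image s k : Set T) := by
        rw [coe_image s k]; exact causalLE_image s hΛ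
      simp only [ContinuousLinearMap.comp_apply, (isOpOn_iotaRep hκ hv hk _).on _ hb,
        LinearIsometry.coe_toContinuousLinearMap, shift_vec hκ hv s hb', Uop_conj]
      rw [(isOpOn_iotaRep hκ hv hk' _).on _ (X.mem_pathsBelow_iff.2 ⟨_, hle, hb'⟩)]
      rfl
    · simp only [ContinuousLinearMap.comp_apply, (isOpOn_iotaRep hκ hv hk _).off x hx, map_zero]
  process s k hk B hB := by
    have hk' := hk.image s
    have hpB := X.pull_mem hk hB
    refine gen_clm_ext (vec := vec) (X.Past (k : Set T)) (fun b hb ζ => ?_) fun x hx => ?_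
    · obtain ⟨Λ, hbΛ, hs⟩ := X.exists_pathsOn hb.1
      obtain ⟨b', hb', rfl⟩ := X.exists_pathPull_eq s hbΛ
      -- The action reflects strict order, so a lift supported on the image of `Λ` stays in the past
      -- of `s k`.
      have hb'p : b' ∈ X.Past (image s k : Set T) := by
        refine X.past_pathsOn hb' fun u hu t ht => ?_
        obtain ⟨u', hu', rfl⟩ := mem_image.1 hu
        obtain ⟨t', ht', rfl⟩ := mem_image.1 ht
        rw [smul_lt_smul, ← cls_lt_cls]
        exact hb.2 _ (hs u' hu') t' ht'
      have h1 : evOp vec k Set.univ (vec (X.pathPull s b') ζ) = vec (X.pathPull s b') ζ := by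
        rw [evOp_univ hκ hv hk]
        exact Submodule.starProjection_eq_self_iff.2 (vec_mem_gen hb _)
      simp only [ContinuousLinearMap.comp_apply, h1, LinearIsometry.coe_toContinuousLinearMap,
        shift_vec hκ hv s hb']
      rcases events_cases hk' hB with rfl | ⟨β, hβ, rfl⟩
      · have : X.pull s ∅ = ∅ := by
          ext x; simp [Setting.pull]
        rw [this, evOp_empty, evOp_empty]; simp
      · have hpb : X.pull s (X.box β (image s k : Set T)) = X.box (X.pathPull s β) (k : Set T) := by
          have hβp := X.pathsOn_subset_paths _ hβ
          ext x
          constructor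
          · rintro ⟨y, hy, hyx⟩
            refine Set.mem_iInter₂.2 fun c hc => ⟨y, Set.mem_iInter₂.1 hy _ ?_, hyx⟩
            rw [clsOf_image]; exact ⟨c, hc, rfl⟩
          · intro hx
            obtain ⟨y, hy⟩ := X.exists_extension s x
            refine ⟨y, Set.mem_iInter₂.2 ?_, hy⟩
            rw [clsOf_image]
            rintro _ ⟨c, hc, rfl⟩
            obtain ⟨y', hy', hyx'⟩ := Set.mem_iInter₂.1 hx c hc
            exact X.paths_cylinder hβp ((hyx' c).trans (hy c).symm) hy'
        rw [hpb, (evOp_box_spec hκ hv hk (X.pathPull_mem hβ)).2.on _ hb,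
          (evOp_box_spec hκ hv hk' hβ).2.on _ hb'p, ← X.pathPull_inf hβ]
        classical
        exact shift_vec hκ hv s (Λ := Λ ∪ k) (X.pathsOn_inter
          (X.pathsOn_mono (image_mono s Finset.subset_union_left) hb')
          (X.pathsOn_mono (image_mono s Finset.subset_union_right) hβ)) ζ
    · simp only [ContinuousLinearMap.comp_apply, evOp_off hκ hv hk hpB hx,
        evOp_off hκ hv hk (X.univ_mem_events k hk) hx, map_zero]

end Covariance

/-! ### Regularity -/

section Regularity

variable {S : Type uS} {T : Type uT} {K : Type uK} [Semigroup S] [Preorder T] [CausalAction S T]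
  [NormedAddCommGroup K] [InnerProductSpace ℂ K] [CompleteSpace K]
  {X : Setting.{uS, uT, uE, uK} S T K}
  {κ : (Cls T → Set X.Ω) → (Cls T → Set X.Ω) → K →L[ℂ] K}
  {H : Type uH} [NormedAddCommGroup H] [InnerProductSpace ℂ H] [CompleteSpace H]
  {vec : (Cls T → Set X.Ω) → K →L[ℂ] H}

theorem iotaRep_empty_vec (hκ : X.IsWideSense κ) (hv : IsDilation X κ vec)
    {b : Cls T → Set X.Ω} (hb : b ∈ X.Paths) (ζ : K) :
    iotaRep hκ hv ∅ 1 (vec b ζ) = vec X.unit (κ X.unit b ζ) := by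
  rw [iotaRep_empty_one, ContinuousLinearMap.comp_apply, adjoint_emb_vec hκ hv hb, emb_embK]

theorem iotaRep_empty_mem (hκ : X.IsWideSense κ) (hv : IsDilation X κ vec) (j : Set T) (x : H) :
    iotaRep hκ hv ∅ 1 x ∈ gen vec (X.PathsBelow j) := by
  rw [iotaRep_empty_one, ContinuousLinearMap.comp_apply, emb_embK]
  exact vec_mem_gen (X.unit_mem_pathsBelow j) _

/-- Let `w` be `vec b ζ` minus its component in `K`. The hypothesis bounds `⟪y, w⟫` by `ε` for `‖y‖
≤ 1` in the span of the generators below `l`, hence by `ε ‖y‖` on `H_l`. The choice `y = E_l w`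
gives `‖E_l w‖² ≤ ε ‖E_l w‖`. -/
theorem norm_sub_le_of_noncorrelation (hκ : X.IsWideSense κ) (hv : IsDilation X κ vec)
    {l : Slice T} {b : Cls T → Set X.Ω} (hb : b ∈ X.Paths) {ζ : K} {ε : ℝ} (hε : 0 ≤ ε)
    (h : ∀ (m : ℕ) (f : Fin m → Cls T → Set X.Ω) (z : Fin m → K),
      (∀ i, f i ∈ X.PathsBelow l.1) → ∑ i, ∑ i', ⟪z i, κ (f i) (f i') (z i')⟫_ℂ ≤ 1 →
      ‖∑ i, ⟪z i, (κ (f i) b - κ (f i) X.unit * κ X.unit b) ζ⟫_ℂ‖ ≤ ε) :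
    ‖(gen vec (X.PathsBelow l.1)).starProjection (vec b ζ) - iotaRep hκ hv ∅ 1 (vec b ζ)‖ ≤ ε := by
  set E := (gen vec (X.PathsBelow l.1)).starProjection with hE
  set w := vec b ζ - iotaRep hκ hv ∅ 1 (vec b ζ) with hw
  have hspan : ∀ y ∈ Submodule.span ℂ {x : H | ∃ b ∈ X.PathsBelow l.1, ∃ ζ, x = vec b ζ},
      ‖y‖ ≤ 1 → ‖⟪y, w⟫_ℂ‖ ≤ ε := by
    intro y hy hy1
    obtain ⟨n, c, g, rfl⟩ := Submodule.mem_span_set'.1 hy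
    choose f hf z hz using fun i => (g i).2
    have h1 : ∑ i, c i • ((g i : H)) = ∑ i, vec (f i) (c i • z i) :=
      Finset.sum_congr rfl fun i _ => by rw [hz, map_smul]
    have hp : ∀ i, f i ∈ X.Paths := fun i => X.pathsBelow_subset_paths _ (hf i)
    rw [h1] at hy1 ⊢
    have h2 := h n f (fun i => c i • z i) hf (by
      have : ∑ i, ∑ i', ⟪c i • z i, κ (f i) (f i') (c i' • z i')⟫_ℂ =
          ⟪∑ i, vec (f i) (c i • z i), ∑ i, vec (f i) (c i • z i)⟫_ℂ := by
        rw [sum_inner]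
        refine Finset.sum_congr rfl fun i _ => ?_
        rw [inner_sum]
        exact Finset.sum_congr rfl fun j _ => (hv.inner _ (hp i) _ (hp j) _ _).symm
      rw [this, inner_self_eq_norm_sq_to_K]
      have h3 : ‖∑ i, vec (f i) (c i • z i)‖ ^ 2 ≤ 1 := by
        have := norm_nonneg (∑ i, vec (f i) (c i • z i))
        nlinarith
      have h4 : (((‖∑ i, vec (f i) (c i • z i)‖ ^ 2 : ℝ)) : ℂ) ≤ ((1 : ℝ) : ℂ) :=
        Complex.real_le_real.2 h3
      simpa using h4)
    refine le_of_eq_of_le (congrArg _ ?_) h2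
    rw [sum_inner]
    refine Finset.sum_congr rfl fun i _ => ?_
    rw [hw, iotaRep_empty_vec hκ hv hb, inner_sub_right, hv.inner _ (hp i) _ hb,
      hv.inner _ (hp i) _ X.unit_mem_paths, ← inner_sub_right]
    rfl
  have hall : ∀ y ∈ gen vec (X.PathsBelow l.1), ‖⟪y, w⟫_ℂ‖ ≤ ε * ‖y‖ := by
    intro y hy
    have hcl : IsClosed {y : H | ‖⟪y, w⟫_ℂ‖ ≤ ε * ‖y‖} :=
      isClosed_le (by fun_prop) (by fun_prop)
    refine closure_minimal (fun y hy => ?_) hcl hy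
    change ‖⟪y, w⟫_ℂ‖ ≤ ε * ‖y‖
    by_cases h0 : ‖y‖ = 0
    · rw [norm_eq_zero.1 h0]; simp
    · have h1 := hspan (((‖y‖ : ℂ)⁻¹) • y) (Submodule.smul_mem _ _ hy) (by
        rw [norm_smul, norm_inv, Complex.norm_real, norm_norm, inv_mul_cancel₀ h0])
      rw [inner_smul_left, norm_mul, RCLike.norm_conj, norm_inv, Complex.norm_real, norm_norm] at h1
      have h2 : 0 < ‖y‖ := lt_of_le_of_ne (norm_nonneg _) (Ne.symm h0)
      rwa [inv_mul_le_iff₀ h2, mul_comm] at h1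
  have hmem : E (vec b ζ) - iotaRep hκ hv ∅ 1 (vec b ζ) ∈ gen vec (X.PathsBelow l.1) :=
    sub_mem (Submodule.starProjection_apply_mem _ _) (iotaRep_empty_mem hκ hv _ _)
  have h1 := hall _ hmem
  set y := E (vec b ζ) - iotaRep hκ hv ∅ 1 (vec b ζ) with hy
  -- Since `K ⊆ H_l`, the vector `y` equals `E_l w`, and `w - y` is orthogonal to `H_l`.
  have h2 : ⟪y, w⟫_ℂ = ⟪y, y⟫_ℂ := by
    have h3 : w - y ∈ (gen vec (X.PathsBelow l.1))ᗮ := by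
      have : w - y = vec b ζ - E (vec b ζ) := by rw [hw, hy]; abel
      rw [this]
      exact Submodule.sub_starProjection_mem_orthogonal _
    have := (Submodule.mem_orthogonal _ _).1 h3 y hmem
    rwa [inner_sub_right, sub_eq_zero] at this
  rw [h2, inner_self_eq_norm_sq_to_K, norm_pow, RCLike.norm_ofReal, abs_norm, sq] at h1
  by_cases h0 : ‖y‖ = 0
  · rw [h0]; exact hε
  · exact le_of_mul_le_mul_right h1 (lt_of_le_of_ne (norm_nonneg _) (Ne.symm h0))

theorem isStarProjection_iotaRep_one (hκ : X.IsWideSense κ) (hv : IsDilation X κ vec) :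
    IsStarProjection (iotaRep hκ hv ∅ 1) := by
  rw [iotaRep_one hκ hv nonanticipatory_empty]
  exact isStarProjection_starProjection

/-- The operators `E_l - P` are uniformly bounded, so the vectors on which they tend to zero form a
closed set; it is closed under sums because slices are directed downwards, and it contains the
generators by `norm_sub_le_of_noncorrelation`. -/
theorem tendsto_slice_projection (hκ : X.IsWideSense κ) (hv : IsDilation X κ vec)
    (h : X.AsymptoticNoncorrelation κ) (x : H) : ∀ ε > (0 : ℝ), ∃ l₀ : Slice T, ∀ l : Slice T,
      CausalLE l.1 l₀.1 →
      ‖(gen vec (X.PathsBelow l.1)).starProjection x - iotaRep hκ hv ∅ 1 x‖ ≤ ε := by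
  let D : Slice T → H →L[ℂ] H := fun l =>
    (gen vec (X.PathsBelow l.1)).starProjection - iotaRep hκ hv ∅ 1
  have hD : ∀ l x, ‖D l x‖ ≤ 2 * ‖x‖ := by
    intro l x
    have h1 := norm_apply_le_of_isStarProjection
      (isStarProjection_starProjection (U := gen vec (X.PathsBelow l.1))) x
    have h2 := norm_apply_le_of_isStarProjection (isStarProjection_iotaRep_one hκ hv) x
    calc ‖D l x‖ ≤ _ := norm_sub_le _ _
      _ ≤ ‖x‖ + ‖x‖ := add_le_add h1 h2
      _ = 2 * ‖x‖ := by ring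
  let M : Submodule ℂ H :=
    { carrier := {x | ∀ ε > (0 : ℝ), ∃ l₀ : Slice T, ∀ l : Slice T,
        CausalLE l.1 l₀.1 → ‖D l x‖ ≤ ε}
      zero_mem' := fun ε hε => by
        obtain ⟨l, -⟩ := exists_slice_superset (nonanticipatory_empty (T := T))
        exact ⟨l, fun l _ => by rw [map_zero, norm_zero]; exact hε.le⟩
      add_mem' := fun {x y} hx hy ε hε => by
        obtain ⟨l, hl⟩ := hx (ε / 2) (by positivity)
        obtain ⟨l', hl'⟩ := hy (ε / 2) (by positivity)
        obtain ⟨m, -, h1, h2⟩ := exists_slice_inf (Set.empty_subset l.1) (Set.empty_subset l'.1)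
        refine ⟨m, fun n hn => ?_⟩
        rw [map_add]
        have := norm_add_le (D n x) (D n y)
        have h3 := hl n (hn.trans h1)
        have h4 := hl' n (hn.trans h2)
        linarith
      smul_mem' := fun c x hx ε hε => by
        obtain ⟨l, hl⟩ := hx (ε / (‖c‖ + 1)) (by positivity)
        refine ⟨l, fun n hn => ?_⟩
        rw [map_smul, norm_smul]
        have h1 := hl n hn
        rw [le_div_iff₀ (by positivity)] at h1
        nlinarith [norm_nonneg (D n x)] }
  have hM : IsClosed (M : Set H) := by
    refine isClosed_of_closure_subset fun x hx ε hε => ?_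
    obtain ⟨y, hy, hxy⟩ := Metric.mem_closure_iff.1 hx (ε / 4) (by positivity)
    obtain ⟨l, hl⟩ := hy (ε / 2) (by positivity)
    refine ⟨l, fun n hn => ?_⟩
    have h1 := hD n (x - y)
    have h2 := hl n hn
    rw [dist_eq_norm] at hxy
    have h3 : D n x = D n (x - y) + D n y := by rw [← map_add, sub_add_cancel]
    rw [h3]
    have := norm_add_le (D n (x - y)) (D n y)
    linarith
  have : gen vec X.Paths ≤ M := gen_le hM fun b hb ζ ε hε => by
    obtain ⟨l₀, hl₀⟩ := h b hb ζ ε hε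
    exact ⟨l₀, fun l hl => norm_sub_le_of_noncorrelation hκ hv hb hε.le (hl₀ l hl)⟩
  rw [hv.gen_paths] at this
  exact this (Submodule.mem_top (x := x))

theorem sliceAlg_anti {l l' : Slice T} (h : CausalLE l.1 l'.1) :
    X.sliceAlg l' ≤ X.sliceAlg l := by
  intro a ha
  refine mem_sliceAlg.2 fun k hk => ?_
  obtain ⟨k', hk', hkk⟩ := exists_finset_causalLE
    (fun t ht => h t (hk ht) : CausalLE (k : Set T) l'.1)
  exact X.𝔄_anti k k' (l.nonanticipatory.mono hk) (l'.nonanticipatory.mono hk') hkk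
    (mem_sliceAlg.1 ha k' hk')

/-- The algebras `𝔄_l` grow as `l` decreases, and slices over `k` are directed downwards; so the
generated algebra is a directed union. -/
theorem exists_mem_sliceAlg {k : Finset T} (hk : Nonanticipatory (k : Set T))
    (hgen : X.𝔄 k = ⨆ (l : Slice T) (_ : (k : Set T) ⊆ l.1), X.sliceAlg l)
    {a : K →L[ℂ] K} (ha : a ∈ X.𝔄 k) : ∃ l : Slice T, (k : Set T) ⊆ l.1 ∧ a ∈ X.sliceAlg l := by
  obtain ⟨l, hl⟩ := exists_slice_superset hk
  have : Nonempty {l : Slice T // (k : Set T) ⊆ l.1} := ⟨⟨l, hl⟩⟩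
  rw [hgen, iSup_subtype', ← SetLike.mem_coe, StarSubalgebra.coe_iSup_of_directed] at ha
  · obtain ⟨l, hl⟩ := Set.mem_iUnion.1 ha
    exact ⟨l.1, l.2, hl⟩
  · intro l l'
    obtain ⟨m, hm, h1, h2⟩ := exists_slice_inf l.2 l'.2
    exact ⟨⟨m, hm⟩, sliceAlg_anti h1, sliceAlg_anti h2⟩

/-- The intersection of the subspaces `H_l` of the slices `l ⊇ k`. -/
def infGen (vec : (Cls T → Set X.Ω) → K →L[ℂ] H) (k : Finset T) : Submodule ℂ H :=
  ⨅ (l : Slice T) (_ : (k : Set T) ⊆ l.1), gen vec (X.PathsBelow l.1)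

theorem mem_infGen {k : Finset T} {x : H} :
    x ∈ infGen vec k ↔ ∀ l : Slice T, (k : Set T) ⊆ l.1 → x ∈ gen vec (X.PathsBelow l.1) := by
  simp [infGen, Submodule.mem_iInf]

theorem isClosed_infGen (k : Finset T) : IsClosed (infGen vec k : Set H) := by
  have : (infGen vec k : Set H) =
      ⋂ (l : Slice T) (_ : (k : Set T) ⊆ l.1), (gen vec (X.PathsBelow l.1) : Set H) := by
    ext x; simp [infGen]
  rw [this]
  exact isClosed_iInter fun l => isClosed_iInter fun _ => isClosed_gen _

instance (k : Finset T) : (infGen vec k).HasOrthogonalProjection :=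
  haveI := (isClosed_infGen (vec := vec) k).completeSpace_coe
  inferInstance

theorem infGen_mono {k k' : Finset T} (hk : Nonanticipatory (k : Set T))
    (h : CausalLE (k : Set T) (k' : Set T)) : infGen vec k ≤ infGen vec k' := by
  intro x hx
  refine mem_infGen.2 fun l' hl' => ?_
  obtain ⟨l, hl, hll⟩ := exists_slice_below hk l' (h.trans (CausalLE.of_subset hl'))
  exact gen_mono (X.pathsBelow_mono hll) (mem_infGen.1 hx l hl)

/-- The operators `ι_l(a)` of a slice. -/
abbrev sliceOp (vec : (Cls T → Set X.Ω) → K →L[ℂ] H) (l : Slice T) (a : K →L[ℂ] K) : H →L[ℂ] H :=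
  algOp vec (X.PathsBelow l.1) a

theorem isOpOn_sliceOp (hκ : X.IsWideSense κ) (hv : IsDilation X κ vec) {l : Slice T}
    {a : K →L[ℂ] K} (ha : a ∈ X.sliceAlg l) :
    IsOpOn vec (X.PathsBelow l.1) (fun b ζ => vec b (a ζ)) (sliceOp vec l a) :=
  isOpOn_algOp hv (X.pathsBelow_subset_paths _) (commutesOn_slice hκ l) ha

theorem sliceOp_eq_of_le (hκ : X.IsWideSense κ) (hv : IsDilation X κ vec) {l l' : Slice T}
    (h : CausalLE l'.1 l.1) {a : K →L[ℂ] K} (ha : a ∈ X.sliceAlg l) {x : H}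
    (hx : x ∈ gen vec (X.PathsBelow l'.1)) : sliceOp vec l a x = sliceOp vec l' a x :=
  gen_eqOn _ (fun b hb ζ => by
    rw [(isOpOn_sliceOp hκ hv ha).on b (X.pathsBelow_mono h hb),
      (isOpOn_sliceOp hκ hv (sliceAlg_anti h ha)).on b hb]) hx

/-- For any `l' ⊇ k`, the operators of `l` preserve `H_m` for a slice `m ⊇ k` below both `l` and
`l'`, and `H_m ⊆ H_{l'}`. -/
theorem sliceOp_mem_infGen (hκ : X.IsWideSense κ) (hv : IsDilation X κ vec) {k : Finset T}
    {l : Slice T} (hl : (k : Set T) ⊆ l.1) {a : K →L[ℂ] K} (ha : a ∈ X.sliceAlg l) {x : H}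
    (hx : x ∈ infGen vec k) : sliceOp vec l a x ∈ infGen vec k := by
  refine mem_infGen.2 fun l' hl' => ?_
  obtain ⟨m, hm, h1, h2⟩ := exists_slice_inf hl hl'
  exact gen_mono (X.pathsBelow_mono h2) (algOp_mem hv (X.pathsBelow_subset_paths _)
    (commutesOn_slice hκ l) ha (X.pathsBelow_mono h1) (mem_infGen.1 hx m hm))

/-- Both operators restrict to that of a common lower slice `m ⊇ k`, and `infGen vec k` lies in
`H_m`. This makes `infOp` independent of the slice chosen for `a`. -/
theorem sliceOp_eq_on_infGen (hκ : X.IsWideSense κ) (hv : IsDilation X κ vec) {k : Finset T}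
    {l l' : Slice T} (hl : (k : Set T) ⊆ l.1) (hl' : (k : Set T) ⊆ l'.1) {a : K →L[ℂ] K}
    (ha : a ∈ X.sliceAlg l) (ha' : a ∈ X.sliceAlg l') {x : H} (hx : x ∈ infGen vec k) :
    sliceOp vec l a x = sliceOp vec l' a x := by
  obtain ⟨m, hm, h1, h2⟩ := exists_slice_inf hl hl'
  rw [sliceOp_eq_of_le hκ hv h1 ha (mem_infGen.1 hx m hm),
    sliceOp_eq_of_le hκ hv h2 ha' (mem_infGen.1 hx m hm)]

theorem commute_starProjection {M : Submodule ℂ H} [M.HasOrthogonalProjection] {P : H →L[ℂ] H}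
    (h : ∀ x ∈ M, P x ∈ M) (h' : ∀ x ∈ M, star P x ∈ M) : Commute P M.starProjection := by
  ext x
  obtain ⟨u, hu, w, hw, rfl⟩ := M.exists_add_mem_mem_orthogonal x
  have hPw : P w ∈ Mᗮ := mem_orthogonal_of_map h' hw
  simp only [mul_apply_eq_comp, map_add, Submodule.starProjection_eq_self_iff.2 hu,
    Submodule.starProjection_eq_self_iff.2 (h u hu), map_zero,
    (Submodule.starProjection_apply_eq_zero_iff _).2 hw,
    (Submodule.starProjection_apply_eq_zero_iff _).2 hPw]

theorem sliceOp_star (hκ : X.IsWideSense κ) (hv : IsDilation X κ vec) {l : Slice T}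
    {a : K →L[ℂ] K} (ha : a ∈ X.sliceAlg l) :
    sliceOp vec l (star a) = star (sliceOp vec l a) :=
  algOp_star hv (X.pathsBelow_subset_paths _) (commutesOn_slice hκ l) ha

theorem sliceOp_commute_infGen (hκ : X.IsWideSense κ) (hv : IsDilation X κ vec) {k : Finset T}
    {l : Slice T} (hl : (k : Set T) ⊆ l.1) {a : K →L[ℂ] K} (ha : a ∈ X.sliceAlg l) :
    Commute (sliceOp vec l a) (infGen vec k).starProjection := by
  refine commute_starProjection (fun x hx => sliceOp_mem_infGen hκ hv hl ha hx) fun x hx => ?_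
  rw [← sliceOp_star hκ hv ha]
  exact sliceOp_mem_infGen hκ hv hl (star_mem ha) hx

/-- Every element of `𝔄_k` belongs to the algebra of a slice that contains `k`. -/
def LocallySliced (X : Setting.{uS, uT, uE, uK} S T K) (k : Finset T) : Prop :=
  ∀ a ∈ X.𝔄 k, ∃ l : Slice T, (k : Set T) ⊆ l.1 ∧ a ∈ X.sliceAlg l

/-- `ι_l(a)` restricted to the intersection of the subspaces `H_l`, `l ⊇ k`. -/
def infOp (vec : (Cls T → Set X.Ω) → K →L[ℂ] H) {k : Finset T} (h : LocallySliced X k)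
    (a : X.𝔄 k) : H →L[ℂ] H :=
  sliceOp vec (h a a.2).choose a * (infGen vec k).starProjection

theorem infOp_eq (hκ : X.IsWideSense κ) (hv : IsDilation X κ vec) {k : Finset T}
    (h : LocallySliced X k) (a : X.𝔄 k) {l : Slice T} (hl : (k : Set T) ⊆ l.1)
    (ha : (a : K →L[ℂ] K) ∈ X.sliceAlg l) :
    infOp vec h a = sliceOp vec l a * (infGen vec k).starProjection := by
  ext x
  exact sliceOp_eq_on_infGen hκ hv (h a a.2).choose_spec.1 hl (h a a.2).choose_spec.2 ha
    (Submodule.starProjection_apply_mem _ _)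

theorem LocallySliced.exists_common {k : Finset T} (h : LocallySliced X k) (a a' : X.𝔄 k) :
    ∃ l : Slice T, (k : Set T) ⊆ l.1 ∧ (a : K →L[ℂ] K) ∈ X.sliceAlg l ∧
      (a' : K →L[ℂ] K) ∈ X.sliceAlg l := by
  obtain ⟨l, hl, ha⟩ := h a a.2
  obtain ⟨l', hl', ha'⟩ := h a' a'.2
  obtain ⟨m, hm, h1, h2⟩ := exists_slice_inf hl hl'
  exact ⟨m, hm, sliceAlg_anti h1 ha, sliceAlg_anti h2 ha'⟩

theorem infOp_add (hκ : X.IsWideSense κ) (hv : IsDilation X κ vec) {k : Finset T}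
    (h : LocallySliced X k) (a a' : X.𝔄 k) :
    infOp vec h (a + a') = infOp vec h a + infOp vec h a' := by
  obtain ⟨l, hl, ha, ha'⟩ := h.exists_common a a'
  rw [infOp_eq hκ hv h a hl ha, infOp_eq hκ hv h a' hl ha',
    infOp_eq hκ hv h (a + a') hl (add_mem ha ha'), ← add_mul]
  congr 1
  exact algOp_add hv (X.pathsBelow_subset_paths _) (commutesOn_slice hκ l) ha ha'

theorem infOp_smul (hκ : X.IsWideSense κ) (hv : IsDilation X κ vec) {k : Finset T}
    (h : LocallySliced X k) (c : ℂ) (a : X.𝔄 k) :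
    infOp vec h (c • a) = c • infOp vec h a := by
  obtain ⟨l, hl, ha⟩ := h a a.2
  rw [infOp_eq hκ hv h a hl ha, infOp_eq hκ hv h (c • a) hl ((X.sliceAlg l).smul_mem ha c),
    ← smul_mul_assoc]
  congr 1
  exact algOp_smul hv (X.pathsBelow_subset_paths _) (commutesOn_slice hκ l) ha c

theorem infOp_mul (hκ : X.IsWideSense κ) (hv : IsDilation X κ vec) {k : Finset T}
    (h : LocallySliced X k) (a a' : X.𝔄 k) :
    infOp vec h (a * a') = infOp vec h a * infOp vec h a' := by
  obtain ⟨l, hl, ha, ha'⟩ := h.exists_common a a'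
  rw [infOp_eq hκ hv h a hl ha, infOp_eq hκ hv h a' hl ha',
    infOp_eq hκ hv h (a * a') hl (mul_mem ha ha'), mul_assoc, ← mul_assoc _ (sliceOp vec l _),
    ← (sliceOp_commute_infGen hκ hv hl ha').eq, mul_assoc (sliceOp vec l _),
    (isStarProjection_starProjection (U := infGen vec k)).isIdempotentElem.eq, ← mul_assoc]
  congr 1
  exact algOp_mul hv (X.pathsBelow_subset_paths _) (commutesOn_slice hκ l) ha ha'

theorem infOp_star (hκ : X.IsWideSense κ) (hv : IsDilation X κ vec) {k : Finset T}
    (h : LocallySliced X k) (a : X.𝔄 k) : infOp vec h (star a) = star (infOp vec h a) := by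
  obtain ⟨l, hl, ha⟩ := h a a.2
  rw [infOp_eq hκ hv h a hl ha, infOp_eq hκ hv h (star a) hl (star_mem ha), star_mul,
    (isStarProjection_starProjection (U := infGen vec k)).isSelfAdjoint.star_eq,
    ← sliceOp_star hκ hv ha]
  exact sliceOp_commute_infGen hκ hv hl (star_mem ha)

theorem infOp_one (hκ : X.IsWideSense κ) (hv : IsDilation X κ vec) {k : Finset T}
    (h : LocallySliced X k) : infOp vec h 1 = (infGen vec k).starProjection := by
  obtain ⟨l, hl, ha⟩ := h 1 (one_mem _)
  rw [infOp_eq hκ hv h 1 hl ha]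
  ext x
  have h1 : sliceOp vec l ((1 : X.𝔄 k) : K →L[ℂ] K) = _ :=
    algOp_one hv (X.pathsBelow_subset_paths _) (commutesOn_slice hκ l)
  rw [h1, mul_apply_eq_comp]
  exact Submodule.starProjection_eq_self_iff.2
    (mem_infGen.1 (Submodule.starProjection_apply_mem _ _) l hl)

/-- The representation `infOp`. -/
def infHom (hκ : X.IsWideSense κ) (hv : IsDilation X κ vec) {k : Finset T}
    (h : LocallySliced X k) : X.𝔄 k →⋆ₙₐ[ℂ] (H →L[ℂ] H) where
  toFun := infOp vec h
  map_smul' := infOp_smul hκ hv h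
  map_zero' := by
    have := infOp_smul hκ hv h 0 0
    rwa [zero_smul, zero_smul] at this
  map_add' := infOp_add hκ hv h
  map_mul' := infOp_mul hκ hv h
  map_star' := infOp_star hκ hv h

open Classical in
/-- The representations with the units `⋀_{l ⊇ k} E_l`. -/
def iotaReg (hκ : X.IsWideSense κ) (hv : IsDilation X κ vec) (k : Finset T) :
    X.𝔄 k →⋆ₙₐ[ℂ] (H →L[ℂ] H) :=
  -- The algebra of `∅` is not assumed to be generated by slice algebras, so `ι_∅` is kept;
  -- `infGen_empty` shows that its unit is nevertheless `⋀ E_l`.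
  if h : k ≠ ∅ ∧ LocallySliced X k then infHom hκ hv h.2 else iotaRep hκ hv k

theorem iotaReg_empty (hκ : X.IsWideSense κ) (hv : IsDilation X κ vec) {k : Finset T}
    (h : k = ∅) : iotaReg hκ hv k = iotaRep hκ hv k :=
  dif_neg fun h' => h'.1 h

theorem iotaReg_apply (hκ : X.IsWideSense κ) (hv : IsDilation X κ vec) {k : Finset T}
    (h0 : k ≠ ∅) (h : LocallySliced X k) (a : X.𝔄 k) :
    iotaReg hκ hv k a = infOp vec h a := by
  rw [iotaReg, dif_pos ⟨h0, h⟩]; rfl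

/-- A vector in every `H_l` is fixed by every `E_l`, hence by the limit `P` of these projections. -/
theorem infGen_empty (hκ : X.IsWideSense κ) (hv : IsDilation X κ vec)
    (h : X.AsymptoticNoncorrelation κ) :
    infGen vec ∅ = gen vec (X.PathsBelow ((∅ : Finset T) : Set T)) := by
  refine le_antisymm (fun x hx => ?_) (le_iInf₂ fun l hl => gen_mono (X.pathsBelow_mono
    (CausalLE.of_subset hl)))
  have h1 : ‖x - iotaRep hκ hv ∅ 1 x‖ ≤ 0 := by
    refine le_of_forall_pos_le_add fun ε hε => ?_
    obtain ⟨l, hl⟩ := tendsto_slice_projection hκ hv h x ε hε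
    have h2 := hl l (CausalLE.of_subset subset_rfl)
    rw [Submodule.starProjection_eq_self_iff.2 (mem_infGen.1 hx l (by simp))] at h2
    rwa [zero_add]
  have h2 : x = iotaRep hκ hv ∅ 1 x := sub_eq_zero.1 (norm_le_zero_iff.1 h1)
  rw [h2]
  exact iotaRep_empty_mem hκ hv _ _

theorem iotaReg_one (hκ : X.IsWideSense κ) (hv : IsDilation X κ vec)
    (h : X.AsymptoticNoncorrelation κ) {k : Finset T} (hs : k ≠ ∅ → LocallySliced X k) :
    iotaReg hκ hv k 1 = (infGen vec k).starProjection := by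
  by_cases h0 : k = ∅
  · subst h0
    rw [iotaReg_empty hκ hv rfl, iotaRep_one hκ hv nonanticipatory_empty]
    simp only [infGen_empty hκ hv h]
  · rw [iotaReg_apply hκ hv h0 (hs h0), infOp_one hκ hv]

theorem iotaReg_apply_vec_unit (hκ : X.IsWideSense κ) (hv : IsDilation X κ vec) {k : Finset T}
    (hk : Nonanticipatory (k : Set T)) (hs : k ≠ ∅ → LocallySliced X k) (a : X.𝔄 k) (ζ : K) :
    iotaReg hκ hv k a (vec X.unit ζ) = vec X.unit ((a : K →L[ℂ] K) ζ) := by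
  by_cases h0 : k = ∅
  · rw [iotaReg_empty hκ hv h0]
    exact (isOpOn_iotaRep hκ hv hk a).on _ (X.unit_mem_pathsBelow _) ζ
  · obtain ⟨l, hl, ha⟩ := hs h0 a a.2
    rw [iotaReg_apply hκ hv h0 (hs h0), infOp_eq hκ hv (hs h0) a hl ha, mul_apply_eq_comp,
      Submodule.starProjection_eq_self_iff.2 (mem_infGen.2 fun l _ =>
        vec_mem_gen (X.unit_mem_pathsBelow _) _)]
    exact (isOpOn_sliceOp hκ hv ha).on _ (X.unit_mem_pathsBelow _) ζ

theorem isRepSystem_iotaReg (hκ : X.IsWideSense κ) (hv : IsDilation X κ vec)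
    (h : X.AsymptoticNoncorrelation κ)
    (hs : ∀ k : Finset T, Nonanticipatory (k : Set T) → k ≠ ∅ → LocallySliced X k) :
    IsRepSystem X (embK hκ hv) (iotaReg hκ hv) where
  faithful k hk a a' haa := by
    refine Subtype.ext (ContinuousLinearMap.ext fun ζ => ?_)
    have h1 := congrArg (fun P : H →L[ℂ] H => P (vec X.unit ζ)) haa
    simp only [iotaReg_apply_vec_unit hκ hv hk (hs k hk)] at h1
    exact (embK hκ hv).injective h1
  consistent k k' hk hk' hkk a ha ha' := by
    by_cases h0 : k = ∅
    · subst h0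
      rw [iotaReg_empty hκ hv rfl]
      refine (isOpOn_iotaRep hκ hv hk _).unique ⟨fun b hb ζ => ?_, fun x hx => ?_⟩
      · rw [mul_apply_eq_comp, (isOpOn_iotaRep hκ hv hk 1).on b hb]
        rw [Finset.coe_empty] at hb
        rw [X.eq_unit_of_mem_pathsBelow_empty hb]
        exact iotaReg_apply_vec_unit hκ hv hk' (hs k' hk') ⟨a, ha'⟩ ζ
      · rw [mul_apply_eq_comp, (isOpOn_iotaRep hκ hv hk 1).off x hx, map_zero]
    · have h0' : k' ≠ ∅ := by
        rintro rfl
        obtain ⟨t, ht⟩ := Finset.nonempty_iff_ne_empty.2 h0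
        obtain ⟨u, hu, -⟩ := hkk t ht
        simp at hu
      -- A slice `l'` serves `a` over `k'`; a slice `l ⊇ k` below it serves `a` over `k`, and the
      -- two operators agree on `H_l`.
      obtain ⟨l', hl', ha2⟩ := hs k' hk' h0' a ha'
      obtain ⟨l, hl, hll⟩ := exists_slice_below hk l' (hkk.trans (CausalLE.of_subset hl'))
      rw [iotaReg_one hκ hv h (hs k hk), iotaReg_apply hκ hv h0 (hs k hk h0),
        iotaReg_apply hκ hv h0' (hs k' hk' h0'),
        infOp_eq hκ hv (hs k hk h0) ⟨a, ha⟩ hl (sliceAlg_anti hll ha2),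
        infOp_eq hκ hv (hs k' hk' h0') ⟨a, ha'⟩ hl' ha2]
      ext x
      have hx := Submodule.starProjection_apply_mem (infGen vec k) x
      simp only [mul_apply_eq_comp]
      rw [Submodule.starProjection_eq_self_iff.2 (infGen_mono hk hkk hx)]
      exact (sliceOp_eq_of_le hκ hv hll ha2 (mem_infGen.1 hx l hl)).symm
  identity a := by
    rw [iotaReg_empty hκ hv rfl]
    exact (isRepSystem hκ hv).identity a

theorem infGen_le_gen_past {k : Finset T}
    (hk : Nonanticipatory (k : Set T)) : infGen vec k ≤ gen vec (X.Past (k : Set T)) := by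
  obtain ⟨l, hl⟩ := exists_slice_superset hk
  exact fun x hx => gen_mono (X.pathsBelow_subset_past l.nonanticipatory hl) (mem_infGen.1 hx l hl)

theorem isHSystem_iotaReg (hκ : X.IsWideSense κ) (hv : IsDilation X κ vec)
    (h : X.AsymptoticNoncorrelation κ)
    (hs : ∀ k : Finset T, Nonanticipatory (k : Set T) → k ≠ ∅ → LocallySliced X k) :
    IsHSystem X (iotaReg hκ hv) (evOp vec) where
  projection := (isHSystem hκ hv).projection
  normalized k hk := by
    rw [evOp_univ hκ hv hk, iotaReg_one hκ hv h (hs k hk)]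
    ext x
    rw [mul_apply_eq_comp]
    exact Submodule.starProjection_eq_self_iff.2
      (infGen_le_gen_past hk (Submodule.starProjection_apply_mem _ _))
  unit_empty := (isHSystem hκ hv).unit_empty
  equiv := (isHSystem hκ hv).equiv
  indep := (isHSystem hκ hv).indep
  sigma_additive := (isHSystem hκ hv).sigma_additive
  commute k hk B hB a := by
    by_cases h0 : k = ∅
    · rw [iotaReg_empty hκ hv h0]
      exact (isHSystem hκ hv).commute k hk B hB a
    · obtain ⟨l, hl, ha⟩ := hs k hk h0 a a.2
      rw [iotaReg_apply hκ hv h0 (hs k hk h0), infOp_eq hκ hv (hs k hk h0) a hl ha]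
      refine Commute.mul_right
        (evOp_commute_algOp hκ hv l.nonanticipatory hl hB (commutesOn_slice hκ l) ha) ?_
      have h1 : ∀ x ∈ infGen vec k, evOp vec k B x ∈ infGen vec k := fun x hx =>
        mem_infGen.2 fun l hl => evOp_mem_gen_below hκ hv l.nonanticipatory hl hB
          (mem_infGen.1 hx l hl)
      refine commute_starProjection h1 fun x hx => ?_
      rw [(evOp_isStarProjection hκ hv hk hB).isSelfAdjoint.star_eq]
      exact h1 x hx

theorem realizes_iotaReg (hκ : X.IsWideSense κ) (hv : IsDilation X κ vec) :
    Realizes X (embK hκ hv) (iotaReg hκ hv) (evOp vec) κ := by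
  have : ∀ Λ b, feynman X (iotaReg hκ hv) (evOp vec) Λ b =
      feynman X (iotaRep hκ hv) (evOp vec) Λ b := fun Λ b => by
    rw [feynman, feynman, iotaReg_empty hκ hv rfl]
  intro Λ b hb b' hb'
  rw [this, this]
  exact realizes hκ hv Λ b hb b' hb'

theorem rangeI_iotaReg (hκ : X.IsWideSense κ) (hv : IsDilation X κ vec)
    (h : X.AsymptoticNoncorrelation κ)
    (hs : ∀ k : Finset T, Nonanticipatory (k : Set T) → k ≠ ∅ → LocallySliced X k)
    {k : Finset T} (hk : Nonanticipatory (k : Set T)) :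
    rangeI X (iotaReg hκ hv) k = ⨅ (l : Slice T) (_ : (k : Set T) ⊆ l.1),
      sliceSpace X (embK hκ hv) (iotaRep hκ hv) (evOp vec) l := by
  rw [rangeI, iotaReg_one hκ hv h (hs k hk), range_starProjection]
  simp only [sliceSpace_eq hκ hv]
  rfl

theorem shift_mem_gen (hκ : X.IsWideSense κ) (hv : IsDilation X κ vec) {s : S}
    (hs : Function.Surjective (clsMap s : Cls T → Cls T)) (l : Slice T) {x : H}
    (hx : x ∈ gen vec (X.PathsBelow (l.preimage s hs).1)) :
    shift hκ hv s x ∈ gen vec (X.PathsBelow l.1) := by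
  have h1 : gen vec (X.PathsBelow (l.preimage s hs).1) ≤
      (gen vec (X.PathsBelow l.1)).comap (shift hκ hv s).toLinearMap := by
    refine gen_le ((isClosed_gen _).preimage (shift hκ hv s).continuous) fun b hb ζ => ?_
    obtain ⟨Λ, b', hb', rfl, hΛ⟩ := exists_pathPull_below s hb
    change shift hκ hv s (vec _ ζ) ∈ gen vec (X.PathsBelow l.1)
    rw [shift_vec hκ hv s hb']
    refine vec_mem_gen (X.mem_pathsBelow_iff.2 ⟨_, fun u hu => ?_, hb'⟩) _
    obtain ⟨t, ht, rfl⟩ := mem_image.1 hu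
    obtain ⟨v, hv, htv⟩ := hΛ t ht
    exact ⟨s • v, hv, smul_le_smul.2 htv⟩
  exact h1 hx

theorem conj_mem_sliceAlg {s : S} (hs : Function.Surjective (clsMap s : Cls T → Cls T))
    {l : Slice T} {a : K →L[ℂ] K} (ha : a ∈ X.sliceAlg l) :
    X.conj s a ∈ X.sliceAlg (l.preimage s hs) := by
  refine mem_sliceAlg.2 fun k hk => ?_
  have h1 : a ∈ X.𝔄 (image s k) := mem_sliceAlg.1 ha _ fun u hu => by
    obtain ⟨t, ht, rfl⟩ := mem_image.1 hu
    exact hk ht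
  have h2 := X.𝔄_image s k ((l.preimage s hs).nonanticipatory.mono hk)
  have h3 : X.conj s a ∈ (X.𝔄 k : Set (K →L[ℂ] K)) := h2 ▸ ⟨a, h1, rfl⟩
  exact h3

/-- Under surjectivity on classes the preimage of a slice `l` is a slice, and `V_s` maps its space
into `H_l`; hence `V_s` maps the intersection over slices `⊇ k` into that over slices `⊇ s k`. The
intertwining relation is then checked on generators below one preimage slice. -/
theorem isCovariant_iotaReg (hκ : X.IsWideSense κ) (hv : IsDilation X κ vec)
    (h : X.AsymptoticNoncorrelation κ)
    (hs : ∀ k : Finset T, Nonanticipatory (k : Set T) → k ≠ ∅ → LocallySliced X k)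
    (hsurj : ∀ s : S, Function.Surjective (clsMap s : Cls T → Cls T)) :
    IsCovariant X (embK hκ hv) (iotaReg hκ hv) (evOp vec) (shift hκ hv) where
  extends_U := (isCovariant hκ hv).extends_U
  process := (isCovariant hκ hv).process
  rep s k hk a ha ha' := by
    by_cases h0 : k = ∅
    · rw [iotaReg_empty hκ hv h0, iotaReg_empty hκ hv (by rw [h0, image_empty])]
      exact (isCovariant hκ hv).rep s k hk a ha ha'
    · have h0' : image s k ≠ ∅ := by
        obtain ⟨t, ht⟩ := Finset.nonempty_iff_ne_empty.2 h0
        exact Finset.ne_empty_of_mem (mem_image.2 ⟨t, ht, rfl⟩)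
      have hk' := hk.image s
      obtain ⟨l, hl, hal⟩ := hs _ hk' h0' a ha
      have hm : (k : Set T) ⊆ (l.preimage s (hsurj s)).1 := fun t ht =>
        hl (mem_image.2 ⟨t, ht, rfl⟩)
      have hc := conj_mem_sliceAlg (hsurj s) hal
      rw [iotaReg_one hκ hv h (hs k hk), iotaReg_apply hκ hv h0 (hs k hk h0),
        iotaReg_apply hκ hv h0' (hs _ hk' h0'),
        infOp_eq hκ hv (hs k hk h0) ⟨_, ha'⟩ hm hc,
        infOp_eq hκ hv (hs _ hk' h0') ⟨a, ha⟩ hl hal]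
      ext x
      have hx := Submodule.starProjection_apply_mem (infGen vec k) x
      set y := (infGen vec k).starProjection x with hy
      have hVy : shift hκ hv s y ∈ infGen vec (image s k) := by
        refine mem_infGen.2 fun l' hl' => shift_mem_gen hκ hv (hsurj s) l'
          (mem_infGen.1 hx _ fun t ht => hl' (mem_image.2 ⟨t, ht, rfl⟩))
      simp only [ContinuousLinearMap.comp_apply, mul_apply_eq_comp, ← hy,
        LinearIsometry.coe_toContinuousLinearMap]
      rw [Submodule.starProjection_eq_self_iff.2 hVy]
      refine gen_eqOn (X.PathsBelow (l.preimage s (hsurj s)).1)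
        (P := (shift hκ hv s).toContinuousLinearMap ∘L
          sliceOp vec (l.preimage s (hsurj s)) (X.conj s a))
        (Q := sliceOp vec l a ∘L (shift hκ hv s).toContinuousLinearMap) (fun b hb ζ => ?_)
        (mem_infGen.1 hx _ hm)
      obtain ⟨Λ, b', hb', rfl, hΛ⟩ := exists_pathPull_below s hb
      have hbl : b' ∈ X.PathsBelow l.1 := X.mem_pathsBelow_iff.2 ⟨_, fun u hu => by
        obtain ⟨t, ht, rfl⟩ := mem_image.1 hu
        obtain ⟨v, hv, htv⟩ := hΛ t ht
        exact ⟨s • v, hv, smul_le_smul.2 htv⟩, hb'⟩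
      simp only [ContinuousLinearMap.comp_apply, (isOpOn_sliceOp hκ hv hc).on _ hb,
        LinearIsometry.coe_toContinuousLinearMap, shift_vec hκ hv s hb', Uop_conj]
      rw [(isOpOn_sliceOp hκ hv hal).on _ hbl]

end Regularity

/-! ### Ultraweakly continuous functionals and bicommutants -/

section Ultraweak

variable {G : Type*} [NormedAddCommGroup G] [InnerProductSpace ℂ G] [CompleteSpace G]
  {H : Type*} [NormedAddCommGroup H] [InnerProductSpace ℂ H] [CompleteSpace H]

/-- The multiple `A ⊗ 1` of an operator on the space of square-summable families. -/
def amp (I : Type*) (A : G →L[ℂ] G) : lp (fun _ : I => G) 2 →L[ℂ] lp (fun _ : I => G) 2 :=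
  lp.mapCLM 2 (fun _ => A) (norm_nonneg A) fun _ => le_rfl

theorem amp_apply {I : Type*} (A : G →L[ℂ] G) (f : lp (fun _ : I => G) 2) (i : I) :
    amp I A f i = A (f i) := rfl

theorem inner_amp {I : Type*} (A : G →L[ℂ] G) (f g : lp (fun _ : I => G) 2) :
    ⟪amp I A f, g⟫_ℂ = ⟪f, amp I (star A) g⟫_ℂ := by
  rw [lp.inner_eq_tsum, lp.inner_eq_tsum]
  refine tsum_congr fun i => ?_
  rw [amp_apply, amp_apply, ContinuousLinearMap.star_eq_adjoint,
    ContinuousLinearMap.adjoint_inner_right]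

theorem star_amp {I : Type*} (A : G →L[ℂ] G) : star (amp I A) = amp I (star A) := by
  ext1 f
  refine ext_inner_left ℂ fun g => ?_
  rw [ContinuousLinearMap.star_eq_adjoint, ContinuousLinearMap.adjoint_inner_right, inner_amp]

theorem amp_mul_apply {I : Type*} (A B : G →L[ℂ] G) (f : lp (fun _ : I => G) 2) :
    amp I (A * B) f = amp I A (amp I B f) := rfl

theorem amp_one_apply {I : Type*} (f : lp (fun _ : I => G) 2) : amp I 1 f = f := rfl

theorem amp_single {I : Type*} [DecidableEq I] (A : G →L[ℂ] G) (i : I) (x : G) :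
    amp I A (lp.single 2 i x) = lp.single 2 i (A x) := by
  ext j
  rw [amp_apply, lp.single_apply, lp.single_apply]
  by_cases h : j = i
  · subst h; simp
  · rw [Pi.single_eq_of_ne h, Pi.single_eq_of_ne h, map_zero]

/-- Two families `p`, `q` of operators with the same multiplication and involution, `p` containing
the identity and `q` correspondingly the projection `E`. -/
structure IsRepPair {J : Type*} (p : J → G →L[ℂ] G) (q : J → H →L[ℂ] H) (E : H →L[ℂ] H) :
    Prop where
  mul : ∀ i j, ∃ k, p k = p i * p j ∧ q k = q i * q j
  star : ∀ i, ∃ j, p j = star (p i) ∧ q j = star (q i)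
  one : ∃ i, p i = 1 ∧ q i = E

variable {J : Type*} {p : J → G →L[ℂ] G} {q : J → H →L[ℂ] H} {E : H →L[ℂ] H}

/-- An operator on `G ⊗ ℓ²` commutes with `B ⊗ 1` if and only if all its matrix entries commute with
`B`; so the amplification of the bicommutant lies in the bicommutant of the amplification. -/
theorem commute_amp {I : Type*} {A : G →L[ℂ] G}
    (hA : ∀ Z : G →L[ℂ] G, (∀ j, Commute Z (p j)) → Commute Z A)
    {Q : lp (fun _ : I => G) 2 →L[ℂ] lp (fun _ : I => G) 2}
    (hQ : ∀ j, Commute Q (amp I (p j))) : Commute Q (amp I A) := by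
  classical
  have hs : ∀ (B : G →L[ℂ] G), Commute Q (amp I B) ↔ ∀ m n, Commute
      (lp.evalCLM ℂ (fun _ : I => G) 2 m ∘L Q ∘L
        lp.singleContinuousLinearMap ℂ (fun _ : I => G) 2 n) B := by
    intro B
    constructor
    · intro h m n
      ext x
      have h1 := congrArg (fun Z : lp (fun _ : I => G) 2 →L[ℂ] lp (fun _ : I => G) 2 =>
        Z (lp.single 2 n x) m) h
      have h2 : (Q * amp I B) (lp.single 2 n x) m = Q (lp.single 2 n (B x)) m := by
        rw [mul_apply_eq_comp, amp_single]
      exact h2.symm.trans h1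
    · intro h
      refine lp.ext_continuousLinearMap (by simp) fun n => ?_
      ext x m
      have h1 := congrArg (fun Z : G →L[ℂ] G => Z x) (h m n)
      have h2 : (Q * amp I B) (lp.single 2 n x) m = Q (lp.single 2 n (B x)) m := by
        rw [mul_apply_eq_comp, amp_single]
      exact h2.trans h1
  exact (hs A).2 fun m n => hA _ fun j => (hs (p j)).1 (hQ j) m n

/-- Von Neumann's argument: the projection onto the closed span of the vectors `(p j ⊗ 1) v`
commutes with the amplified algebra, hence with `A ⊗ 1`. So `(A ⊗ 1) v` stays in that span, to which
`u` is orthogonal. -/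
theorem inner_amp_eq_zero (hpq : IsRepPair p q E) {A : G →L[ℂ] G}
    (hA : ∀ Z : G →L[ℂ] G, (∀ j, Commute Z (p j)) → Commute Z A)
    {I : Type*} {u v : lp (fun _ : I => G) 2} (h : ∀ j, ⟪u, amp I (p j) v⟫_ℂ = 0) :
    ⟪u, amp I A v⟫_ℂ = 0 := by
  set N := (Submodule.span ℂ (Set.range fun j => amp I (p j) v)).topologicalClosure with hN
  have hgen : ∀ j, amp I (p j) v ∈ N := fun j =>
    Submodule.le_topologicalClosure _ (Submodule.subset_span ⟨j, rfl⟩)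
  have hinv : ∀ j, ∀ x ∈ N, amp I (p j) x ∈ N := by
    intro j x hx
    have h1 : N ≤ N.comap (amp I (p j)).toLinearMap := by
      refine Submodule.topologicalClosure_minimal _ (Submodule.span_le.2 ?_)
        ((Submodule.isClosed_topologicalClosure _).preimage (amp I (p j)).continuous)
      rintro _ ⟨i, rfl⟩
      obtain ⟨k, hk, -⟩ := hpq.mul j i
      change amp I (p j) (amp I (p i) v) ∈ N
      rw [← amp_mul_apply, ← hk]
      exact hgen k
    exact h1 hx
  have hQ : ∀ j, Commute N.starProjection (amp I (p j)) := fun j =>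
    (commute_starProjection (hinv j) fun x hx => by
      obtain ⟨i, hi, -⟩ := hpq.star j
      rw [star_amp, ← hi]
      exact hinv i x hx).symm
  have hv : v ∈ N := by
    obtain ⟨i, hi, -⟩ := hpq.one
    have := hgen i
    rwa [hi, amp_one_apply] at this
  have hAv : amp I A v ∈ N := by
    have h1 := congrArg (fun Z : lp (fun _ : I => G) 2 →L[ℂ] lp (fun _ : I => G) 2 => Z v)
      (commute_amp hA hQ).eq
    simp only [mul_apply_eq_comp, Submodule.starProjection_eq_self_iff.2 hv] at h1
    exact Submodule.starProjection_eq_self_iff.1 h1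
  have hu : N ≤ (Submodule.span ℂ {u})ᗮ := by
    refine Submodule.topologicalClosure_minimal _ (Submodule.span_le.2 ?_)
      (Submodule.isClosed_orthogonal _)
    rintro _ ⟨j, rfl⟩
    exact Submodule.mem_orthogonal_singleton_iff_inner_right.2 (h j)
  exact Submodule.mem_orthogonal_singleton_iff_inner_right.1 (hu hAv)

theorem memℓp_two {I : Type*} {f : I → G} (h : Summable fun i => ‖f i‖ ^ 2) :
    Memℓp (E := fun _ : I => G) f 2 := by
  refine memℓp_gen ?_
  simpa using h

theorem summable_sq {I : Type*} (f : lp (fun _ : I => G) 2) : Summable fun i => ‖f i‖ ^ 2 := by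
  simpa using (lp.memℓp f).summable (by simp)

theorem exists_sumElim {I I' : Type*} (f : lp (fun _ : I => G) 2) (f' : lp (fun _ : I' => G) 2) :
    ∃ g : lp (fun _ : I ⊕ I' => G) 2, ∀ i, g i = Sum.elim (fun i => f i) (fun i => f' i) i := by
  refine ⟨⟨Sum.elim (fun i => f i) (fun i => f' i), memℓp_two ?_⟩, fun i => rfl⟩
  exact ((summable_sq f).hasSum.sum (summable_sq f').hasSum
    (f := fun i => ‖Sum.elim (fun i => f i) (fun i => f' i) i‖ ^ 2)).summable

/-- Ultraweakly continuous functionals that agree on a unital `*`-algebra agree on its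
bicommutant. -/
theorem inner_amp_eq (hpq : IsRepPair p q E) {A : G →L[ℂ] G}
    (hA : ∀ Z : G →L[ℂ] G, (∀ j, Commute Z (p j)) → Commute Z A)
    {I I' : Type*} {u v : lp (fun _ : I => G) 2} {u' v' : lp (fun _ : I' => G) 2}
    (h : ∀ j, ⟪u, amp I (p j) v⟫_ℂ = ⟪u', amp I' (p j) v'⟫_ℂ) :
    ⟪u, amp I A v⟫_ℂ = ⟪u', amp I' A v'⟫_ℂ := by
  -- The difference of two such functionals is again one, on the direct sum of the two
  -- amplifications.
  obtain ⟨U, hU⟩ := exists_sumElim u (-u')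
  obtain ⟨V, hV⟩ := exists_sumElim v v'
  have key : ∀ B : G →L[ℂ] G,
      ⟪U, amp (I ⊕ I') B V⟫_ℂ = ⟪u, amp I B v⟫_ℂ - ⟪u', amp I' B v'⟫_ℂ := by
    intro B
    rw [sub_eq_add_neg, ← inner_neg_left]
    refine (lp.hasSum_inner U (amp (I ⊕ I') B V)).unique ?_
    refine HasSum.sum ?_ ?_
    · refine (lp.hasSum_inner u (amp I B v)).congr_fun fun i => ?_
      simp only [Function.comp_apply, amp_apply, hU, hV, Sum.elim_inl]
    · refine (lp.hasSum_inner (-u') (amp I' B v')).congr_fun fun i => ?_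
      simp only [Function.comp_apply, amp_apply, hU, hV, Sum.elim_inr]
  have h1 := inner_amp_eq_zero hpq hA (u := U) (v := V) fun j => by rw [key, h, sub_self]
  rwa [key, sub_eq_zero] at h1

theorem re_inner_le_norm_half_sq (u v : H) :
    (⟪u, v⟫_ℂ).re ≤ ‖(1 / 2 : ℂ) • (u + v)‖ ^ 2 := by
  have h1 : ‖u + v‖ ^ 2 = ‖u‖ ^ 2 + 2 * (⟪u, v⟫_ℂ).re + ‖v‖ ^ 2 := norm_add_sq (𝕜 := ℂ) u v
  have h2 : ‖u - v‖ ^ 2 = ‖u‖ ^ 2 - 2 * (⟪u, v⟫_ℂ).re + ‖v‖ ^ 2 := norm_sub_sq (𝕜 := ℂ) u v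
  rw [norm_smul, mul_pow, h1]
  norm_num
  nlinarith [sq_nonneg ‖u - v‖]

/-- The positive functional `⟪x, q · x⟫ = ⟪ξ, p · η⟫` is dominated by the vector functional of `χ =
(ξ + η) / 2`, by polarization (`re_inner_le_norm_half_sq`). Hence `p j χ ↦ q j x` is a well defined
contraction. -/
theorem exists_intertwiner (hpq : IsRepPair p q E) {I : Type*} {x : H}
    {ξ η : lp (fun _ : I => G) 2} (h : ∀ j, ⟪x, q j x⟫_ℂ = ⟪ξ, amp I (p j) η⟫_ℂ) :
    ∃ (χ : lp (fun _ : I => G) 2) (W : lp (fun _ : I => G) 2 →L[ℂ] H),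
      (∀ j, W (amp I (p j) χ) = q j x) ∧ ∀ f, E (W f) = W f := by
  have hinner : ∀ i j, ⟪q i x, q j x⟫_ℂ = ⟪amp I (p i) ξ, amp I (p j) η⟫_ℂ := by
    intro i j
    obtain ⟨i', hp', hq'⟩ := hpq.star i
    obtain ⟨k, hk, hk'⟩ := hpq.mul i' j
    rw [inner_amp, ← amp_mul_apply, ← hp', ← hk, ← h k, hk', hq', mul_apply_eq_comp,
      ContinuousLinearMap.star_eq_adjoint, ContinuousLinearMap.adjoint_inner_right]
  set χ := (1 / 2 : ℂ) • (ξ + η) with hχ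
  obtain ⟨W, hW, hoff⟩ := exists_clm_of_bound (fun j => amp I (p j) χ) (fun j => q j x) 1 (by
    intro c
    have h1 := inner_linearCombination hinner c c
    have h2 : Finsupp.linearCombination ℂ (fun j => amp I (p j) χ) c = (1 / 2 : ℂ) •
        (Finsupp.linearCombination ℂ (fun j => amp I (p j) ξ) c +
          Finsupp.linearCombination ℂ (fun j => amp I (p j) η) c) := by
      simp only [Finsupp.linearCombination_apply, Finsupp.sum, ← Finset.sum_add_distrib,
        Finset.smul_sum, hχ, map_smul, map_add, smul_add]
      refine Finset.sum_congr rfl fun j _ => ?_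
      rw [smul_comm, smul_comm (c j)]
    have h3 := re_inner_le_norm_half_sq (Finsupp.linearCombination ℂ (fun j => amp I (p j) ξ) c)
      (Finsupp.linearCombination ℂ (fun j => amp I (p j) η) c)
    rw [← h1, ← h2] at h3
    have h4 := inner_self_eq_norm_sq (𝕜 := ℂ) (Finsupp.linearCombination ℂ (fun j => q j x) c)
    rw [one_mul]
    replace h3 := h4.symm.trans_le h3
    exact abs_le_of_sq_le_sq' h3 (norm_nonneg _) |>.2)
  refine ⟨χ, W, hW, fun f => ?_⟩
  have : E ∘L W = W := by
    refine clm_ext_of_span (s := Set.range fun j => amp I (p j) χ) ?_ fun f hf => ?_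
    · rintro _ ⟨j, rfl⟩
      obtain ⟨i, hi, hi'⟩ := hpq.one
      obtain ⟨k, hk, hk'⟩ := hpq.mul i j
      rw [ContinuousLinearMap.comp_apply]
      have h1 : amp I (p k) χ = amp I (p j) χ := by rw [hk, hi, one_mul]
      -- The index `k` with `p k = p j` may differ from `j`; the values at `x` agree because `W` is
      -- well defined.
      have h2 : q k x = q j x := by rw [← hW, ← hW, h1]
      rw [hW, ← hi', ← mul_apply_eq_comp, ← hk', h2]
    · rw [ContinuousLinearMap.comp_apply, hoff f hf, map_zero]
  exact congrArg (fun Z : lp (fun _ : I => G) 2 →L[ℂ] H => Z f) this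

/-- If the matrix elements of `q` and `X` are given by ultraweakly continuous functionals of `p`
and of an element `A` of the bicommutant of `p`, then `X` belongs to the bicommutant of `q`. -/
theorem commute_of_ultraweak (hpq : IsRepPair p q E) {A : G →L[ℂ] G} (hAs : star A = A)
    (hA : ∀ Z : G →L[ℂ] G, (∀ j, Commute Z (p j)) → Commute Z A) {Φ : H →L[ℂ] H}
    (hΦs : star Φ = Φ) (hEΦ : E * Φ = Φ) (hΦE : Φ * E = Φ) {D : Set H}
    (hD : ∀ x, E x ∈ (Submodule.span ℂ D).topologicalClosure)
    (hω : ∀ y ∈ D, ∀ x ∈ D, ∃ ξ η : lp (fun _ : ℕ => G) 2,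
      (∀ j, ⟪y, q j x⟫_ℂ = ⟪ξ, amp ℕ (p j) η⟫_ℂ) ∧ ⟪y, Φ x⟫_ℂ = ⟪ξ, amp ℕ A η⟫_ℂ)
    {Y : H →L[ℂ] H} (hY : ∀ j, Commute Y (q j)) : Commute Y Φ := by
  -- `Φ x` is the image of `(A ⊗ 1) χ` under the intertwiner: both have the same inner products with
  -- `D`, as the functionals compared there agree on the `p j` and hence at `A`.
  have hW : ∀ x ∈ D, ∃ (χ : lp (fun _ : ℕ => G) 2) (W : lp (fun _ : ℕ => G) 2 →L[ℂ] H),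
      (∀ j, W (amp ℕ (p j) χ) = q j x) ∧ Φ x = W (amp ℕ A χ) := by
    intro x hx
    obtain ⟨ξ, η, h1, -⟩ := hω x hx x hx
    obtain ⟨χ, W, hW, hE⟩ := exists_intertwiner hpq h1
    refine ⟨χ, W, hW, eq_of_inner_generators (s := D) ?_ ?_ fun y hy => ?_⟩
    · rw [← hEΦ]; exact hD _
    · rw [← hE]; exact hD _
    · obtain ⟨ξ', η', h2, h3⟩ := hω y hy x hx
      rw [h3, ← ContinuousLinearMap.adjoint_inner_left W]
      refine inner_amp_eq hpq hA fun j => ?_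
      rw [← h2, ContinuousLinearMap.adjoint_inner_left, hW]
  have hΦinner : ∀ y z : H, ⟪Φ y, z⟫_ℂ = ⟪y, Φ z⟫_ℂ := fun y z => by
    rw [← ContinuousLinearMap.adjoint_inner_right, ← ContinuousLinearMap.star_eq_adjoint, hΦs]
  -- Intertwiners for `x` and for `y` turn both sides into ultraweak functionals evaluated at `A`.
  -- At `p j` they are `⟪y, Y q_j x⟫` and `⟪y, q_j Y x⟫`, equal since `Y` commutes with `q j`.
  have hkey : ∀ y ∈ D, ∀ x ∈ D, ⟪y, Y (Φ x)⟫_ℂ = ⟪y, Φ (Y x)⟫_ℂ := by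
    intro y hy x hx
    obtain ⟨χ, W, hW1, hW2⟩ := hW x hx
    obtain ⟨χ', W', hW1', hW2'⟩ := hW y hy
    have h1 : ⟪y, Y (Φ x)⟫_ℂ =
        ⟪ContinuousLinearMap.adjoint W (ContinuousLinearMap.adjoint Y y), amp ℕ A χ⟫_ℂ := by
      rw [ContinuousLinearMap.adjoint_inner_left, ContinuousLinearMap.adjoint_inner_left, hW2]
    have h2 : ⟪y, Φ (Y x)⟫_ℂ = ⟪χ', amp ℕ A (ContinuousLinearMap.adjoint W' (Y x))⟫_ℂ := by
      rw [← hΦinner, hW2', ← ContinuousLinearMap.adjoint_inner_right, inner_amp, hAs]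
    rw [h1, h2]
    refine inner_amp_eq hpq hA fun j => ?_
    obtain ⟨i, hi, hi'⟩ := hpq.star j
    rw [ContinuousLinearMap.adjoint_inner_left, ContinuousLinearMap.adjoint_inner_left, hW1,
      ← star_star (p j), ← inner_amp, ← hi, ContinuousLinearMap.adjoint_inner_right, hW1', hi',
      ContinuousLinearMap.star_eq_adjoint, ContinuousLinearMap.adjoint_inner_left]
    exact congrArg (fun Z : H →L[ℂ] H => ⟪y, Z x⟫_ℂ) (hY j).eq
  have hYE : Commute Y E := by
    obtain ⟨i, -, hi⟩ := hpq.one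
    exact hi ▸ hY i
  have h1 : ∀ x, E (Y (Φ x)) = Y (Φ x) := fun x => by
    have := congrArg (fun Z : H →L[ℂ] H => (Z * Φ) x) hYE.eq
    simp only [mul_assoc, hEΦ] at this
    exact this.symm
  have h2 : ∀ x, E (Φ (Y x)) = Φ (Y x) := fun x => congrArg (fun Z : H →L[ℂ] H => Z (Y x)) hEΦ
  have h3 : ∀ x ∈ D, (Y * Φ) x = (Φ * Y) x := fun x hx =>
    eq_of_inner_generators (s := D) ((h1 x) ▸ hD _) ((h2 x) ▸ hD _) fun y hy => hkey y hy x hx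
  have h4 : (Submodule.span ℂ D).topologicalClosure ≤
      LinearMap.eqLocus (Y * Φ).toLinearMap (Φ * Y).toLinearMap :=
    Submodule.topologicalClosure_minimal _ (Submodule.span_le.2 h3)
      (isClosed_eq (Y * Φ).continuous (Φ * Y).continuous)
  have h5 : (Y * Φ) * E = (Φ * Y) * E := by
    ext x
    exact h4 (hD x)
  rw [mul_assoc, hΦE, mul_assoc, hYE.eq, ← mul_assoc, hΦE] at h5
  exact h5

end Ultraweak

/-! ### Regressions -/

section Order

variable {G : Type*} [NormedAddCommGroup G] [InnerProductSpace ℂ G] [CompleteSpace G]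

theorem mul_nonneg_of_isStarProjection {e x : G →L[ℂ] G} (he : IsStarProjection e)
    (hc : Commute e x) (hx : 0 ≤ x) : 0 ≤ e * x := by
  have h := star_left_conjugate_nonneg hx e
  rwa [he.isSelfAdjoint.star_eq, hc.eq, mul_assoc, he.isIdempotentElem.eq, ← hc.eq] at h

/-- Decompose `e' y - e x = e' (y - x) + (e' - e) x`; each term is a projection times a commuting
positive operator. -/
theorem mul_le_mul_of_isStarProjection {e e' x y : G →L[ℂ] G} (he : IsStarProjection e)
    (he' : IsStarProjection e') (hee : e * e' = e) (hcx : Commute e x) (hcx' : Commute e' x)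
    (hcy : Commute e' y) (hx : 0 ≤ x) (hxy : x ≤ y) : e * x ≤ e' * y := by
  have h1 : 0 ≤ e' * (y - x) := mul_nonneg_of_isStarProjection he' (hcy.sub_right hcx')
    (sub_nonneg.2 hxy)
  have h2 : 0 ≤ (e' - e) * x := mul_nonneg_of_isStarProjection
    (he.sub_of_mul_eq_left he' hee) (hcx'.sub_left hcx) hx
  have h3 := add_nonneg h1 h2
  rw [mul_sub, sub_mul, sub_add_sub_cancel] at h3
  exact sub_nonneg.1 h3

theorem nonneg_of_isStarProjection {e : G →L[ℂ] G} (he : IsStarProjection e) : 0 ≤ e :=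
  (ContinuousLinearMap.nonneg_iff_isPositive e).2 (.of_isStarProjection he)

theorem le_one_of_isStarProjection {e : G →L[ℂ] G} (he : IsStarProjection e) : e ≤ 1 :=
  sub_nonneg.1 (nonneg_of_isStarProjection he.one_sub)

theorem isStarProjection_sum {e : ℕ → G →L[ℂ] G} (he : ∀ m, IsStarProjection (e m))
    (h : Pairwise fun m m' => e m * e m' = 0) (F : Finset ℕ) :
    IsStarProjection (∑ m ∈ F, e m) := by
  classical
  induction F using Finset.induction_on with
  | empty => simp
  | insert m F hm ih =>
    rw [Finset.sum_insert hm]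
    refine (he m).add ih ?_
    rw [Finset.mul_sum]
    exact Finset.sum_eq_zero fun m' hm' => h fun h => hm (h ▸ hm')

theorem re_inner_le_of_le {A B : G →L[ℂ] G} (h : A ≤ B) (ζ : G) :
    (⟪ζ, A ζ⟫_ℂ).re ≤ (⟪ζ, B ζ⟫_ℂ).re := by
  have h1 := ((ContinuousLinearMap.le_def A B).1 h).inner_nonneg_right ζ
  rw [sub_apply, inner_sub_right, sub_nonneg] at h1
  exact (Complex.le_def.1 h1).1

theorem eq_of_le_of_re_inner {A B : G →L[ℂ] G} (h : A ≤ B)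
    (h' : ∀ ζ, (⟪ζ, A ζ⟫_ℂ).re = (⟪ζ, B ζ⟫_ℂ).re) : A = B := by
  have h1 := (inner_map_self_eq_zero (B - A).toLinearMap).1 fun ζ => by
    have h2 := ((ContinuousLinearMap.le_def A B).1 h).inner_nonneg_left ζ
    refine Complex.ext ?_ (Complex.le_def.1 h2).2.symm
    rw [← inner_conj_symm, Complex.conj_re]
    change (⟪ζ, (B - A) ζ⟫_ℂ).re = 0
    rw [sub_apply, inner_sub_right, Complex.sub_re, h', sub_self]
  have h3 : B - A = 0 := by
    ext ζ
    exact congrArg (fun L : G →ₗ[ℂ] G => L ζ) h1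
  exact (sub_eq_zero.1 h3).symm

theorem eq_of_hasSum_of_le {a c : ℕ → ℝ} {s : ℝ} (hac : ∀ m, a m ≤ c m) (ha : HasSum a s)
    (hc : ∀ F : Finset ℕ, ∑ m ∈ F, c m ≤ s) (m : ℕ) : a m = c m := by
  classical
  refine le_antisymm (hac m) ?_
  have h1 : ∀ᶠ F : Finset ℕ in Filter.atTop, ∑ i ∈ F, a i ≤ s - (c m - a m) := by
    filter_upwards [Filter.eventually_ge_atTop {m}] with F hF
    have hm : m ∈ F := hF (Finset.mem_singleton_self m)
    have h2 := hc F
    have h3 : c m - a m ≤ ∑ i ∈ F, (c i - a i) :=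
      Finset.single_le_sum (f := fun i => c i - a i) (fun i _ => sub_nonneg.2 (hac i)) hm
    rw [Finset.sum_sub_distrib] at h3
    linarith
  have ha' := ha
  rw [HasSum, SummationFilter.unconditional_filter] at ha'
  have := le_of_tendsto ha' h1
  linarith

end Order

/-! ### Regression formulas as positive functionals on the algebra of a slice -/

section States

variable {S : Type uS} {T : Type uT} {K : Type uK} [Semigroup S] [Preorder T] [CausalAction S T]
  [NormedAddCommGroup K] [InnerProductSpace ℂ K] [CompleteSpace K]
  {X : Setting.{uS, uT, uE, uK} S T K}
  {κ : (Cls T → Set X.Ω) → (Cls T → Set X.Ω) → K →L[ℂ] K}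
  {H : Type uH} [NormedAddCommGroup H] [InnerProductSpace ℂ H] [CompleteSpace H]
  {vec : (Cls T → Set X.Ω) → K →L[ℂ] H}

theorem box_mem_sliceEvents {b : Cls T → Set X.Ω} (hb : b ∈ X.Paths) (l : Slice T) :
    X.box b l.1 ∈ X.sliceEvents l := by
  obtain ⟨k, hk, hbk, hbox, -⟩ := X.exists_pathsOn_slice hb l
  exact ⟨k, hk, hbox ▸ X.box_mem_events k (l.nonanticipatory.mono hk) _ hbk⟩

theorem box_eq_slice {k : Finset T} {l : Slice T} (hk : (k : Set T) ⊆ l.1)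
    {β : Cls T → Set X.Ω} (hβ : β ∈ X.PathsOn k) : X.box β (k : Set T) = X.box β l.1 :=
  X.box_eq_of_subset (Set.image_mono hk) fun c _ hc => (hβ c).2 hc

/-- A chain of slices below `l` that covers the support of `b`. -/
theorem exists_chain_covering {l : Slice T} {b : Cls T → Set X.Ω} (hb : b ∈ X.PathsBelow l.1) :
    ∃ ms : List (Slice T), (l :: ms).IsChain (fun m m' => CausalLE m'.1 m.1) ∧
      ∀ c, (∀ m ∈ ms, c ∉ clsOf m.1) → b c = Set.univ := by
  obtain ⟨Λ, hΛ, hbΛ⟩ := X.mem_pathsBelow_iff.1 hb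
  obtain ⟨ms, hms, hcov⟩ := exists_slice_chain Λ l hΛ
  refine ⟨ms, hms, fun c hc => (hbΛ c).2 ?_⟩
  rintro ⟨t, ht, rfl⟩
  obtain ⟨m, hm, htm⟩ := hcov t ht
  exact hc m hm ⟨t, htm, rfl⟩

variable {R : SliceReps.{uS, uT, uE, uK, uG} X}

namespace SliceReps

theorem coe_event {l : Slice T} {B : Set X.Ω} (hB : B ∈ X.sliceEvents l) :
    (R.event l B : R.G l →L[ℂ] R.G l) = R.π l B := by
  rw [event, dif_pos hB]

/-- The partition into the whole space and countably many empty sets has a convergent sum, so its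
constant tail vanishes. -/
theorem π_empty (l : Slice T) : R.π l ∅ = 0 := by
  classical
  ext x
  have h := R.sigma_additive l ∅ (by simp) (fun m => if m = 0 then Set.univ else ∅)
    (fun m => by
      split_ifs
      · exact X.univ_mem_events ∅ nonanticipatory_empty
      · exact (X.semiring ∅ nonanticipatory_empty).empty_mem)
    (fun m m' hmm => by
      change Disjoint (if m = 0 then Set.univ else ∅) (if m' = 0 then Set.univ else ∅)
      by_cases h : m = 0
      · rw [if_neg (show m' ≠ 0 from fun h' => hmm (h.trans h'.symm))]; exact disjoint_bot_right
      · rw [if_neg h]; exact disjoint_bot_left)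
    (Set.eq_univ_of_forall fun y => Set.mem_iUnion.2 ⟨0, by simp⟩) x
  have h1 := h.summable.tendsto_atTop_zero
  have h2 : Filter.Tendsto (fun m : ℕ => R.π l (if m = 0 then Set.univ else ∅) x) Filter.atTop
      (nhds (R.π l ∅ x)) := by
    refine tendsto_const_nhds.congr' ?_
    filter_upwards [Filter.eventually_ge_atTop 1] with m hm
    rw [if_neg (by omega)]
  exact tendsto_nhds_unique h2 h1

theorem isStarProjection_event {l : Slice T} {B : Set X.Ω} (hB : B ∈ X.sliceEvents l) :
    IsStarProjection (R.event l B : R.G l →L[ℂ] R.G l) := by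
  rw [coe_event hB]; exact R.projection l B hB

/-- The events are central in the algebra of the slice. -/
theorem commute_event {l : Slice T} {B : Set X.Ω} (hB : B ∈ X.sliceEvents l) (A : R.alg l) :
    Commute (R.event l B : R.G l →L[ℂ] R.G l) (A : R.G l →L[ℂ] R.G l) := by
  have h1 : R.π l B ∈ StarSubalgebra.centralizer ℂ (R.gens l) := by
    have key : ∀ B' ∈ X.sliceEvents l, R.π l B' * R.π l B = R.π l B * R.π l B' := by
      intro B' hB'
      rw [← R.multiplicative l B' hB' B hB, ← R.multiplicative l B hB B' hB', Set.inter_comm]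
    rw [StarSubalgebra.mem_centralizer_iff]
    rintro _ (⟨B', hB', rfl⟩ | ⟨a, rfl⟩)
    · rw [(R.projection l B' hB').isSelfAdjoint.star_eq]
      exact ⟨key B' hB', key B' hB'⟩
    · rw [← map_star]
      exact ⟨(R.commute l B hB a).symm, (R.commute l B hB (star a)).symm⟩
  rw [coe_event hB]
  exact ((StarSubalgebra.mem_centralizer_iff ℂ).1 A.2 _ h1).1

theorem inter_mem_sliceEvents {l : Slice T} {B B' : Set X.Ω} (hB : B ∈ X.sliceEvents l)
    (hB' : B' ∈ X.sliceEvents l) : B ∩ B' ∈ X.sliceEvents l := by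
  obtain ⟨k, hk, hB⟩ := hB
  obtain ⟨k', hk', hB'⟩ := hB'
  rcases events_cases (l.nonanticipatory.mono hk) hB with rfl | ⟨β, hβ, rfl⟩
  · rw [Set.empty_inter]; exact ⟨k, hk, hB⟩
  rcases events_cases (l.nonanticipatory.mono hk') hB' with rfl | ⟨β', hβ', rfl⟩
  · rw [Set.inter_empty]; exact ⟨k', hk', hB'⟩
  rw [box_eq_slice hk hβ, box_eq_slice hk' hβ', ← X.box_inter]
  exact box_mem_sliceEvents (X.paths_inter (X.pathsOn_subset_paths _ hβ)
    (X.pathsOn_subset_paths _ hβ')) l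

theorem event_inter {l : Slice T} {B B' : Set X.Ω} (hB : B ∈ X.sliceEvents l)
    (hB' : B' ∈ X.sliceEvents l) : R.event l (B ∩ B') = R.event l B * R.event l B' := by
  refine Subtype.ext ?_
  rw [MulMemClass.coe_mul, coe_event hB, coe_event hB', coe_event (inter_mem_sliceEvents hB hB')]
  exact R.multiplicative l B hB B' hB'

theorem univ_mem_sliceEvents (l : Slice T) : Set.univ ∈ X.sliceEvents l :=
  ⟨∅, by simp, X.univ_mem_events ∅ nonanticipatory_empty⟩

theorem empty_mem_sliceEvents (l : Slice T) : ∅ ∈ X.sliceEvents l :=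
  ⟨∅, by simp, (X.semiring ∅ nonanticipatory_empty).empty_mem⟩

theorem event_univ (l : Slice T) : R.event l Set.univ = 1 := by
  refine Subtype.ext ?_
  rw [coe_event (univ_mem_sliceEvents l), R.unital]; rfl

theorem event_nonneg {l : Slice T} {B : Set X.Ω} (hB : B ∈ X.sliceEvents l) :
    0 ≤ (R.event l B : R.G l →L[ℂ] R.G l) :=
  nonneg_of_isStarProjection (isStarProjection_event hB)

theorem isStarProjection_sum_event {l : Slice T} {f : ℕ → Set X.Ω}
    (hf : ∀ m, f m ∈ X.sliceEvents l) (hd : Pairwise fun m m' => Disjoint (f m) (f m'))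
    (F : Finset ℕ) :
    IsStarProjection ((∑ m ∈ F, R.event l (f m) : R.alg l) : R.G l →L[ℂ] R.G l) := by
  rw [AddSubmonoidClass.coe_finsetSum]
  refine isStarProjection_sum (fun m => isStarProjection_event (hf m)) (fun m m' hmm => ?_) F
  change (R.event l (f m) : R.G l →L[ℂ] R.G l) * (R.event l (f m') : R.G l →L[ℂ] R.G l) = 0
  have h1 : Disjoint (f m) (f m') := hd hmm
  rw [← MulMemClass.coe_mul, ← event_inter (hf m) (hf m'), h1.inter_eq,
    coe_event (empty_mem_sliceEvents l), π_empty]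

variable {ρ : ∀ l : Slice T, R.alg l →ₗ[ℂ] (K →L[ℂ] K)}
  {θ : ∀ l l' : Slice T, R.alg l' →ₗ[ℂ] R.alg l}

/-- The linear map `A ↦ ρ_{m_1}(π(b(m_1)) θ(⋯ θ(π(b(l)) A) ⋯ ))` for a descending chain
`l ≥ m_n ≥ ⋯ ≥ m_1` of slices. -/
def state (ρ : ∀ l : Slice T, R.alg l →ₗ[ℂ] (K →L[ℂ] K))
    (θ : ∀ l l' : Slice T, R.alg l' →ₗ[ℂ] R.alg l) (b : Cls T → Set X.Ω) :
    (l : Slice T) → List (Slice T) → R.alg l →ₗ[ℂ] (K →L[ℂ] K)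
  | l, [] => ρ l ∘ₗ LinearMap.mulLeft ℂ (R.event l (X.box b l.1))
  | l, m :: ms => state ρ θ b m ms ∘ₗ θ m l ∘ₗ LinearMap.mulLeft ℂ (R.event l (X.box b l.1))

theorem state_nil (b : Cls T → Set X.Ω) (l : Slice T) (A : R.alg l) :
    state ρ θ b l [] A = ρ l (R.event l (X.box b l.1) * A) := rfl

theorem state_cons (b : Cls T → Set X.Ω) (l m : Slice T) (ms : List (Slice T)) (A : R.alg l) :
    state ρ θ b l (m :: ms) A = state ρ θ b m ms (θ m l (R.event l (X.box b l.1) * A)) := rfl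

namespace IsRegression

variable (hR : R.IsRegression κ ρ θ)
include hR

theorem ρ_mono {l : Slice T} {A A' : R.alg l}
    (h : (A : R.G l →L[ℂ] R.G l) ≤ (A' : R.G l →L[ℂ] R.G l)) : ρ l A ≤ ρ l A' := by
  have h1 := (hR.normal_ρ l).positive (A' - A)
    ((ContinuousLinearMap.le_def _ _).1 h)
  rw [map_sub] at h1
  exact (ContinuousLinearMap.le_def _ _).2 h1

theorem θ_mono {l l' : Slice T} (hl : CausalLE l.1 l'.1) {A A' : R.alg l'}
    (h : (A : R.G l' →L[ℂ] R.G l') ≤ (A' : R.G l' →L[ℂ] R.G l')) :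
    (θ l l' A : R.G l →L[ℂ] R.G l) ≤ (θ l l' A' : R.G l →L[ℂ] R.G l) := by
  have h1 := (hR.normal_θ l l' hl).positive (A' - A)
    ((ContinuousLinearMap.le_def _ _).1 h)
  rw [map_sub] at h1
  exact (ContinuousLinearMap.le_def _ _).2 h1

theorem θ_nonneg {l l' : Slice T} (hl : CausalLE l.1 l'.1) {A : R.alg l'}
    (h : 0 ≤ (A : R.G l' →L[ℂ] R.G l')) : 0 ≤ (θ l l' A : R.G l →L[ℂ] R.G l) := by
  have h1 := hR.θ_mono hl (A := 0) (A' := A) h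
  rwa [map_zero] at h1

/-- The hypotheses concern the products with the event on `l`, because only these enter the
recursion. Positivity of the smaller product is needed when a larger central projection replaces a
smaller one on the next slice. -/
theorem state_le (ms : List (Slice T)) : ∀ {l : Slice T},
    (l :: ms).IsChain (fun m m' => CausalLE m'.1 m.1) → ∀ {b b' : Cls T → Set X.Ω},
    b ∈ X.Paths → b' ∈ X.Paths → b ≤ b' → ∀ {A A' : R.alg l},
    0 ≤ ((R.event l (X.box b l.1) * A : R.alg l) : R.G l →L[ℂ] R.G l) →
    ((R.event l (X.box b l.1) * A : R.alg l) : R.G l →L[ℂ] R.G l) ≤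
      ((R.event l (X.box b' l.1) * A' : R.alg l) : R.G l →L[ℂ] R.G l) →
    state ρ θ b l ms A ≤ state ρ θ b' l ms A' := by
  induction ms with
  | nil =>
    intro l _ b b' _ _ _ A A' _ h
    exact hR.ρ_mono h
  | cons m ms ih =>
    intro l hch b b' hb hb' hbb A A' h0 h
    rw [List.isChain_cons_cons] at hch
    rw [state_cons, state_cons]
    have hBe := box_mem_sliceEvents hb m
    have hBe' := box_mem_sliceEvents hb' m
    have h1 := hR.θ_nonneg hch.1 h0
    have h2 := hR.θ_mono hch.1 h
    refine ih hch.2 hb hb' hbb ?_ ?_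
    · exact mul_nonneg_of_isStarProjection (isStarProjection_event hBe) (commute_event hBe _) h1
    · refine mul_le_mul_of_isStarProjection (isStarProjection_event hBe)
        (isStarProjection_event hBe') ?_ (commute_event hBe _) (commute_event hBe' _)
        (commute_event hBe' _) h1 h2
      rw [← MulMemClass.coe_mul, ← event_inter hBe hBe', Set.inter_eq_left.2]
      exact Set.iInter₂_mono fun c _ => hbb c

theorem state_nonneg {ms : List (Slice T)} {l : Slice T}
    (hch : (l :: ms).IsChain (fun m m' => CausalLE m'.1 m.1)) {b : Cls T → Set X.Ω}
    (hb : b ∈ X.Paths) {A : R.alg l} (h : 0 ≤ (A : R.G l →L[ℂ] R.G l)) :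
    0 ≤ state ρ θ b l ms A := by
  have hBe := box_mem_sliceEvents hb l
  have h1 := hR.state_le ms hch hb hb le_rfl (A := 0) (A' := A) (by rw [mul_zero]; rfl) (by
    rw [mul_zero]
    exact mul_nonneg_of_isStarProjection (isStarProjection_event hBe) (commute_event hBe _) h)
  rwa [map_zero] at h1

theorem state_mono {ms : List (Slice T)} {l : Slice T}
    (hch : (l :: ms).IsChain (fun m m' => CausalLE m'.1 m.1)) {b : Cls T → Set X.Ω}
    (hb : b ∈ X.Paths) {A A' : R.alg l}
    (h : (A : R.G l →L[ℂ] R.G l) ≤ (A' : R.G l →L[ℂ] R.G l)) :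
    state ρ θ b l ms A ≤ state ρ θ b l ms A' := by
  have h1 := hR.state_nonneg hch hb (A := A' - A) (sub_nonneg.2 h)
  rw [map_sub] at h1
  exact sub_nonneg.1 h1

theorem state_module (ms : List (Slice T)) : ∀ {l : Slice T},
    (l :: ms).IsChain (fun m m' => CausalLE m'.1 m.1) → ∀ (b : Cls T → Set X.Ω) (A : R.alg l)
    {a : K →L[ℂ] K} (ha : a ∈ X.sliceAlg l),
    state ρ θ b l ms (A * R.iota l ⟨a, ha⟩) = state ρ θ b l ms A * a := by
  induction ms with
  | nil =>
    intro l _ b A a ha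
    rw [state_nil, state_nil, ← mul_assoc, hR.module_ρ]
  | cons m ms ih =>
    intro l hch b A a ha
    rw [List.isChain_cons_cons] at hch
    rw [state_cons, state_cons, ← mul_assoc,
      hR.module_θ m l hch.1 _ a (sliceAlg_anti hch.1 ha) ha, ih hch.2]

theorem ultraweak_mulLeft {l : Slice T} {b : Cls T → Set X.Ω} (hb : b ∈ X.Paths)
    {ξ η : ℕ → R.G l} (hξ : SqSummable ξ) (hη : SqSummable η) :
    ∃ ξ' η' : ℕ → R.G l, SqSummable ξ' ∧ SqSummable η' ∧ ∀ A : R.alg l,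
      ∑' n, ⟪ξ n, ((R.event l (X.box b l.1) * A : R.alg l) : R.G l →L[ℂ] R.G l) (η n)⟫_ℂ =
        ∑' n, ⟪ξ' n, (A : R.G l →L[ℂ] R.G l) (η' n)⟫_ℂ := by
  have he := isStarProjection_event (R := R) (box_mem_sliceEvents hb l)
  refine ⟨fun n => (R.event l (X.box b l.1) : R.G l →L[ℂ] R.G l) (ξ n), η, ?_, hη, fun A => ?_⟩
  · refine Summable.of_nonneg_of_le (fun n => by positivity) (fun n => ?_) hξ
    exact pow_le_pow_left₀ (norm_nonneg _) (norm_apply_le_of_isStarProjection he _) 2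
  · refine tsum_congr fun n => ?_
    rw [MulMemClass.coe_mul, mul_apply_eq_comp, ← ContinuousLinearMap.adjoint_inner_left,
      ← ContinuousLinearMap.star_eq_adjoint, he.isSelfAdjoint.star_eq]

theorem state_ultraweak (ms : List (Slice T)) : ∀ {l : Slice T},
    (l :: ms).IsChain (fun m m' => CausalLE m'.1 m.1) → ∀ {b : Cls T → Set X.Ω}, b ∈ X.Paths →
    ∀ {ξ η : ℕ → K}, SqSummable ξ → SqSummable η →
    ∃ ξ' η' : ℕ → R.G l, SqSummable ξ' ∧ SqSummable η' ∧ ∀ A : R.alg l,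
      ∑' n, ⟪ξ n, state ρ θ b l ms A (η n)⟫_ℂ =
        ∑' n, ⟪ξ' n, (A : R.G l →L[ℂ] R.G l) (η' n)⟫_ℂ := by
  induction ms with
  | nil =>
    intro l _ b hb ξ η hξ hη
    obtain ⟨ξ₁, η₁, h1, h2, h3⟩ := (hR.normal_ρ l).ultraweak ξ η hξ hη
    obtain ⟨ξ₂, η₂, h4, h5, h6⟩ := hR.ultraweak_mulLeft hb h1 h2
    exact ⟨ξ₂, η₂, h4, h5, fun A => by rw [← h6, ← h3, state_nil]⟩
  | cons m ms ih =>
    intro l hch b hb ξ η hξ hη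
    rw [List.isChain_cons_cons] at hch
    obtain ⟨ξ₀, η₀, h1, h2, h3⟩ := ih hch.2 hb hξ hη
    obtain ⟨ξ₁, η₁, h4, h5, h6⟩ := (hR.normal_θ m l hch.1).ultraweak ξ₀ η₀ h1 h2
    obtain ⟨ξ₂, η₂, h7, h8, h9⟩ := hR.ultraweak_mulLeft hb h4 h5
    refine ⟨ξ₂, η₂, h7, h8, fun A => ?_⟩
    rw [← h9, ← h6, state_cons, h3]
    rfl

/-- The chain is split at `l`: `ms` descends from it, `ls` ascends, and `A` stands for the part of
the nested expression beyond the event of `l`. Induction moves the slices of `ms` one by one to the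
ascending side until the regression formula applies. -/
theorem kernel_eq_state (ms : List (Slice T)) : ∀ {l : Slice T} {ls : List (Slice T)},
    (l :: ms).IsChain (fun m m' => CausalLE m'.1 m.1) →
    (l :: ls).IsChain (fun m m' => CausalLE m.1 m'.1) → ∀ {b b' : Cls T → Set X.Ω},
    b ∈ X.Paths → b' ∈ X.Paths →
    (∀ c, (∀ m ∈ ms, c ∉ clsOf m.1) → (∀ m ∈ l :: ls, c ∉ clsOf m.1) →
      b c = Set.univ ∧ b' c = Set.univ) → ∀ {A : R.alg l},
    R.event l (X.box (b ⊓ b') l.1) * A = R.nested θ (b ⊓ b') l ls →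
    κ b b' = state ρ θ (b ⊓ b') l ms A := by
  induction ms with
  | nil =>
    intro l ls _ hls b b' hb hb' hc A hA
    rw [state_nil, hA]
    exact hR.regression l ls hls b hb b' hb' fun c h => hc c (by simp) h
  | cons m ms ih =>
    intro l ls hms hls b b' hb hb' hc A hA
    rw [List.isChain_cons_cons] at hms
    rw [state_cons, hA]
    refine ih hms.2 (ls := l :: ls) (List.isChain_cons_cons.2 ⟨hms.1, hls⟩) hb hb'
      (fun c h h' => hc c (fun n hn => ?_) fun n hn => h' n (List.mem_cons_of_mem _ hn)) rfl
    rcases List.mem_cons.1 hn with rfl | hn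
    · exact h' _ List.mem_cons_self
    · exact h n hn

/-- The regression formula contains the two paths only through their intersection, and a chain
covering the support of `b ⊓ b'` covers both supports. -/
theorem kernel_inf {b b' : Cls T → Set X.Ω} (hb : b ∈ X.Paths) (hb' : b' ∈ X.Paths) :
    κ b b' = κ (b ⊓ b') (b ⊓ b') := by
  have hd := X.paths_inter hb hb'
  obtain ⟨l, -, hdl, -⟩ := X.exists_slice_of_past (k := ∅) nonanticipatory_empty
    (b := b ⊓ b') (b' := b ⊓ b') ⟨hd, by simp⟩ ⟨hd, by simp⟩
  obtain ⟨ms, hms, hcov⟩ := exists_chain_covering hdl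
  have h1 := hR.kernel_eq_state ms (ls := []) hms (List.isChain_singleton _) hb hb'
    (fun c hc _ => inf_eq_top_iff.1 (hcov c hc)) (mul_one _)
  have h2 := hR.kernel_eq_state ms (ls := []) hms (List.isChain_singleton _) hd hd
    (fun c hc _ => ⟨hcov c hc, hcov c hc⟩) (mul_one _)
  rw [h1, h2]
  simp only [inf_idem]

end IsRegression

end SliceReps

/-- Put the event into a countable partition. By σ-additivity the values `κ(dβ, dβ)` of the members
add up to `κ(d, d)`, while finite sums of the upper bounds `C` do not exceed it; so no bound can be
strict. The value `C ∅` needs separate treatment because over `k = ∅` the empty event is not a box.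
-/
theorem kernel_eq_of_sandwich (hκ : X.IsWideSense κ) (hv : IsDilation X κ vec) {k : Finset T}
    (hk : Nonanticipatory (k : Set T)) {d : Cls T → Set X.Ω} (hd : d ∈ X.Past (k : Set T))
    {C : Set X.Ω → K →L[ℂ] K} (h0 : 0 ≤ C ∅)
    (hC : ∀ β ∈ X.PathsOn k, κ (d ⊓ β) (d ⊓ β) ≤ C (X.box β (k : Set T)))
    (hsum : ∀ f : ℕ → Set X.Ω, (∀ m, f m ∈ X.𝓑 k) →
      Pairwise (fun m m' => Disjoint (f m) (f m')) → ∀ F : Finset ℕ,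
      ∑ m ∈ F, C (f m) ≤ κ d d) {β : Cls T → Set X.Ω} (hβ : β ∈ X.PathsOn k) :
    κ (d ⊓ β) (d ⊓ β) = C (X.box β (k : Set T)) := by
  refine eq_of_le_of_re_inner (hC β hβ) fun ζ => ?_
  obtain ⟨f, hf, hdis, hun, m₀, hm₀⟩ := (X.semiring k hk).partition _ (X.box_mem_events k hk β hβ)
  have hnorm : ∀ b ∈ X.Paths, ‖vec b ζ‖ ^ 2 = (⟪ζ, κ b b ζ⟫_ℂ).re := by
    intro b hb
    rw [← hv.inner b hb b hb, ← inner_self_eq_norm_sq (𝕜 := ℂ)]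
    rfl
  have hev : ∀ β ∈ X.PathsOn k, ‖evOp vec k (X.box β (k : Set T)) (vec d ζ)‖ ^ 2 =
      (⟪ζ, κ (d ⊓ β) (d ⊓ β) ζ⟫_ℂ).re := by
    intro β hβ
    rw [(evOp_box_spec hκ hv hk hβ).2.on d hd,
      hnorm _ (X.past_inter hd (X.pathsOn_subset_past hk hβ)).1]
  have h1 := evOp_sigma_additive hκ hv hk hf hdis hun (vec d ζ)
  have h2 : evOp vec k Set.univ (vec d ζ) = vec d ζ := by
    rw [evOp_univ hκ hv hk]
    exact Submodule.starProjection_eq_self_iff.2 (vec_mem_gen hd _)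
  rw [h2] at h1
  have h3 : HasSum (fun m => ‖evOp vec k (f m) (vec d ζ)‖ ^ 2) (⟪ζ, κ d d ζ⟫_ℂ).re := by
    have h4 := Complex.hasSum_re ((innerSL ℂ (vec d ζ)).hasSum h1)
    rw [← hv.inner d hd.1 d hd.1]
    refine h4.congr_fun fun m => ?_
    exact norm_sq_of_isStarProjection (evOp_isStarProjection hκ hv hk (hf m)) _
  have h5 := eq_of_hasSum_of_le (c := fun m => (⟪ζ, C (f m) ζ⟫_ℂ).re) (fun m => ?_) h3
    (fun F => ?_) m₀
  · simpa only [hm₀, hev β hβ] using h5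
  · rcases events_cases hk (hf m) with h | ⟨β', hβ', h⟩
    · rw [h, evOp_empty]
      have h6 := re_inner_le_of_le h0 ζ
      simpa using h6
    · rw [← h, hev β' hβ']
      exact re_inner_le_of_le (hC β' hβ') ζ
  · have h6 := re_inner_le_of_le (hsum f hf hdis F) ζ
    rwa [sum_apply, inner_sum, Complex.re_sum] at h6

end States

/-! ### The conditional Markov property -/

section Markov

variable {S : Type uS} {T : Type uT} {K : Type uK} [Semigroup S] [Preorder T] [CausalAction S T]
  [NormedAddCommGroup K] [InnerProductSpace ℂ K] [CompleteSpace K]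
  {X : Setting.{uS, uT, uE, uK} S T K}
  {κ : (Cls T → Set X.Ω) → (Cls T → Set X.Ω) → K →L[ℂ] K}
  {H : Type uH} [NormedAddCommGroup H] [InnerProductSpace ℂ H] [CompleteSpace H]
  {vec : (Cls T → Set X.Ω) → K →L[ℂ] H}
  {R : SliceReps.{uS, uT, uE, uK, uG} X}
  {ρ : ∀ l : Slice T, R.alg l →ₗ[ℂ] (K →L[ℂ] K)}
  {θ : ∀ l l' : Slice T, R.alg l' →ₗ[ℂ] R.alg l}

open SliceReps

theorem mem_sliceEvents_of_mem {l : Slice T} {k : Finset T} (hk : (k : Set T) ⊆ l.1)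
    {B : Set X.Ω} (hB : B ∈ X.𝓑 k) : B ∈ X.sliceEvents l := ⟨k, hk, hB⟩

theorem pathsOn_covered {l : Slice T} {k : Finset T} (hk : (k : Set T) ⊆ l.1)
    {β : Cls T → Set X.Ω} (hβ : β ∈ X.PathsOn k) {c : Cls T} (hc : c ∉ clsOf l.1) :
    β c = Set.univ := (hβ c).2 fun h => hc (Set.image_mono hk h)

/-- The event of the path `d ⊓ β` on a slice that contains the support of `β`. -/
theorem event_inf {l : Slice T} {k : Finset T} (hk : (k : Set T) ⊆ l.1)
    {d β : Cls T → Set X.Ω} (hd : d ∈ X.Paths) (hβ : β ∈ X.PathsOn k) :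
    R.event l (X.box (d ⊓ β) l.1) =
      R.event l (X.box d l.1) * R.event l (X.box β (k : Set T)) := by
  rw [X.box_inter, box_eq_slice hk hβ, event_inter (box_mem_sliceEvents hd l)
    (box_mem_sliceEvents (X.pathsOn_subset_paths _ hβ) l)]

theorem kernel_eq_state_one (hR : R.IsRegression κ ρ θ) {l : Slice T} {ms : List (Slice T)}
    (hms : (l :: ms).IsChain (fun m m' => CausalLE m'.1 m.1)) {d : Cls T → Set X.Ω}
    (hd : d ∈ X.Paths)
    (hcov : ∀ c, (∀ m ∈ ms, c ∉ clsOf m.1) → c ∉ clsOf l.1 → d c = Set.univ) :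
    κ d d = state ρ θ d l ms 1 := by
  have h := hR.kernel_eq_state ms (ls := []) hms (List.isChain_singleton _) hd hd
    (fun c hc hc' => by
      have := hcov c hc (hc' l List.mem_cons_self)
      exact ⟨this, this⟩) (mul_one _)
  rwa [inf_idem] at h

theorem kernel_eq_state_next (hR : R.IsRegression κ ρ θ) {l l' : Slice T}
    (hll : CausalLE l.1 l'.1) {ms : List (Slice T)}
    (hms : (l :: ms).IsChain (fun m m' => CausalLE m'.1 m.1)) {d : Cls T → Set X.Ω}
    (hd : d ∈ X.Paths)
    (hcov : ∀ c, (∀ m ∈ ms, c ∉ clsOf m.1) → c ∉ clsOf l'.1 → d c = Set.univ) :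
    κ d d = state ρ θ d l ms (θ l l' (R.event l' (X.box d l'.1))) := by
  have h := hR.kernel_eq_state ms (ls := [l']) hms
    (List.isChain_cons_cons.2 ⟨hll, List.isChain_singleton _⟩) hd hd
    (fun c hc hc' => by
      have := hcov c hc (hc' l' (by simp))
      exact ⟨this, this⟩) (A := θ l l' (R.event l' (X.box (d ⊓ d) l'.1))) rfl
  rwa [inf_idem] at h

section

variable (hκ : X.IsWideSense κ) (hv : IsDilation X κ vec) (hR : R.IsRegression κ ρ θ)
  {l l' : Slice T} {ms : List (Slice T)}
  (hms : (l :: ms).IsChain (fun m m' => CausalLE m'.1 m.1)) {d : Cls T → Set X.Ω}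
  (hd : d ∈ X.PathsBelow l.1) (hcov : ∀ c, (∀ m ∈ ms, c ∉ clsOf m.1) → d c = Set.univ)
include hκ hv hR hms hd hcov

/-- The regression formula for `d ⊓ β` inserts `β` also into slices of `ms` that share classes with
`l`; dropping these insertions gives an upper bound, and the sandwich makes it exact. -/
theorem kernel_eq_state_event {k : Finset T} (hk : (k : Set T) ⊆ l.1) {β : Cls T → Set X.Ω}
    (hβ : β ∈ X.PathsOn k) :
    κ (d ⊓ β) (d ⊓ β) = state ρ θ d l ms (R.event l (X.box β (k : Set T))) := by
  have hkn : Nonanticipatory (k : Set T) := l.nonanticipatory.mono hk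
  refine kernel_eq_of_sandwich (C := fun B => state ρ θ d l ms (R.event l B)) hκ hv hkn
    (X.pathsBelow_subset_past l.nonanticipatory hk hd)
    (hR.state_nonneg hms hd.1 (event_nonneg (empty_mem_sliceEvents l))) (fun β hβ => ?_)
    (fun f hf hdis F => ?_) hβ
  · have hdβ := X.paths_inter hd.1 (X.pathsOn_subset_paths _ hβ)
    rw [kernel_eq_state_one hR hms hdβ fun c hc hc' => by
      rw [Pi.inf_apply, hcov c hc, pathsOn_covered hk hβ hc']; exact inf_idem _]
    refine hR.state_le ms hms hdβ hd.1 inf_le_left ?_ ?_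
    · rw [mul_one]; exact event_nonneg (box_mem_sliceEvents hdβ l)
    · rw [mul_one, event_inf hk hd.1 hβ]
  · have hf' := fun m => mem_sliceEvents_of_mem hk (hf m)
    rw [← map_sum, kernel_eq_state_one hR hms hd.1 fun c hc _ => hcov c hc]
    exact hR.state_mono hms hd.1 (le_one_of_isStarProjection
      (isStarProjection_sum_event hf' hdis F))

/-- The formula through `l'` has `θ(π_{l'}(d))` in place of `θ(1)` when `d` is nontrivial on `l'`.
So `d` is split into its part `δ` on `l'` and the rest `d₀`. For `d₀` the formula does give
`ω_{d₀}(θ(1))`; the sandwich yields `κ(d, d) = ω_{d₀}(π_l(δ) θ(1))`, which dominates `ω_d(θ(1))`. -/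
theorem state_θ_one_le (hll : CausalLE l.1 l'.1) : state ρ θ d l ms (θ l l' 1) ≤ κ d d := by
  obtain ⟨k, hk', hδ, hbox, hkd⟩ := X.exists_pathsOn_slice hd.1 l'
  -- A class of `d` on `l'` is below a point `u` of `l`, which is below a point of `l'`;
  -- nonanticipation of `l'` forces equivalence with `u`, so the class is on `l` too.
  have hk : (k : Set T) ⊆ l.1 := by
    intro t ht
    obtain ⟨u, hu, htu⟩ := hd.2 _ (hkd t ht)
    obtain ⟨w, hw, huw⟩ := hll u hu
    rw [cls_le_cls] at htu
    refine l.mem_of_cls_eq hu (cls_eq_cls.2 ⟨?_, htu⟩)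
    by_contra h
    exact l'.nonanticipatory t (hk' ht) w hw
      (lt_of_lt_of_le (lt_of_le_not_ge htu h) huw)
  have hkn : Nonanticipatory (k : Set T) := l.nonanticipatory.mono hk
  set δ := X.restrict d (clsOf l'.1) with hδdef
  set d₀ := X.restrict d (clsOf l'.1)ᶜ with hd₀def
  have hdd : d₀ ⊓ δ = d := X.restrict_inf_compl d _
  have hd₀ : d₀ ∈ X.PathsBelow l.1 := X.restrict_mem_pathsBelow hd _
  have hcov₀ : ∀ c, (∀ m ∈ ms, c ∉ clsOf m.1) → d₀ c = Set.univ := fun c hc => by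
    by_contra h
    exact (X.restrict_ne_univ h).2 (hcov c hc)
  have h1pos : 0 ≤ (θ l l' 1 : R.G l →L[ℂ] R.G l) :=
    hR.θ_nonneg hll (nonneg_of_isStarProjection (IsStarProjection.one _))
  have hmulpos : ∀ B ∈ X.sliceEvents l, ∀ A : R.alg l, 0 ≤ (A : R.G l →L[ℂ] R.G l) →
      0 ≤ ((R.event l B * A : R.alg l) : R.G l →L[ℂ] R.G l) := fun B hB A hA =>
    mul_nonneg_of_isStarProjection (isStarProjection_event hB) (commute_event hB _) hA
  have key := kernel_eq_of_sandwich (C := fun B => state ρ θ d₀ l ms (R.event l B * θ l l' 1))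
    hκ hv hkn (X.pathsBelow_subset_past l.nonanticipatory hk hd₀)
    (hR.state_nonneg hms hd₀.1 (hmulpos _ (empty_mem_sliceEvents l) _ h1pos)) (fun β hβ => ?_)
    (fun f hf hdis F => ?_) hδ
  · rw [hdd] at key
    rw [key]
    refine hR.state_le ms hms hd.1 hd₀.1 (hdd ▸ inf_le_left)
      (hmulpos _ (box_mem_sliceEvents hd.1 l) _ h1pos) ?_
    have h2 := event_inf (R := R) hk hd₀.1 hδ
    rw [hdd] at h2
    rw [h2, mul_assoc]
  · have hd₀β := X.paths_inter hd₀.1 (X.pathsOn_subset_paths _ hβ)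
    have hev := box_mem_sliceEvents hd₀β l'
    rw [kernel_eq_state_next hR hll hms hd₀β fun c hc hc' => by
      rw [Pi.inf_apply, hcov₀ c hc, pathsOn_covered hk' hβ hc']; exact inf_idem _]
    have h2 := hR.θ_mono hll (A := R.event l' (X.box (d₀ ⊓ β) l'.1)) (A' := 1)
      (le_one_of_isStarProjection (isStarProjection_event hev))
    have h3 := hR.θ_nonneg hll (event_nonneg (R := R) hev)
    have hbe := box_mem_sliceEvents hd₀β l
    refine hR.state_le ms hms hd₀β hd₀.1 inf_le_left (hmulpos _ hbe _ h3) ?_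
    rw [← mul_assoc, ← event_inf hk hd₀.1 hβ]
    exact mul_le_mul_of_isStarProjection (isStarProjection_event hbe) (isStarProjection_event hbe)
      (isStarProjection_event hbe).isIdempotentElem (commute_event hbe _) (commute_event hbe _)
      (commute_event hbe _) h3 h2
  · have hf' := fun m => mem_sliceEvents_of_mem hk (hf m)
    have hb1 : X.box d₀ l'.1 = Set.univ := by
      rw [← X.box_unit l'.1]
      exact X.box_congr fun c hc => X.restrict_of_notMem d (fun h => h hc)
    rw [← map_sum, ← Finset.sum_mul, kernel_eq_state_next hR hll hms hd₀.1
      fun c hc _ => hcov₀ c hc, hb1, event_univ]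
    refine hR.state_mono hms hd₀.1 ?_
    have hcomm : ∀ A : R.alg l, Commute
        ((∑ m ∈ F, R.event l (f m) : R.alg l) : R.G l →L[ℂ] R.G l) (A : R.G l →L[ℂ] R.G l) := by
      intro A
      rw [AddSubmonoidClass.coe_finsetSum]
      exact Commute.sum_left _ _ _ fun m _ => commute_event (hf' m) A
    have h2 := mul_le_mul_of_isStarProjection (isStarProjection_sum_event (R := R) hf' hdis F)
      (IsStarProjection.one _) (mul_one _) (hcomm (θ l l' 1)) (Commute.one_left _)
      (Commute.one_left _) h1pos le_rfl
    rwa [one_mul] at h2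

/-- The regression formula again gives an upper bound once insertions of `β` outside `l'` and of `d`
on `l'` are dropped. The total needed by the sandwich is `ω_d(θ(1)) ≤ κ(d, d)`, from
`state_θ_one_le`. -/
theorem kernel_eq_state_θ_event (hll : CausalLE l.1 l'.1) {k : Finset T}
    (hk : (k : Set T) ⊆ l'.1) {β : Cls T → Set X.Ω} (hβ : β ∈ X.PathsOn k) :
    κ (d ⊓ β) (d ⊓ β) = state ρ θ d l ms (θ l l' (R.event l' (X.box β (k : Set T)))) := by
  have hkn : Nonanticipatory (k : Set T) := l'.nonanticipatory.mono hk
  refine kernel_eq_of_sandwich (C := fun B => state ρ θ d l ms (θ l l' (R.event l' B))) hκ hv hkn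
    (X.pathsBelow_subset_past l'.nonanticipatory hk (X.pathsBelow_mono hll hd))
    (hR.state_nonneg hms hd.1 (hR.θ_nonneg hll (event_nonneg (empty_mem_sliceEvents l'))))
    (fun β hβ => ?_) (fun f hf hdis F => ?_) hβ
  · have hβp := X.pathsOn_subset_paths _ hβ
    have hdβ := X.paths_inter hd.1 hβp
    rw [kernel_eq_state_next hR hll hms hdβ fun c hc hc' => by
      rw [Pi.inf_apply, hcov c hc, pathsOn_covered hk hβ hc']; exact inf_idem _]
    have hbe := box_mem_sliceEvents hdβ l
    have hbd := box_mem_sliceEvents hd.1 l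
    have hbd' := box_mem_sliceEvents hd.1 l'
    have hβe := mem_sliceEvents_of_mem hk (X.box_mem_events k hkn β hβ)
    have h1 : (R.event l' (X.box (d ⊓ β) l'.1) : R.G l' →L[ℂ] R.G l') ≤
        R.event l' (X.box β (k : Set T)) := by
      rw [event_inf hk hd.1 hβ]
      have h2 := mul_le_mul_of_isStarProjection (isStarProjection_event (R := R) hbd')
        (IsStarProjection.one _) (mul_one _) (commute_event hbd' (R.event l' (X.box β (k : Set T))))
        (Commute.one_left _) (Commute.one_left _) (event_nonneg hβe) le_rfl
      rwa [one_mul] at h2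
    have h3 := hR.θ_nonneg hll (event_nonneg (R := R) (box_mem_sliceEvents hdβ l'))
    refine hR.state_le ms hms hdβ hd.1 inf_le_left
      (mul_nonneg_of_isStarProjection (isStarProjection_event hbe) (commute_event hbe _) h3) ?_
    refine mul_le_mul_of_isStarProjection (isStarProjection_event hbe)
      (isStarProjection_event hbd) ?_ (commute_event hbe _) (commute_event hbd _)
      (commute_event hbd _) h3 (hR.θ_mono hll h1)
    rw [← MulMemClass.coe_mul, ← event_inter hbe hbd, Set.inter_eq_left.2]
    rw [X.box_inter]
    exact Set.inter_subset_left
  · have hf' := fun m => mem_sliceEvents_of_mem hk (hf m)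
    rw [← map_sum, ← map_sum]
    refine le_trans (hR.state_mono hms hd.1 (hR.θ_mono hll (A' := 1) ?_))
      (state_θ_one_le hκ hv hR hms hd hcov hll)
    exact le_one_of_isStarProjection (isStarProjection_sum_event hf' hdis F)

end

end Markov

/-! ### Transfer to the canonical realization -/

section Markov

variable {S : Type uS} {T : Type uT} {K : Type uK} [Semigroup S] [Preorder T] [CausalAction S T]
  [NormedAddCommGroup K] [InnerProductSpace ℂ K] [CompleteSpace K]
  {X : Setting.{uS, uT, uE, uK} S T K}
  {κ : (Cls T → Set X.Ω) → (Cls T → Set X.Ω) → K →L[ℂ] K}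
  {H : Type uH} [NormedAddCommGroup H] [InnerProductSpace ℂ H] [CompleteSpace H]
  {vec : (Cls T → Set X.Ω) → K →L[ℂ] H}
  {R : SliceReps.{uS, uT, uE, uK, uG} X}
  {ρ : ∀ l : Slice T, R.alg l →ₗ[ℂ] (K →L[ℂ] K)}
  {θ : ∀ l l' : Slice T, R.alg l' →ₗ[ℂ] R.alg l}

open SliceReps

theorem sliceProj_eq (hκ : X.IsWideSense κ) (hv : IsDilation X κ vec) (l : Slice T) :
    sliceProj X (embK hκ hv) (iotaRep hκ hv) (evOp vec) l =
      (gen vec (X.PathsBelow l.1)).starProjection := by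
  simp only [sliceProj, sliceSpace_eq hκ hv]

theorem sliceOp_one (hκ : X.IsWideSense κ) (hv : IsDilation X κ vec) (l : Slice T) :
    sliceOp vec l 1 = (gen vec (X.PathsBelow l.1)).starProjection :=
  algOp_one hv (X.pathsBelow_subset_paths _) (commutesOn_slice hκ l)

/-- The events of a slice, as paths, together with the elements of its algebra. -/
def SliceIndex (X : Setting.{uS, uT, uE, uK} S T K) (l : Slice T) :=
  {i : (Cls T → Set X.Ω) × X.sliceAlg l // ∃ k : Finset T, (k : Set T) ⊆ l.1 ∧ i.1 ∈ X.PathsOn k}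

/-- `π_l(B) ι_l(a)` on the space `G_l`. -/
def sliceLeft (R : SliceReps.{uS, uT, uE, uK, uG} X) (l : Slice T) (i : SliceIndex X l) :
    R.G l →L[ℂ] R.G l := R.π l (X.box i.1.1 l.1) * R.ι l i.1.2

/-- `π_l(B) ι_l(a)` on the space of the dilation. -/
def sliceRight (vec : (Cls T → Set X.Ω) → K →L[ℂ] H) (l : Slice T) (i : SliceIndex X l) :
    H →L[ℂ] H :=
  opOn vec (X.PathsBelow l.1) fun b ζ => vec (b ⊓ i.1.1) ((i.1.2 : K →L[ℂ] K) ζ)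

theorem isOpOn_evOp_mul_sliceOp (hκ : X.IsWideSense κ) (hv : IsDilation X κ vec) {l : Slice T}
    {k : Finset T} (hk : (k : Set T) ⊆ l.1) {β : Cls T → Set X.Ω} (hβ : β ∈ X.PathsOn k)
    {a : K →L[ℂ] K} (ha : a ∈ X.sliceAlg l) :
    IsOpOn vec (X.PathsBelow l.1) (fun b ζ => vec (b ⊓ β) (a ζ))
      (evOp vec k (X.box β (k : Set T)) * sliceOp vec l a) where
  on b hb ζ := by
    rw [mul_apply_eq_comp, (isOpOn_sliceOp hκ hv ha).on b hb,
      (evOp_box_spec hκ hv (l.nonanticipatory.mono hk) hβ).2.on b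
        (X.pathsBelow_subset_past l.nonanticipatory hk hb)]
  off x hx := by rw [mul_apply_eq_comp, (isOpOn_sliceOp hκ hv ha).off x hx, map_zero]

theorem sliceRight_eq (hκ : X.IsWideSense κ) (hv : IsDilation X κ vec) {l : Slice T}
    (i : SliceIndex X l) {k : Finset T} (hk : (k : Set T) ⊆ l.1) (hβ : i.1.1 ∈ X.PathsOn k) :
    sliceRight vec l i = evOp vec k (X.box i.1.1 (k : Set T)) * sliceOp vec l i.1.2 :=
  (isOpOn_evOp_mul_sliceOp hκ hv hk hβ i.1.2.2).eq

theorem isOpOn_sliceRight (hκ : X.IsWideSense κ) (hv : IsDilation X κ vec) {l : Slice T}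
    (i : SliceIndex X l) : IsOpOn vec (X.PathsBelow l.1)
      (fun b ζ => vec (b ⊓ i.1.1) ((i.1.2 : K →L[ℂ] K) ζ)) (sliceRight vec l i) := by
  obtain ⟨k, hk, hβ⟩ := i.2
  rw [sliceRight_eq hκ hv i hk hβ]
  exact isOpOn_evOp_mul_sliceOp hκ hv hk hβ i.1.2.2

theorem SliceIndex.mem_pathsBelow {l : Slice T} (i : SliceIndex X l) :
    i.1.1 ∈ X.PathsBelow l.1 := by
  obtain ⟨k, hk, hβ⟩ := i.2
  exact X.pathsOn_subset_pathsBelow (CausalLE.of_subset hk) hβ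

theorem SliceIndex.box_mem {l : Slice T} (i : SliceIndex X l) :
    X.box i.1.1 l.1 ∈ X.sliceEvents l := box_mem_sliceEvents i.mem_pathsBelow.1 l

theorem isRepPair_slice (hκ : X.IsWideSense κ) (hv : IsDilation X κ vec) (l : Slice T) :
    IsRepPair (sliceLeft R l) (sliceRight vec l) (gen vec (X.PathsBelow l.1)).starProjection where
  mul i j := by
    obtain ⟨k, hk, hβ⟩ := i.2
    obtain ⟨k', hk', hβ'⟩ := j.2
    let n : SliceIndex X l := ⟨(i.1.1 ⊓ j.1.1, i.1.2 * j.1.2), union k k', fun t ht =>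
        (mem_union.1 ht).elim (fun h => hk h) fun h => hk' h,
      X.pathsOn_inter (X.pathsOn_mono (fun t ht => mem_union.2 (Or.inl ht)) hβ)
        (X.pathsOn_mono (fun t ht => mem_union.2 (Or.inr ht)) hβ')⟩
    refine ⟨n, ?_, ?_⟩
    · change R.π l (X.box (i.1.1 ⊓ j.1.1) l.1) * R.ι l (i.1.2 * j.1.2) =
        R.π l _ * R.ι l _ * (R.π l _ * R.ι l _)
      rw [X.box_inter, R.multiplicative l _ i.box_mem _ j.box_mem, map_mul, mul_assoc, mul_assoc,
        ← mul_assoc (R.ι l i.1.2), ← (R.commute l _ j.box_mem i.1.2).eq, mul_assoc]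
    · refine (isOpOn_sliceRight hκ hv n).unique ⟨fun b hb ζ => ?_, fun x hx => ?_⟩
      · rw [mul_apply_eq_comp, (isOpOn_sliceRight hκ hv j).on b hb,
          (isOpOn_sliceRight hκ hv i).on _ (X.pathsBelow_inter hb j.mem_pathsBelow), inf_assoc,
          inf_comm j.1.1]
        rfl
      · rw [mul_apply_eq_comp, (isOpOn_sliceRight hκ hv j).off x hx, map_zero]
  star i := by
    obtain ⟨k, hk, hβ⟩ := i.2
    let n : SliceIndex X l := ⟨(i.1.1, star i.1.2), k, hk, hβ⟩
    have hkn := l.nonanticipatory.mono hk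
    refine ⟨n, ?_, ?_⟩
    · change R.π l _ * R.ι l (star i.1.2) = star (R.π l _ * R.ι l _)
      rw [star_mul, (R.projection l _ i.box_mem).isSelfAdjoint.star_eq, map_star]
      have := R.commute l _ i.box_mem (star i.1.2)
      rwa [map_star] at this
    · rw [sliceRight_eq hκ hv n hk hβ, sliceRight_eq hκ hv i hk hβ, star_mul,
        (evOp_box_spec hκ hv hkn hβ).1.isSelfAdjoint.star_eq, ← sliceOp_star hκ hv i.1.2.2]
      exact evOp_commute_algOp hκ hv l.nonanticipatory hk (X.box_mem_events k hkn _ hβ)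
        (commutesOn_slice hκ l) (star_mem i.1.2.2)
  one := by
    let n : SliceIndex X l := ⟨(X.unit, 1), ∅, by simp, X.unit_mem_pathsOn ∅⟩
    refine ⟨n, ?_, ?_⟩
    · change R.π l (X.box X.unit l.1) * R.ι l 1 = 1
      rw [X.box_unit, R.unital, map_one, one_mul]
    · rw [sliceRight_eq hκ hv n (k := ∅) (by simp) (X.unit_mem_pathsOn ∅)]
      change evOp vec ∅ (X.box X.unit _) * sliceOp vec l 1 = _
      rw [X.box_unit, (isHSystem hκ hv).unit_empty, one_mul, sliceOp_one hκ hv]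

theorem commute_of_commute_sliceLeft {l : Slice T} (A : R.alg l) {Z : R.G l →L[ℂ] R.G l}
    (hZ : ∀ i : SliceIndex X l, Commute Z (sliceLeft R l i)) :
    Commute Z (A : R.G l →L[ℂ] R.G l) := by
  have h1 : Z ∈ StarSubalgebra.centralizer ℂ (R.gens l) := by
    have hπ : ∀ B ∈ X.sliceEvents l, R.π l B * Z = Z * R.π l B := by
      rintro B ⟨k, hk, hB⟩
      rcases events_cases (l.nonanticipatory.mono hk) hB with rfl | ⟨β, hβ, rfl⟩
      · rw [π_empty, zero_mul, mul_zero]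
      · have h := hZ ⟨(β, 1), k, hk, hβ⟩
        change Commute Z (R.π l (X.box β l.1) * R.ι l 1) at h
        rw [map_one, mul_one, ← box_eq_slice hk hβ] at h
        exact h.eq.symm
    have hι : ∀ a : X.sliceAlg l, R.ι l a * Z = Z * R.ι l a := by
      intro a
      have h := hZ ⟨(X.unit, a), ∅, by simp, X.unit_mem_pathsOn ∅⟩
      change Commute Z (R.π l (X.box X.unit l.1) * R.ι l a) at h
      rw [X.box_unit, R.unital, one_mul] at h
      exact h.eq.symm
    rw [StarSubalgebra.mem_centralizer_iff]
    rintro _ (⟨B, hB, rfl⟩ | ⟨a, rfl⟩)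
    · rw [(R.projection l B hB).isSelfAdjoint.star_eq]
      exact ⟨hπ B hB, hπ B hB⟩
    · rw [← map_star]
      exact ⟨hι a, hι _⟩
  exact ((StarSubalgebra.mem_centralizer_iff ℂ).1 A.2 _ h1).1

theorem exists_lp_of_state (hR : R.IsRegression κ ρ θ) {l : Slice T} {ms : List (Slice T)}
    (hms : (l :: ms).IsChain (fun m m' => CausalLE m'.1 m.1)) {d : Cls T → Set X.Ω}
    (hd : d ∈ X.Paths) (ζ ζ' : K) : ∃ ξ η : lp (fun _ : ℕ => R.G l) 2, ∀ A : R.alg l,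
      ⟪ζ, state ρ θ d l ms A ζ'⟫_ℂ = ⟪ξ, amp ℕ (A : R.G l →L[ℂ] R.G l) η⟫_ℂ := by
  -- A single matrix element is the ultraweak functional of sequences supported at `0`.
  have hs : ∀ z : K, SqSummable (Pi.single 0 z : ℕ → K) := fun z =>
    summable_of_ne_finset_zero (s := {0}) fun n hn => by
      rw [Pi.single_eq_of_ne (by simpa using hn)]; simp
  obtain ⟨ξ, η, hξ, hη, h⟩ := hR.state_ultraweak ms hms hd (hs ζ) (hs ζ')
  refine ⟨⟨ξ, memℓp_two hξ⟩, ⟨η, memℓp_two hη⟩, fun A => ?_⟩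
  rw [lp.inner_eq_tsum]
  refine Eq.trans ?_ (h A)
  rw [tsum_eq_single 0 fun n hn => by rw [Pi.single_eq_of_ne hn, inner_zero_left],
    Pi.single_eq_same, Pi.single_eq_same]

/-- Instance of `commute_of_ultraweak` with `A = θ(π_{l'}(B))` and `Φ = E_l π_{l'}(B) E_l`. For
generators `vec b ζ`, `vec b' ζ'` the functional is the matrix element of `ω_d` at `ζ`, `ζ'` with `d
= b ⊓ b'`; the module property of the state accounts for the factors `ι_l(a)`. -/
theorem commute_compression (hκ : X.IsWideSense κ) (hv : IsDilation X κ vec)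
    (hR : R.IsRegression κ ρ θ) {l l' : Slice T} (hll : CausalLE l.1 l'.1) {k : Finset T}
    (hk : (k : Set T) ⊆ l'.1) {β : Cls T → Set X.Ω} (hβ : β ∈ X.PathsOn k) {Y : H →L[ℂ] H}
    (hY : ∀ i : SliceIndex X l, Commute Y (sliceRight vec l i)) :
    Commute Y ((gen vec (X.PathsBelow l.1)).starProjection *
      evOp vec k (X.box β (k : Set T)) * (gen vec (X.PathsBelow l.1)).starProjection) := by
  set E := (gen vec (X.PathsBelow l.1)).starProjection with hE
  have hEp : IsStarProjection E := isStarProjection_starProjection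
  have hkn := l'.nonanticipatory.mono hk
  have hβe : X.box β (k : Set T) ∈ X.sliceEvents l' := ⟨k, hk, X.box_mem_events k hkn β hβ⟩
  have hβp := X.pathsOn_subset_paths _ hβ
  refine commute_of_ultraweak (isRepPair_slice (R := R) hκ hv l)
    (A := θ l l' (R.event l' (X.box β (k : Set T)))) ?_
    (fun Z hZ => commute_of_commute_sliceLeft _ hZ) ?_ ?_ ?_
    (D := {x : H | ∃ b ∈ X.PathsBelow l.1, ∃ ζ, x = vec b ζ}) ?_ ?_ hY
  · exact (IsSelfAdjoint.of_nonneg (hR.θ_nonneg hll (event_nonneg hβe))).star_eq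
  · rw [star_mul, star_mul, hEp.isSelfAdjoint.star_eq,
      (evOp_box_spec hκ hv hkn hβ).1.isSelfAdjoint.star_eq, mul_assoc]
  · rw [← mul_assoc, ← mul_assoc, hEp.isIdempotentElem.eq]
  · rw [mul_assoc, hEp.isIdempotentElem.eq]
  · exact fun x => Submodule.starProjection_apply_mem _ x
  · rintro _ ⟨b, hb, ζ, rfl⟩ _ ⟨b', hb', ζ', rfl⟩
    have hd := X.pathsBelow_inter hb hb'
    obtain ⟨ms, hms, hcov⟩ := exists_chain_covering hd
    obtain ⟨ξ, η, hξη⟩ := exists_lp_of_state hR hms hd.1 ζ ζ'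
    have hker : ∀ β : Cls T → Set X.Ω, β ∈ X.Paths →
        κ b (b' ⊓ β) = κ ((b ⊓ b') ⊓ β) ((b ⊓ b') ⊓ β) := fun β hβ => by
      rw [hR.kernel_inf hb.1 (X.paths_inter hb'.1 hβ), inf_assoc]
    refine ⟨ξ, η, fun i => ?_, ?_⟩
    · obtain ⟨ki, hki, hβi⟩ := i.2
      have hip := X.pathsOn_subset_paths _ hβi
      have h1 : sliceLeft R l i =
          ((R.event l (X.box i.1.1 (ki : Set T)) * R.iota l i.1.2 : R.alg l) :
            R.G l →L[ℂ] R.G l) := by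
        rw [MulMemClass.coe_mul, box_eq_slice hki hβi, coe_event i.box_mem]; rfl
      rw [h1, ← hξη, (isOpOn_sliceRight hκ hv i).on b' hb',
        hv.inner _ hb.1 _ (X.paths_inter hb'.1 hip), hker _ hip,
        kernel_eq_state_event hκ hv hR hms hd hcov hki hβi,
        hR.state_module ms hms _ _ i.1.2.2, mul_apply_eq_comp]
    · rw [← hξη, ← kernel_eq_state_θ_event hκ hv hR hms hd hcov hll hk hβ, ← hker _ hβp,
        ← hv.inner _ hb.1 _ (X.paths_inter hb'.1 hβp), mul_apply_eq_comp, mul_apply_eq_comp,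
        Submodule.starProjection_eq_self_iff.2 (vec_mem_gen hb' _),
        (evOp_box_spec hκ hv hkn hβ).2.on b' (X.pathsBelow_subset_past l'.nonanticipatory hk
          (X.pathsBelow_mono hll hb')), ← ContinuousLinearMap.adjoint_inner_left,
        ← ContinuousLinearMap.star_eq_adjoint, hEp.isSelfAdjoint.star_eq,
        Submodule.starProjection_eq_self_iff.2 (vec_mem_gen hb _)]

theorem sliceOp_mem_sliceIota (hκ : X.IsWideSense κ) (hv : IsDilation X κ vec) {l : Slice T}
    {a : K →L[ℂ] K} (ha : a ∈ X.sliceAlg l) :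
    sliceOp vec l a ∈ sliceIota X (embK hκ hv) (iotaRep hκ hv) (evOp vec) l := by
  have ho := isOpOn_sliceOp hκ hv ha
  refine ⟨a, ha, ?_, fun k h hk => ?_⟩
  · rw [sliceProj_eq]
    refine ho.unique ⟨fun b hb ζ => ?_, fun x hx => ?_⟩
    · rw [mul_apply_eq_comp, Submodule.starProjection_eq_self_iff.2 (vec_mem_gen hb _),
        ho.on b hb]
    · rw [mul_apply_eq_comp, (Submodule.starProjection_apply_eq_zero_iff _).2 hx, map_zero]
  · have hkn := l.nonanticipatory.mono hk
    refine ((isOpOn_iotaRep hκ hv hkn ⟨a, h⟩).unique ⟨fun b hb ζ => ?_, fun x hx => ?_⟩).symm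
    · rw [mul_apply_eq_comp, (isOpOn_iotaRep hκ hv hkn 1).on b hb,
        ho.on b (X.pathsBelow_mono (CausalLE.of_subset hk) hb)]
      rfl
    · rw [mul_apply_eq_comp, (isOpOn_iotaRep hκ hv hkn 1).off x hx, map_zero]

theorem conditionallyMarkov (hκ : X.IsWideSense κ) (hv : IsDilation X κ vec)
    (hR : R.IsRegression κ ρ θ) :
    ConditionallyMarkov X (embK hκ hv) (iotaRep hκ hv) (evOp vec) := by
  rintro l l' hll _ ⟨k, hk, B, hB, rfl⟩
  rcases events_cases (l'.nonanticipatory.mono hk) hB with rfl | ⟨β, hβ, rfl⟩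
  · rw [evOp_empty, zero_mul, mul_zero, zero_mul]; exact zero_mem _
  -- The factor `E_{l'}` in `π_{l'}(B) = π_k(B) E_{l'}` is absorbed by `E_l ≤ E_{l'}`.
  have hEE : (gen vec (X.PathsBelow l'.1)).starProjection *
      (gen vec (X.PathsBelow l.1)).starProjection =
      (gen vec (X.PathsBelow l.1)).starProjection := by
    ext x
    rw [mul_apply_eq_comp]
    exact Submodule.starProjection_eq_self_iff.2 (gen_mono (X.pathsBelow_mono hll)
      (Submodule.starProjection_apply_mem _ _))
  rw [sliceProj_eq, sliceProj_eq, mul_assoc, mul_assoc, hEE, ← mul_assoc]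
  have key : ∀ Y ∈ StarSubalgebra.centralizer ℂ
      (slicePi X (embK hκ hv) (iotaRep hκ hv) (evOp vec) l ∪
        sliceIota X (embK hκ hv) (iotaRep hκ hv) (evOp vec) l),
      Commute Y ((gen vec (X.PathsBelow l.1)).starProjection *
        evOp vec k (X.box β (k : Set T)) * (gen vec (X.PathsBelow l.1)).starProjection) := by
    intro Y hY
    rw [StarSubalgebra.mem_centralizer_iff] at hY
    refine commute_compression hκ hv hR hll hk hβ fun i => ?_
    obtain ⟨ki, hki, hβi⟩ := i.2
    have h1 := (hY _ (Or.inl ⟨ki, hki, _,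
      X.box_mem_events ki (l.nonanticipatory.mono hki) _ hβi, rfl⟩)).1
    have h2 := (hY _ (Or.inr (sliceOp_mem_sliceIota hκ hv i.1.2.2))).1
    rw [sliceProj_eq] at h1
    have h3 : sliceRight vec l i = evOp vec ki (X.box i.1.1 (ki : Set T)) *
        (gen vec (X.PathsBelow l.1)).starProjection * sliceOp vec l i.1.2 := by
      rw [sliceRight_eq hκ hv i hki hβi, mul_assoc]
      congr 1
      rw [← sliceOp_one hκ hv]
      have := algOp_mul hv (X.pathsBelow_subset_paths _) (commutesOn_slice hκ l)
        (one_mem _) i.1.2.2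
      rwa [one_mul] at this
    rw [h3]
    exact Commute.mul_right h1.symm h2.symm
  refine (StarSubalgebra.mem_centralizer_iff ℂ).2 fun Y hY => ⟨key Y hY, key _ (star_mem hY)⟩

end Markov

end
end QSP

theorem theorem3 {S : Type uS} {T : Type uT} {K : Type uK} [Semigroup S] [Preorder T]
    [QSP.CausalAction S T] [NormedAddCommGroup K] [InnerProductSpace ℂ K] [CompleteSpace K]
    (X : QSP.Setting.{uS, uT, uE, uK} S T K)
    (κ : (QSP.Cls T → Set X.Ω) → (QSP.Cls T → Set X.Ω) → K →L[ℂ] K)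
    (hκ : X.IsWideSense κ) :
    ∃ (H : Type (max uT uE uK)) (_ : NormedAddCommGroup H) (_ : InnerProductSpace ℂ H)
      (_ : CompleteSpace H) (J : K →ₗᵢ[ℂ] H)
      (ι : ∀ k : Finset T, X.𝔄 k →⋆ₙₐ[ℂ] (H →L[ℂ] H))
      (π : Finset T → Set X.Ω → H →L[ℂ] H)
      (V : S →ₙ* (H →ₗᵢ[ℂ] H)),
      -- the canonical `S`-covariant realization
      (QSP.IsRepSystem X J ι ∧ QSP.IsHSystem X ι π ∧ QSP.IsCovariant X J ι π V ∧
        QSP.Realizes X J ι π κ ∧ QSP.IsCanonical X J ι π) ∧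
      -- regularity
      ((∀ k : Finset T, QSP.Nonanticipatory (k : Set T) → k ≠ ∅ →
          X.𝔄 k = ⨆ (l : QSP.Slice T) (_ : (k : Set T) ⊆ l.1), X.sliceAlg l) →
        X.AsymptoticNoncorrelation κ →
        (∀ x : H, ∀ ε > (0 : ℝ), ∃ l₀ : QSP.Slice T, ∀ l : QSP.Slice T,
          QSP.CausalLE l.1 l₀.1 → ‖QSP.sliceProj X J ι π l x - ι ∅ 1 x‖ ≤ ε) ∧
        ∃ ι' : ∀ k : Finset T, X.𝔄 k →⋆ₙₐ[ℂ] (H →L[ℂ] H),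
          QSP.IsRepSystem X J ι' ∧ QSP.IsHSystem X ι' π ∧ QSP.Realizes X J ι' π κ ∧
          (∀ k : Finset T, QSP.Nonanticipatory (k : Set T) →
            QSP.rangeI X ι' k =
              ⨅ (l : QSP.Slice T) (_ : (k : Set T) ⊆ l.1), QSP.sliceSpace X J ι π l) ∧
          ((∀ s : S, Function.Surjective (QSP.clsMap s : QSP.Cls T → QSP.Cls T)) →
            QSP.IsCovariant X J ι' π V)) ∧
      -- the conditional Markov property
      (∀ (R : QSP.SliceReps.{uS, uT, uE, uK, uG} X)
          (ρ : ∀ l : QSP.Slice T, R.alg l →ₗ[ℂ] (K →L[ℂ] K))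
          (θ : ∀ l l' : QSP.Slice T, R.alg l' →ₗ[ℂ] R.alg l),
          R.IsRegression κ ρ θ → QSP.ConditionallyMarkov X J ι π) := by
  obtain ⟨H, iN, iI, iC, vec, hv⟩ := QSP.exists_dilation hκ
  refine ⟨H, iN, iI, iC, QSP.embK hκ hv, QSP.iotaRep hκ hv, QSP.evOp vec, QSP.shift hκ hv,
    ⟨QSP.isRepSystem hκ hv, QSP.isHSystem hκ hv, QSP.isCovariant hκ hv, QSP.realizes hκ hv,
      QSP.isCanonical hκ hv⟩, fun hgen hasym => ⟨fun x ε hε => ?_, ?_⟩,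
    fun R ρ θ hR => QSP.conditionallyMarkov hκ hv hR⟩
  · simp only [QSP.sliceProj_eq hκ hv]
    exact QSP.tendsto_slice_projection hκ hv hasym x ε hε
  · have hs : ∀ k : Finset T, QSP.Nonanticipatory (k : Set T) → k ≠ ∅ → QSP.LocallySliced X k :=
      fun k hk h0 _ ha => QSP.exists_mem_sliceAlg hk (hgen k hk h0) ha
    exact ⟨QSP.iotaReg hκ hv, QSP.isRepSystem_iotaReg hκ hv hasym hs,
      QSP.isHSystem_iotaReg hκ hv hasym hs, QSP.realizes_iotaReg hκ hv,
      fun k hk => QSP.rangeI_iotaReg hκ hv hasym hs hk,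
      fun hsurj => QSP.isCovariant_iotaReg hκ hv hasym hs hsurj⟩
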